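/- Let $L>0$, $S=\mathbb R\times(0,L)$, $\Omega=\mathbb R/\mathbb Z\times(0,L)$, $\omega\in\mathbb R$, and let $\varepsilon\in L^\infty(S)$ be real-valued, $1$-periodic in $x_1$ and bounded below by a positive constant almost everywhere. Let $\gamma$ be one of the boundary conditions on $(0,L)$: Dirichlet $v(0)=v(L)=0$; Neumann $v'(0)=v'(L)=0$; mixed $v(0)=v'(L)=0$; or $\beta$-quasi-periodic $e^{i\beta}v(0)=v(L)$, $e^{i\beta}v'(0)=v'(L)$ with $\beta\in[0,2\pi)$. Let $(\psi_k)$ be the standard orthonormal basis of $L^2((0,L))$ of eigenfunctions of $-d^2/dt^2$ under $\gamma$, with eigenvalues $\kappa_k^2$, let $\varphi_{l}(x)=e^{2\pi i l_1x_1}\psi_{l_2}(x_2)$, and let $$H^2_\gamma(\Omega)=\Big\{u\in L^2(\Omega):\ \sum_l\big(1+(2\pi l_1)^2+\kappa_{l_2}^2\big)^2|\langle\varphi_l,u\rangle|^2<\infty\Big\}$$ with the corresponding norm. For $\xi\in\mathbb C$ define $\Delta_\xi,B_\xi:H^2_\gamma(\Omega)\to L^2(\Omega)$ by $$\Delta_\xi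 u=\Delta u+2i\xi\,\partial_{x_1}u-\xi^2u,\qquad B_\xi u=\Delta_\xi u+\omega^2\varepsilon u .$$ A root function of $(B_\xi)$ at $\xi_0\in\mathbb C$ is a function $\xi\mapsto u_\xi\in H^2_\gamma(\Omega)$, holomorphic near $\xi_0$, with $u_{\xi_0}\ne0$ and $B_{\xi_0}u_{\xi_0}=0$; its multiplicity is the order of $\xi_0$ as a root of $\xi\mapsto B_\xi u_\xi$. If one exists, $\xi_0$ is called a characteristic value. The rank of $\bar u\in\ker B_{\xi_0}\setminus\{0\}$ is the maximal multiplicity of a root function with $u_{\xi_0}=\bar u$. The partial null multiplicities of $\xi_0$ are the ranks of $u^{(1)},\dots,u^{(\alpha)}$, where $u^{(1)},\dots,u^{(\alpha)}$ is a basis of $\ker B_{\xi_0}$ such that, for each $j$, the rank of $u^{(j)}$ is the maximum of the ranks of the nonzero elements of some direct complement of $\mathrm{span}\{u^{(1)},\dots,u^{(j-1)}\}$ in $\ker B_{\xi_0}$. For $\alpha\in[-\pi,\pi)$ let $A_\alpha=-\varepsilon^{-1}\Delta_\alpha$ on $H^2_\gamma(\Omega)$. An analytic arrangement of the eigenvalues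 (a family of analytic band functions) is a sequence of real-valued functions $(\lambda_m)_{m\in\mathbb N}$, each analytic on a neighborhood of $[-\pi,\pi)$, such that for every $\alpha\in[-\pi,\pi)$ the sequence $(\lambda_m(\alpha))_m$ lists the eigenvalues of $A_\alpha$, each repeated according to its multiplicity. Then an analytic arrangement exists, and for every analytic arrangement $(\lambda_m)$ and every $\xi^*\in[-\pi,\pi)$ the following are equivalent: 1. $\xi^*$ is a characteristic value of $(B_\xi)$ with a partial null multiplicity greater than $1$; 2. there is $m\in\mathbb N$ with $\lambda_m(\xi^*)=\omega^2$ and $\lambda_m'(\xi^*)=0$. -/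

import Mathlib

open MeasureTheory Set
open scoped ENNReal

noncomputable section

/-! ## Characteristic values of holomorphic operator families -/

namespace OperatorFamily

variable {E F : Type*} [NormedAddCommGroup E] [NormedSpace ℂ E]
  [NormedAddCommGroup F] [NormedSpace ℂ F]

/-- `u` is a root function of the family `B` at `ξ₀`: it is holomorphic near `ξ₀`, does not vanish
at `ξ₀`, and `B_{ξ₀} u_{ξ₀} = 0`. -/
def IsRootFunction (B : ℂ → E →L[ℂ] F) (ξ₀ : ℂ) (u : ℂ → E) : Prop :=
  AnalyticAt ℂ u ξ₀ ∧ u ξ₀ ≠ 0 ∧ B ξ₀ (u ξ₀) = 0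

/-- `ξ₀` is a characteristic value of `B` if there is a root function of `B` at `ξ₀`. -/
def IsCharacteristicValue (B : ℂ → E →L[ℂ] F) (ξ₀ : ℂ) : Prop :=
  ∃ u, IsRootFunction B ξ₀ u

/-- The multiplicity of `u`: the order of `ξ₀` as a root of `ξ ↦ B_ξ u_ξ`. -/
def multiplicity (B : ℂ → E →L[ℂ] F) (ξ₀ : ℂ) (u : ℂ → E) : ℕ∞ :=
  analyticOrderAt (fun ξ => B ξ (u ξ)) ξ₀

/-- `v` is an eigenvector of `B` at `ξ₀` if it is the value at `ξ₀` of a root function. -/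
def IsEigenvector (B : ℂ → E →L[ℂ] F) (ξ₀ : ℂ) (v : E) : Prop :=
  ∃ u, IsRootFunction B ξ₀ u ∧ u ξ₀ = v

/-- The rank of `v`: the largest multiplicity of a root function `u` with `u_{ξ₀} = v`. -/
def rank (B : ℂ → E →L[ℂ] F) (ξ₀ : ℂ) (v : E) : ℕ∞ :=
  sSup {r | ∃ u, IsRootFunction B ξ₀ u ∧ u ξ₀ = v ∧ multiplicity B ξ₀ u = r}

/-- `v 0, …, v (α-1)` is a canonical system of eigenvectors of `B` at `ξ₀`: a basis of
`ker B_{ξ₀}` such that the rank of `v j` is the maximum of the ranks of all eigenvectors in some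
direct complement of `span {v i | i < j}` in `ker B_{ξ₀}` (for `j = 0` the only direct complement
is `ker B_{ξ₀}` itself). -/
def IsCanonicalSystem (B : ℂ → E →L[ℂ] F) (ξ₀ : ℂ) {α : ℕ} (v : Fin α → E) : Prop :=
  LinearIndependent ℂ v ∧
  Submodule.span ℂ (range v) = LinearMap.ker (B ξ₀ : E →ₗ[ℂ] F) ∧
  ∀ j : Fin α, ∃ C : Submodule ℂ E,
    Disjoint (Submodule.span ℂ (v '' Iio j)) C ∧
    Submodule.span ℂ (v '' Iio j) ⊔ C = LinearMap.ker (B ξ₀ : E →ₗ[ℂ] F) ∧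
    IsGreatest {r | ∃ w ∈ C, IsEigenvector B ξ₀ w ∧ rank B ξ₀ w = r} (rank B ξ₀ (v j))

/-- `r` is one of the partial null multiplicities of `B` at `ξ₀`, that is, one of the ranks of the
members of a canonical system of eigenvectors. -/
def IsPartialNullMultiplicity (B : ℂ → E →L[ℂ] F) (ξ₀ : ℂ) (r : ℕ) : Prop :=
  ∃ (α : ℕ) (v : Fin α → E), IsCanonicalSystem B ξ₀ v ∧ ∃ j, rank B ξ₀ (v j) = r

end OperatorFamily

namespace Waveguide

/-! ## Boundary conditions and the transversal eigensystem -/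

/-- The boundary conditions on the two horizontal sides of the strip. -/
inductive BoundaryCondition : Type
  | dirichlet
  | neumann
  | mixed
  | quasiPeriodic (β : ℝ) (hβ : β ∈ Ico 0 (2 * Real.pi))

namespace BoundaryCondition

/-- The condition `γ v = (0, 0)ᵀ` for a function `v` on the cross section `[0, L]`. -/
def Holds (L : ℝ) (v : ℝ → ℂ) : BoundaryCondition → Prop
  | dirichlet => v 0 = 0 ∧ v L = 0
  | neumann => deriv v 0 = 0 ∧ deriv v L = 0
  | mixed => v 0 = 0 ∧ deriv v L = 0
  | quasiPeriodic β _ =>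
      Complex.exp (Complex.I * β) * v 0 - v L = 0 ∧
      Complex.exp (Complex.I * β) * deriv v 0 - deriv v L = 0

/-- The index set of the eigenpairs of `-d²/dt²` under the boundary condition. -/
def index : BoundaryCondition → Set ℤ
  | dirichlet => Ici 1
  | neumann => Ici 0
  | mixed => Ici 1
  | quasiPeriodic _ _ => univ

/-- `kappa γ L k ^ 2` is the `k`-th eigenvalue of `-d²/dt²` under the boundary condition. -/
def kappa (L : ℝ) (k : ℤ) : BoundaryCondition → ℝ
  | dirichlet => Real.pi * k / L
  | neumann => Real.pi * k / L
  | mixed => Real.pi * (2 * k - 1) / (2 * L)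
  | quasiPeriodic β _ => (β + 2 * Real.pi * k) / L

/-- The normalized eigenfunctions of `-d²/dt²` on `(0, L)` under the boundary condition. -/
def psi (γ : BoundaryCondition) (L : ℝ) (k : ℤ) (t : ℝ) : ℂ :=
  match γ with
  | dirichlet => (√(2 / L) : ℝ) * Complex.sin (γ.kappa L k * t)
  | neumann => (√((if k = 0 then 1 else 2) / L) : ℝ) * Complex.cos (γ.kappa L k * t)
  | mixed => (√(2 / L) : ℝ) * Complex.sin (γ.kappa L k * t)
  | quasiPeriodic _ _ => (√(1 / L) : ℝ) * Complex.exp (Complex.I * γ.kappa L k * t)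

end BoundaryCondition

open BoundaryCondition

lemma hasDerivAt_sin (c : ℂ) (a t : ℝ) :
    HasDerivAt (fun t : ℝ => c * Complex.sin (a * t)) (c * (a * Complex.cos (a * t))) t := by
  have h : HasDerivAt (fun z : ℂ => c * Complex.sin (a * z)) (c * (a * Complex.cos (a * t)))
      (t : ℂ) := by
    have h1 : HasDerivAt (fun z : ℂ => (a : ℂ) * z) a (t : ℂ) := by
      simpa using (hasDerivAt_id (t : ℂ)).const_mul (a : ℂ)
    simpa [mul_comm] using (h1.csin.const_mul c)
  exact h.comp_ofReal

lemma hasDerivAt_cos (c : ℂ) (a t : ℝ) :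
    HasDerivAt (fun t : ℝ => c * Complex.cos (a * t)) (-(c * (a * Complex.sin (a * t)))) t := by
  have h : HasDerivAt (fun z : ℂ => c * Complex.cos (a * z)) (-(c * (a * Complex.sin (a * t))))
      (t : ℂ) := by
    have h1 : HasDerivAt (fun z : ℂ => (a : ℂ) * z) a (t : ℂ) := by
      simpa using (hasDerivAt_id (t : ℂ)).const_mul (a : ℂ)
    simpa [mul_comm] using (h1.ccos.const_mul c)
  exact h.comp_ofReal

lemma hasDerivAt_exp (c : ℂ) (a t : ℝ) :
    HasDerivAt (fun t : ℝ => c * Complex.exp (Complex.I * a * t))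
      (c * Complex.I * a * Complex.exp (Complex.I * a * t)) t := by
  have h : HasDerivAt (fun z : ℂ => c * Complex.exp (Complex.I * a * z))
      (c * Complex.I * a * Complex.exp (Complex.I * a * t)) (t : ℂ) := by
    have h1 : HasDerivAt (fun z : ℂ => (Complex.I * a : ℂ) * z) (Complex.I * a) (t : ℂ) := by
      simpa using (hasDerivAt_id (t : ℂ)).const_mul (Complex.I * a : ℂ)
    exact (h1.cexp.const_mul c).congr_deriv (by ring)
  exact h.comp_ofReal

/-- The functions `psi` satisfy the boundary condition. -/
lemma holds_psi (γ : BoundaryCondition) {L : ℝ} (hL : 0 < L) (k : ℤ) :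
    γ.Holds L (γ.psi L k) := by
  have hL' : (L : ℂ) ≠ 0 := by exact_mod_cast hL.ne'
  cases γ with
  | dirichlet =>
    refine ⟨by simp [psi], ?_⟩
    have : ((BoundaryCondition.dirichlet.kappa L k : ℝ) : ℂ) * L = k * Real.pi := by
      simp only [kappa]; push_cast; field_simp
    simp [psi, this, Complex.sin_int_mul_pi]
  | neumann =>
    have : ((BoundaryCondition.neumann.kappa L k : ℝ) : ℂ) * L = k * Real.pi := by
      simp only [kappa]; push_cast; field_simp
    constructor
    · exact ((hasDerivAt_cos _ _ 0).deriv).trans (by simp)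
    · exact ((hasDerivAt_cos _ _ L).deriv).trans (by rw [this, Complex.sin_int_mul_pi]; simp)
  | mixed =>
    have : ((BoundaryCondition.mixed.kappa L k : ℝ) : ℂ) * L = k * Real.pi - Real.pi / 2 := by
      simp only [kappa]; push_cast; field_simp
    refine ⟨by simp [psi], ?_⟩
    exact ((hasDerivAt_sin _ _ L).deriv).trans
      (by rw [this, Complex.cos_sub_pi_div_two, Complex.sin_int_mul_pi]; simp)
  | quasiPeriodic β hβ =>
    have : Complex.exp (Complex.I * ((BoundaryCondition.quasiPeriodic β hβ).kappa L k : ℝ) * L)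
        = Complex.exp (Complex.I * β) := by
      have : Complex.I * ((BoundaryCondition.quasiPeriodic β hβ).kappa L k : ℝ) * L
          = Complex.I * β + k * (2 * Real.pi * Complex.I) := by
        simp only [kappa]; push_cast; field_simp
      rw [this, Complex.exp_add, Complex.exp_int_mul_two_pi_mul_I, mul_one]
    constructor
    · simp only [psi, this]; simp; ring
    · have h0 := (hasDerivAt_exp (√(1 / L) : ℝ)
        ((BoundaryCondition.quasiPeriodic β hβ).kappa L k) 0).deriv
      have h1 := (hasDerivAt_exp (√(1 / L) : ℝ)
        ((BoundaryCondition.quasiPeriodic β hβ).kappa L k) L).deriv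
      have e : (BoundaryCondition.quasiPeriodic β hβ).psi L k = fun t : ℝ =>
        ((√(1 / L) : ℝ) : ℂ) * Complex.exp
          (Complex.I * ((BoundaryCondition.quasiPeriodic β hβ).kappa L k : ℝ) * t) := rfl
      rw [e, h0, h1, this]; simp; ring

/-- The functions `psi` are eigenfunctions: `-psi'' = kappa² psi`. -/
lemma deriv_deriv_psi (γ : BoundaryCondition) (L : ℝ) (k : ℤ) (t : ℝ) :
    -deriv (deriv (γ.psi L k)) t = ((γ.kappa L k : ℝ) : ℂ) ^ 2 * γ.psi L k t := by
  have hs : ∀ (c : ℂ) (a : ℝ), -deriv (deriv fun t : ℝ => c * Complex.sin (a * t)) t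
      = (a : ℂ) ^ 2 * (c * Complex.sin (a * t)) := by
    intro c a
    have : deriv (fun t : ℝ => c * Complex.sin (a * t))
        = fun t : ℝ => (c * a) * Complex.cos (a * t) := by
      funext s; rw [(hasDerivAt_sin c a s).deriv]; ring
    rw [this, (hasDerivAt_cos (c * a) a t).deriv]; ring
  have hc : ∀ (c : ℂ) (a : ℝ), -deriv (deriv fun t : ℝ => c * Complex.cos (a * t)) t
      = (a : ℂ) ^ 2 * (c * Complex.cos (a * t)) := by
    intro c a
    have : deriv (fun t : ℝ => c * Complex.cos (a * t))
        = fun t : ℝ => (-(c * a)) * Complex.sin (a * t) := by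
      funext s; rw [(hasDerivAt_cos c a s).deriv]; ring
    rw [this, (hasDerivAt_sin (-(c * a)) a t).deriv]; ring
  have he : ∀ (c : ℂ) (a : ℝ), -deriv (deriv fun t : ℝ => c * Complex.exp (Complex.I * a * t)) t
      = (a : ℂ) ^ 2 * (c * Complex.exp (Complex.I * a * t)) := by
    intro c a
    have : deriv (fun t : ℝ => c * Complex.exp (Complex.I * a * t))
        = fun t : ℝ => (c * Complex.I * a) * Complex.exp (Complex.I * a * t) := by
      funext s; rw [(hasDerivAt_exp c a s).deriv]
    rw [this, (hasDerivAt_exp (c * Complex.I * a) a t).deriv]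
    linear_combination (-(c * (a : ℂ) ^ 2 * Complex.exp (Complex.I * a * t))) * Complex.I_sq
  cases γ with
  | dirichlet => exact hs _ _
  | neumann => exact hc _ _
  | mixed => exact hs _ _
  | quasiPeriodic β hβ => exact he _ _

/-! ### Orthonormality -/

lemma integral_cos_int {L : ℝ} (hL : 0 < L) (n : ℤ) :
    ∫ t in (0 : ℝ)..L, Real.cos (Real.pi * n / L * t) = if n = 0 then L else 0 := by
  split_ifs with h
  · simp [h]
  · have hc : Real.pi * n / L ≠ 0 := by
      have : (n : ℝ) ≠ 0 := by exact_mod_cast h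
      have := Real.pi_ne_zero
      positivity
    rw [intervalIntegral.integral_comp_mul_left (fun x => Real.cos x) hc]
    have : Real.pi * n / L * L = n * Real.pi := by field_simp
    simp [this, Real.sin_int_mul_pi]

lemma integral_trig {L : ℝ} (hL : 0 < L) (c : ℝ) (n m : ℤ) :
    ∫ t in (0 : ℝ)..L, c / 2 * (Real.cos (Real.pi * n / L * t)
      + Real.cos (Real.pi * m / L * t))
      = c / 2 * ((if n = 0 then L else 0) + (if m = 0 then L else 0)) := by
  rw [intervalIntegral.integral_const_mul, intervalIntegral.integral_add,
    integral_cos_int hL, integral_cos_int hL]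
  all_goals exact Continuous.intervalIntegrable (by fun_prop) _ _

lemma integral_trig' {L : ℝ} (hL : 0 < L) (c : ℝ) (n m : ℤ) :
    ∫ t in (0 : ℝ)..L, c / 2 * (Real.cos (Real.pi * n / L * t)
      - Real.cos (Real.pi * m / L * t))
      = c / 2 * ((if n = 0 then L else 0) - (if m = 0 then L else 0)) := by
  rw [intervalIntegral.integral_const_mul, intervalIntegral.integral_sub,
    integral_cos_int hL, integral_cos_int hL]
  all_goals exact Continuous.intervalIntegrable (by fun_prop) _ _

lemma integral_exp_int {L : ℝ} (hL : 0 < L) (n : ℤ) :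
    ∫ t in (0 : ℝ)..L, Complex.exp ((2 * Real.pi * n / L * Complex.I) * t)
      = if n = 0 then (L : ℂ) else 0 := by
  have hL' : (L : ℂ) ≠ 0 := by exact_mod_cast hL.ne'
  split_ifs with h
  · simp [h]
  · have hc : (2 * Real.pi * n / L * Complex.I : ℂ) ≠ 0 := by
      have h1 : (n : ℂ) ≠ 0 := by exact_mod_cast h
      have h2 : (Real.pi : ℂ) ≠ 0 := by exact_mod_cast Real.pi_ne_zero
      simp [h1, h2, hL', Complex.I_ne_zero]
    rw [integral_exp_mul_complex hc]
    have : 2 * Real.pi * n / L * Complex.I * L = n * (2 * Real.pi * Complex.I) := by field_simp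
    rw [this, Complex.exp_int_mul_two_pi_mul_I]
    simp

lemma integral_psi (γ : BoundaryCondition) {L : ℝ} (hL : 0 < L) (j k : γ.index) :
    ∫ t in (0 : ℝ)..L, star (γ.psi L j t) * γ.psi L k t = if j = k then 1 else 0 := by
  obtain ⟨j, hj⟩ := j
  obtain ⟨k, hk⟩ := k
  have hL' : (L : ℂ) ≠ 0 := by exact_mod_cast hL.ne'
  have h2 : √(2 / L) * √(2 / L) = 2 / L := Real.mul_self_sqrt (by positivity)
  have hss : ∀ (s a b : ℝ) , s * Real.sin a * (s * Real.sin b)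
      = (s * s) / 2 * (Real.cos (b - a) - Real.cos (b + a)) := by
    intro s a b; rw [Real.cos_sub, Real.cos_add]; ring
  have hcc : ∀ (r s a b : ℝ) , r * Real.cos a * (s * Real.cos b)
      = (r * s) / 2 * (Real.cos (b - a) + Real.cos (b + a)) := by
    intro r s a b; rw [Real.cos_sub, Real.cos_add]; ring
  simp only [Subtype.mk.injEq]
  cases γ with
  | dirichlet =>
    simp only [index, mem_Ici] at hj hk
    have : ∀ t : ℝ, star (BoundaryCondition.dirichlet.psi L j t) * BoundaryCondition.dirichlet.psi L k t
        = (((2 / L) / 2 * (Real.cos (Real.pi * (k - j : ℤ) / L * t)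
            - Real.cos (Real.pi * (k + j : ℤ) / L * t)) : ℝ) : ℂ) := by
      intro t
      simp only [psi, kappa, Complex.star_def, ← Complex.ofReal_mul, ← Complex.ofReal_sin,
        Complex.conj_ofReal]
      rw [hss, h2]
      congr 4 <;> push_cast <;> ring
    simp only [this]
    rw [intervalIntegral.integral_ofReal, integral_trig' hL, if_neg (by omega : ¬ (k + j = 0))]
    by_cases h : j = k
    · subst h; simp; field_simp
    · rw [if_neg (by omega), if_neg h]; simp
  | neumann =>
    simp only [index, mem_Ici] at hj hk
    have : ∀ t : ℝ, star (BoundaryCondition.neumann.psi L j t) * BoundaryCondition.neumann.psi L k t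
        = (((√((if j = 0 then 1 else 2) / L) * √((if k = 0 then 1 else 2) / L)) / 2 *
            (Real.cos (Real.pi * (k - j : ℤ) / L * t)
            + Real.cos (Real.pi * (k + j : ℤ) / L * t)) : ℝ) : ℂ) := by
      intro t
      simp only [psi, kappa, Complex.star_def, ← Complex.ofReal_mul, ← Complex.ofReal_cos,
        Complex.conj_ofReal]
      rw [hcc]
      congr 4 <;> push_cast <;> ring
    simp only [this]
    rw [intervalIntegral.integral_ofReal, integral_trig hL]
    by_cases h : j = k
    · subst h
      rw [Real.mul_self_sqrt (by split_ifs <;> positivity)]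
      by_cases h0 : j = 0
      · subst h0; simp; field_simp; norm_num
      · rw [if_neg h0, if_neg (by omega : ¬ (j + j = 0))]; simp; field_simp
    · rw [if_neg (by omega : ¬ (k - j = 0)), if_neg (by omega : ¬ (k + j = 0)), if_neg h]; simp
  | mixed =>
    simp only [index, mem_Ici] at hj hk
    have : ∀ t : ℝ, star (BoundaryCondition.mixed.psi L j t) * BoundaryCondition.mixed.psi L k t
        = (((2 / L) / 2 * (Real.cos (Real.pi * (k - j : ℤ) / L * t)
            - Real.cos (Real.pi * (k + j - 1 : ℤ) / L * t)) : ℝ) : ℂ) := by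
      intro t
      simp only [psi, kappa, Complex.star_def, ← Complex.ofReal_mul, ← Complex.ofReal_sin,
        Complex.conj_ofReal]
      rw [hss, h2]
      congr 4 <;> push_cast <;> field_simp <;> ring
    simp only [this]
    rw [intervalIntegral.integral_ofReal, integral_trig' hL, if_neg (by omega : ¬ (k + j - 1 = 0))]
    by_cases h : j = k
    · subst h; simp; field_simp
    · rw [if_neg (by omega), if_neg h]; simp
  | quasiPeriodic β hβ =>
    have : ∀ t : ℝ, star ((BoundaryCondition.quasiPeriodic β hβ).psi L j t)
          * (BoundaryCondition.quasiPeriodic β hβ).psi L k t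
        = (1 / L : ℂ) * Complex.exp ((2 * Real.pi * (k - j : ℤ) / L * Complex.I) * t) := by
      intro t
      have h1 : ((√(1 / L) : ℝ) : ℂ) * ((√(1 / L) : ℝ) : ℂ) = 1 / L := by
        rw [← Complex.ofReal_mul, Real.mul_self_sqrt (by positivity)]; simp
      simp only [psi, Complex.star_def, map_mul, Complex.conj_ofReal, ← Complex.exp_conj,
        Complex.conj_I]
      rw [mul_mul_mul_comm, h1, ← Complex.exp_add]
      congr 2
      simp only [kappa]; push_cast; field_simp; ring
    simp only [this]
    rw [intervalIntegral.integral_const_mul, integral_exp_int hL]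
    by_cases h : j = k
    · subst h; simp [hL']
    · rw [if_neg (by omega), if_neg h]; simp

/-! ## Function spaces on the periodicity cell -/

/-- Lebesgue measure on the cell `(0,1) × (0,L)`, which represents `Ω = ℝ/ℤ × (0,L)`. -/
def cellMeasure (L : ℝ) : Measure (ℝ × ℝ) :=
  volume.restrict (Ioo 0 1 ×ˢ Ioo 0 L)

/-- The space `L²(Ω)`. -/
abbrev L2 (L : ℝ) : Type := Lp ℂ 2 (cellMeasure L)

instance (L : ℝ) : IsFiniteMeasure (cellMeasure L) := by
  refine ⟨?_⟩
  rw [cellMeasure, Measure.restrict_apply_univ, Measure.volume_eq_prod, Measure.prod_prod]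
  simp

/-- The index set of the basis of `L²(Ω)`. -/
abbrev Index (γ : BoundaryCondition) : Type := ℤ × γ.index

/-- The basis functions `exp(2πi l₁ x₁) ψ_{l₂}(x₂)`. -/
def phiFun (γ : BoundaryCondition) (L : ℝ) (l : Index γ) (x : ℝ × ℝ) : ℂ :=
  Complex.exp (2 * Real.pi * Complex.I * l.1 * x.1) * γ.psi L l.2 x.2

lemma continuous_psi (γ : BoundaryCondition) (L : ℝ) (k : ℤ) : Continuous (γ.psi L k) := by
  cases γ <;> (unfold psi; simp only []; fun_prop)

lemma continuous_phiFun (γ : BoundaryCondition) (L : ℝ) (l : Index γ) :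
    Continuous (phiFun γ L l) := by
  have := continuous_psi γ L l.2
  unfold phiFun
  fun_prop

lemma memLp_phiFun (γ : BoundaryCondition) (L : ℝ) (l : Index γ) :
    MemLp (phiFun γ L l) 2 (cellMeasure L) := by
  have hc := continuous_phiFun γ L l
  obtain ⟨C, hC⟩ := ((isCompact_Icc (a := (0 : ℝ)) (b := 1)).prod
    (isCompact_Icc (a := (0 : ℝ)) (b := L))).exists_bound_of_continuousOn hc.continuousOn
  refine MemLp.of_bound hc.aestronglyMeasurable C ?_
  refine (ae_restrict_iff' (measurableSet_Ioo.prod measurableSet_Ioo)).2 (ae_of_all _ ?_)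
  exact fun x hx => hC x ⟨Ioo_subset_Icc_self hx.1, Ioo_subset_Icc_self hx.2⟩

/-- The basis functions as elements of `L²(Ω)`. -/
def phi (γ : BoundaryCondition) (L : ℝ) (l : Index γ) : L2 L :=
  (memLp_phiFun γ L l).toLp _

lemma orthonormal_phi (γ : BoundaryCondition) {L : ℝ} (hL : 0 < L) :
    Orthonormal ℂ (phi γ L) := by
  classical
  rw [orthonormal_iff_ite]
  intro l m
  rw [MeasureTheory.L2.inner_def]
  have h1 : ∫ x, inner ℂ (phi γ L l x) (phi γ L m x) ∂(cellMeasure L)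
      = ∫ x, (Complex.exp ((2 * Real.pi * (m.1 - l.1 : ℤ) / (1 : ℝ) * Complex.I) * x.1)
          * (star (γ.psi L l.2 x.2) * γ.psi L m.2 x.2)) ∂(cellMeasure L) := by
    refine integral_congr_ae ?_
    filter_upwards [(memLp_phiFun γ L l).coeFn_toLp, (memLp_phiFun γ L m).coeFn_toLp]
      with x hx hy
    have e : ∀ n : ℤ, star (Complex.exp (2 * Real.pi * Complex.I * n * x.1))
        = Complex.exp (-(2 * Real.pi * Complex.I * n * x.1)) := by
      intro n
      have h2 : (starRingEnd ℂ) 2 = 2 := Complex.conj_ofNat 2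
      rw [Complex.star_def, ← Complex.exp_conj]
      simp [h2]
    rw [phi, phi, hx, hy, RCLike.inner_apply', phiFun, phiFun, ← Complex.star_def, star_mul', e]
    rw [mul_mul_mul_comm, ← Complex.exp_add]
    congr 2
    push_cast; ring
  rw [h1, cellMeasure, Measure.volume_eq_prod, ← Measure.prod_restrict]
  rw [integral_prod_mul
    (fun t : ℝ => Complex.exp ((2 * Real.pi * (m.1 - l.1 : ℤ) / (1 : ℝ) * Complex.I) * t))
    (fun t : ℝ => star (γ.psi L l.2 t) * γ.psi L m.2 t),
    ← integral_Ioc_eq_integral_Ioo, ← integral_Ioc_eq_integral_Ioo,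
    ← intervalIntegral.integral_of_le zero_le_one, ← intervalIntegral.integral_of_le hL.le,
    integral_exp_int one_pos, integral_psi γ hL]
  by_cases h : l = m
  · subst h; simp
  · rw [if_neg h]
    by_cases h' : l.2 = m.2
    · have : l.1 ≠ m.1 := fun h'' => h (Prod.ext h'' h')
      rw [if_neg (by omega)]; simp
    · rw [if_neg h']; simp

/-- The weight `1 + (2π l₁)² + κ_{l₂}²`, which is comparable to `1 + |l|²`. -/
def weight (γ : BoundaryCondition) (L : ℝ) (l : Index γ) : ℝ :=
  1 + (2 * Real.pi * l.1) ^ 2 + γ.kappa L l.2 ^ 2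

/-- The space `H²_γ(Ω)` of all `u ∈ L²(Ω)` with `∑ (1 + (2π l₁)² + κ_{l₂}²)² |⟨φ_l, u⟩|² < ∞`,
as a subspace of `L²(Ω)`. -/
def H2Submodule (γ : BoundaryCondition) (L : ℝ) : Submodule ℂ (L2 L) where
  carrier := {u | Memℓp (fun l : Index γ => (weight γ L l : ℂ) * inner ℂ (phi γ L l) u) 2}
  zero_mem' := by simpa using! (zero_memℓp : Memℓp (0 : Index γ → ℂ) 2)
  add_mem' := by
    intro u v hu hv
    have := Memℓp.add hu hv
    simpa [inner_add_right, mul_add, Pi.add_def] using this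
  smul_mem' := by
    intro c u hu
    have := Memℓp.const_smul hu c
    simpa [inner_smul_right, mul_left_comm, Pi.smul_def] using this

/-- The space `H²_γ(Ω)`. It is a type of its own, because its norm is not that of `L²(Ω)`. -/
def H2 (γ : BoundaryCondition) (L : ℝ) : Type := H2Submodule γ L

namespace H2

variable (γ : BoundaryCondition) (L : ℝ)

instance : AddCommGroup (H2 γ L) := inferInstanceAs (AddCommGroup (H2Submodule γ L))

instance : Module ℂ (H2 γ L) := inferInstanceAs (Module ℂ (H2Submodule γ L))

/-- The inclusion of `H²_γ(Ω)` into `L²(Ω)`. -/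
def toL2 : H2 γ L →ₗ[ℂ] L2 L := (H2Submodule γ L).subtype

/-- The weighted sequence of coefficients of an element of `H²_γ(Ω)`. -/
def coeffs : H2 γ L →ₗ[ℂ] lp (fun _ : Index γ => ℂ) 2 where
  toFun u := ⟨fun l => (weight γ L l : ℂ) * inner ℂ (phi γ L l) (toL2 γ L u), u.2⟩
  map_add' u v := by
    ext l
    simp only [map_add, inner_add_right, mul_add]
    rfl
  map_smul' c u := by
    ext l
    simp [inner_smul_right, mul_left_comm]

/-- The map that defines the norm of `H²_γ(Ω)`. -/
def graphMap : H2 γ L →ₗ[ℂ] L2 L × lp (fun _ : Index γ => ℂ) 2 :=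
  (toL2 γ L).prod (coeffs γ L)

/-- The norm of `H²_γ(Ω)`: the maximum of the `L²` norm and of
`(∑ (1 + (2π l₁)² + κ_{l₂}²)² |⟨φ_l, u⟩|²)^{1/2}`. By Parseval's identity and since the weights are
at least `1`, the maximum is always the second of the two. -/
instance : NormedAddCommGroup (H2 γ L) :=
  NormedAddCommGroup.induced (H2 γ L) (L2 L × lp (fun _ : Index γ => ℂ) 2) (graphMap γ L)
    (fun _ _ h => Subtype.ext (congrArg Prod.fst h))

instance : NormedSpace ℂ (H2 γ L) :=
  NormedSpace.induced ℂ (H2 γ L) (L2 L × lp (fun _ : Index γ => ℂ) 2) (graphMap γ L)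

lemma norm_def (u : H2 γ L) : ‖u‖ = max ‖toL2 γ L u‖ ‖coeffs γ L u‖ := rfl

/-- The inclusion of `H²_γ(Ω)` into `L²(Ω)` as a bounded operator. -/
def incl : H2 γ L →L[ℂ] L2 L :=
  (toL2 γ L).mkContinuous 1 fun u => by rw [one_mul, norm_def]; exact le_max_left _ _

end H2

variable (γ : BoundaryCondition) {L : ℝ}

lemma weight_pos (l : Index γ) : 0 < weight γ L l := by unfold weight; positivity

/-- The operator `ℓ² → ℓ²` of multiplication by a sequence that is bounded by `1`. -/
def seqMul (m : Index γ → ℂ) (hm : ∀ l, ‖m l‖ ≤ 1) :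
    lp (fun _ : Index γ => ℂ) 2 →L[ℂ] lp (fun _ : Index γ => ℂ) 2 :=
  LinearMap.mkContinuous
    { toFun := fun a => ⟨fun l => m l * a l, (lp.memℓp a).norm.mono fun l => by
        rw [norm_mul]; exact mul_le_of_le_one_left (norm_nonneg _) (hm l)⟩
      map_add' := fun a b => by ext l; simp only [lp.coeFn_add, Pi.add_apply, mul_add]
      map_smul' := fun c a => by ext l; simp [mul_left_comm] }
    1 fun a => by
      rw [one_mul]
      refine lp.norm_mono (by norm_num) fun l => ?_
      simp only [LinearMap.coe_mk, AddHom.coe_mk, norm_mul]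
      exact mul_le_of_le_one_left (norm_nonneg _) (hm l)

/-- The operator `u ↦ ∑ m_l ⟨φ_l, u⟩ φ_l` from `H²_γ(Ω)` to `L²(Ω)`, for a symbol `m` that is
dominated by the weight. -/
def fourierMul (hL : 0 < L) (m : Index γ → ℂ) (hm : ∀ l, ‖m l‖ ≤ weight γ L l) :
    H2 γ L →L[ℂ] L2 L :=
  ((orthonormal_phi γ hL).orthogonalFamily.linearIsometry.toContinuousLinearMap ∘L
    seqMul γ (fun l => m l / weight γ L l) fun l => by
      rw [norm_div, Complex.norm_real, Real.norm_of_nonneg (weight_pos γ l).le]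
      exact div_le_one_of_le₀ (hm l) (weight_pos γ l).le) ∘L
  (H2.coeffs γ L).mkContinuous 1 fun u => by
    rw [one_mul, H2.norm_def]; exact le_max_right _ _

lemma hasSum_fourierMul (hL : 0 < L) (m : Index γ → ℂ) (hm : ∀ l, ‖m l‖ ≤ weight γ L l)
    (u : H2 γ L) :
    HasSum (fun l => (m l * inner ℂ (phi γ L l) (H2.incl γ L u)) • phi γ L l)
      (fourierMul γ hL m hm u) := by
  have h := (orthonormal_phi γ hL).orthogonalFamily.hasSum_linearIsometry
    (seqMul γ (fun l => m l / weight γ L l) (fun l => by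
      rw [norm_div, Complex.norm_real, Real.norm_of_nonneg (weight_pos γ l).le]
      exact div_le_one_of_le₀ (hm l) (weight_pos γ l).le) (H2.coeffs γ L u))
  change HasSum _ (fourierMul γ hL m hm u) at h
  refine h.congr_fun ?_
  intro l
  have hw : (weight γ L l : ℂ) ≠ 0 := by exact_mod_cast (weight_pos γ l).ne'
  simp [seqMul, H2.coeffs, H2.incl]
  congr 1
  field_simp

/-- The derivative `∂_{x₁} : H²_γ(Ω) → L²(Ω)`, which acts on `φ_l` as `2πi l₁`. -/
def partialX (hL : 0 < L) : H2 γ L →L[ℂ] L2 L :=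
  fourierMul γ hL (fun l => 2 * Real.pi * Complex.I * l.1) fun l => by
    simp only [norm_mul, Complex.norm_I, Complex.norm_intCast, Complex.norm_real,
      Complex.norm_ofNat, mul_one, weight]
    rw [Real.norm_of_nonneg Real.pi_pos.le, mul_pow, ← sq_abs (l.1 : ℝ), ← mul_pow]
    nlinarith [sq_nonneg (2 * Real.pi * |(l.1 : ℝ)| - 1), sq_nonneg (γ.kappa L l.2)]

/-- The Laplacian `Δ : H²_γ(Ω) → L²(Ω)`, which acts on `φ_l` as `-((2π l₁)² + κ_{l₂}²)`. -/
def laplacian (hL : 0 < L) : H2 γ L →L[ℂ] L2 L :=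
  fourierMul γ hL (fun l => ((-((2 * Real.pi * l.1) ^ 2 + γ.kappa L l.2 ^ 2) : ℝ) : ℂ))
    fun l => by
      rw [Complex.norm_real, norm_neg, Real.norm_of_nonneg (by positivity), weight]
      linarith

/-- The symbols of `∂_{x₁}` and of `Δ` are those of the classical derivatives of `φ_l`. -/
lemma deriv_phiFun (l : Index γ) (x₁ x₂ : ℝ) :
    deriv (fun t => phiFun γ L l (t, x₂)) x₁
      = 2 * Real.pi * Complex.I * l.1 * phiFun γ L l (x₁, x₂) ∧
    deriv (deriv fun t => phiFun γ L l (t, x₂)) x₁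
        + deriv (deriv fun t => phiFun γ L l (x₁, t)) x₂
      = ((-((2 * Real.pi * l.1) ^ 2 + γ.kappa L l.2 ^ 2) : ℝ) : ℂ) * phiFun γ L l (x₁, x₂) := by
  have h0 : ∀ s : ℝ, deriv (fun t => phiFun γ L l (t, x₂)) s
      = 2 * Real.pi * Complex.I * l.1 * phiFun γ L l (s, x₂) := by
    intro s
    have e : (fun t => phiFun γ L l (t, x₂)) = fun t : ℝ => γ.psi L l.2 x₂ *
        Complex.exp (Complex.I * ((2 * Real.pi * l.1 : ℝ) : ℂ) * t) := by
      funext t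
      simp only [phiFun]
      rw [mul_comm]
      congr 2
      push_cast; ring
    have e' : phiFun γ L l (s, x₂) = γ.psi L l.2 x₂ *
        Complex.exp (Complex.I * ((2 * Real.pi * l.1 : ℝ) : ℂ) * s) := congrFun e s
    rw [e, (hasDerivAt_exp _ _ s).deriv, e']
    push_cast; ring
  refine ⟨h0 x₁, ?_⟩
  have h1 : (fun t => phiFun γ L l (x₁, t)) = fun t : ℝ =>
      Complex.exp (2 * Real.pi * Complex.I * l.1 * x₁) * γ.psi L l.2 t := rfl
  have h2 : (deriv fun t => phiFun γ L l (x₁, t)) = fun t : ℝ =>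
      Complex.exp (2 * Real.pi * Complex.I * l.1 * x₁) * deriv (γ.psi L l.2) t := by
    rw [h1]; funext t; exact deriv_const_mul_field _
  rw [funext h0, h2, deriv_const_mul_field, deriv_const_mul_field, h0]
  have h3 := deriv_deriv_psi γ L l.2 x₂
  have h4 : deriv (deriv (γ.psi L l.2)) x₂ = -(((γ.kappa L l.2 : ℝ) : ℂ) ^ 2 * γ.psi L l.2 x₂) := by
    rw [← h3, neg_neg]
  rw [h4]
  simp only [phiFun]
  push_cast
  linear_combination (4 * (Real.pi : ℂ) ^ 2 * (l.1 : ℂ) ^ 2 *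
    Complex.exp (2 * Real.pi * Complex.I * l.1 * x₁) * γ.psi L l.2 x₂) * Complex.I_sq

/-- `Δ_ξ = Δ + 2iξ ∂_{x₁} - ξ²` as an operator from `H²_γ(Ω)` to `L²(Ω)`. -/
def deltaXi (hL : 0 < L) (ξ : ℂ) : H2 γ L →L[ℂ] L2 L :=
  laplacian γ hL + (2 * Complex.I * ξ) • partialX γ hL - (ξ ^ 2) • H2.incl γ L

/-! ## The medium, the operators `B_ξ`, and the band functions -/

/-- The permittivity: a function in `L^∞` of the strip `ℝ × (0,L)`, periodic with period `1` in the
first variable, and bounded away from `0`. -/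
structure Permittivity (L : ℝ) where
  /-- the underlying function -/
  toFun : ℝ × ℝ → ℝ
  aestronglyMeasurable :
    AEStronglyMeasurable toFun (volume.restrict (univ ×ˢ Ioo 0 L))
  periodic : ∀ x₁ x₂ : ℝ, x₂ ∈ Ioo 0 L → toFun (x₁ + 1, x₂) = toFun (x₁, x₂)
  lower_bound : ∃ c : ℝ, 0 < c ∧ ∀ᵐ x ∂(volume.restrict (univ ×ˢ Ioo 0 L)), c ≤ toFun x
  upper_bound : ∃ C : ℝ, ∀ᵐ x ∂(volume.restrict (univ ×ˢ Ioo 0 L)), toFun x ≤ C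

namespace Permittivity

variable (ε : Permittivity L)

lemma cellMeasure_le : cellMeasure L ≤ volume.restrict (univ ×ˢ Ioo 0 L) :=
  Measure.restrict_mono_set _ (prod_mono (subset_univ _) le_rfl)

lemma memLp_top : MemLp (fun x => (ε.toFun x : ℂ)) ∞ (cellMeasure L) := by
  obtain ⟨c, hc, hc'⟩ := ε.lower_bound
  obtain ⟨C, hC⟩ := ε.upper_bound
  refine memLp_top_of_bound
    (Complex.continuous_ofReal.comp_aestronglyMeasurable
      (ε.aestronglyMeasurable.mono_measure cellMeasure_le)) C ?_
  filter_upwards [ae_mono cellMeasure_le hc', ae_mono cellMeasure_le hC] with x h1 h2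
  rw [Complex.norm_real, Real.norm_of_nonneg (hc.le.trans h1)]
  exact h2

/-- Multiplication by the permittivity as a bounded operator on `L²(Ω)`. -/
def mulL : L2 L →L[ℂ] L2 L :=
  (ContinuousLinearMap.mul ℂ ℂ).holderL (cellMeasure L) ∞ 2 2 (ε.memLp_top.toLp _)

lemma coeFn_mulL (u : L2 L) :
    ε.mulL u =ᵐ[cellMeasure L] fun x => (ε.toFun x : ℂ) * u x := by
  have h := (ContinuousLinearMap.mul ℂ ℂ).coeFn_holder (r := 2) (ε.memLp_top.toLp _) u
  filter_upwards [h, ε.memLp_top.coeFn_toLp] with x h1 h2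
  refine h1.trans ?_
  rw [h2]; rfl

end Permittivity

/-- `B_ξ u = Δ_ξ u + ω² ε u` as an operator from `H²_γ(Ω)` to `L²(Ω)`. -/
def B (hL : 0 < L) (ε : Permittivity L) (ω : ℝ) (ξ : ℂ) : H2 γ L →L[ℂ] L2 L :=
  deltaXi γ hL ξ + ((ω : ℂ) ^ 2) • (ε.mulL ∘L H2.incl γ L)

/-- The eigenspace of `A_α = -ε⁻¹ Δ_α` for the number `μ`, that is, the space of all
`w ∈ H²_γ(Ω)` with `Δ_α w + μ ε w = 0`. -/
def bandEigenspace (hL : 0 < L) (ε : Permittivity L) (α μ : ℝ) : Submodule ℂ (H2 γ L) :=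
  LinearMap.ker
    (deltaXi γ hL α + (μ : ℂ) • (ε.mulL ∘L H2.incl γ L) : H2 γ L →L[ℂ] L2 L).toLinearMap

/-- `lam 0, lam 1, …` is an analytic arrangement of the eigenvalues of `A_α`, `α ∈ [-π, π)`: each
`lam m` is real analytic on a neighborhood of `[-π, π)` (equivalently, has a holomorphic extension
to a complex neighborhood), and for each `α ∈ [-π, π)` the sequence `lam m α` lists the eigenvalues
of `A_α`, each one as many times as its multiplicity says. -/
def IsAnalyticArrangement (hL : 0 < L) (ε : Permittivity L) (lam : ℕ → ℝ → ℝ) : Prop :=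
  (∀ m, AnalyticOnNhd ℝ (lam m) (Ico (-Real.pi) Real.pi)) ∧
  ∀ α ∈ Ico (-Real.pi) Real.pi, ∀ μ : ℝ,
    Cardinal.mk {m // lam m α = μ} = Module.rank ℂ (bandEigenspace γ hL ε α μ)

end Waveguide

end

/-! Write A_ξ = -Δ_ξ, and let C be multiplication by ε, so that -B_ξ = A_ξ - ω²C. For real ξ this
pencil is symmetric, and C is positive with square root S = √ε. Both conditions of the equivalence
amount to a third one: there are u₀ ≠ 0 and u₁ with B u₀ = 0 and B u₁ + B' u₀ = 0 at ξ*, that is, a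
Jordan chain of length two.

For null multiplicities: a root function has multiplicity at least 2 exactly when its value and its
derivative at ξ* form such a chain, and the first member of a canonical system has maximal rank in
the whole kernel (`exists_one_lt_isPartialNullMultiplicity_iff`). Canonical systems with finite
ranks exist because the orders of zeros of B_ξ u_ξ are bounded. This is analytic Fredholm theory
(`exists_analyticOrderAt_le`), started by a complex ξ at which B_ξ is injective
(`exists_injective_pencil`).

For band functions: near (ξ*, ω²) the eigenvalues of the pencil are the values of finitely many
analytic branches λ_i with eigenvectors w_i. A holomorphic reduction to finite dimension
(`exists_analytic_splitting`) followed by Rellich's theorem (`exists_analytic_eigenbasis`) gives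
them. First-order perturbation theory yields ⟨w_i, A'v⟩ = λ_i' ⟨w_i, Cv⟩ for v in the eigenspace,
while the chain equation for u₀ is solvable if and only if A'u₀ is orthogonal to the eigenspace.
Hence a chain exists if and only if some λ_i' vanishes
(`IsSymmetricPencil.exists_deriv_eq_zero_iff`). A count of multiplicities shows that the zero slopes
seen by any analytic arrangement are those of the local branches
(`exists_deriv_eq_zero_iff_of_enumeration`).

An arrangement exists because each local branch continues to all of ℝ: the estimate |λ'| ≤ K|λ| + K
(`norm_deriv_le`) excludes blow-up. Counted with generic multiplicities, the global branches exhaust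
the eigenvalues (`nonempty_equiv_fin`), and there are infinitely many of them by the spectral
theorem for compact operators (`infinite_eigenvalues`).

All operator estimates are made on Fourier coefficients, hence rest on the completeness of (φ_l)
(`eq_zero_of_forall_inner_phi`). -/

noncomputable section

/-! ### Holomorphic continuation of an isolated eigenspace -/

namespace OperatorFamily

open Filter Topology
open scoped ContDiff

section Splitting

variable {E H N : Type*} [NormedAddCommGroup E] [NormedSpace ℂ E] [CompleteSpace E]
  [NormedAddCommGroup H] [NormedSpace ℂ H] [CompleteSpace H]
  [NormedAddCommGroup N] [NormedSpace ℂ N]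

/-- An isolated eigenspace of the pencil `A t₀ - μ C` continues to a holomorphic family of
invariant subspaces, which carries all eigenvalues near `μ₀` of the pencils `A t - μ C` with `t`
near `t₀`. -/
theorem exists_analytic_splitting {A : ℂ → E →L[ℂ] H} {t₀ : ℂ} (hA : AnalyticAt ℂ A t₀)
    (C : E →L[ℂ] H) (μ₀ : ℂ) (ι : N →L[ℂ] E) (P : E →L[ℂ] N)
    (hP : ∀ x, P (ι x) = x) (hker : ∀ x, A t₀ (ι x) = μ₀ • C (ι x))
    (Ψ : E ≃L[ℂ] H) (hΨ : ∀ u, Ψ u = A t₀ u - μ₀ • C u - C (ι (P u))) :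
    ∃ (V : ℂ → N →L[ℂ] E) (M : ℂ → N →L[ℂ] N),
      AnalyticAt ℂ V t₀ ∧ AnalyticAt ℂ M t₀ ∧ V t₀ = ι ∧ M t₀ = μ₀ • ContinuousLinearMap.id ℂ N ∧
      (∀ᶠ t in 𝓝 t₀, ∀ x, A t (V t x) = C (V t (M t x))) ∧
      (∀ t x, P (V t x) = x) ∧
      ∀ᶠ p : ℂ × ℂ in 𝓝 (t₀, μ₀), ∀ u, A p.1 u = p.2 • C u →
        u = V p.1 (P u) ∧ M p.1 (P u) = p.2 • P u := by
  set R : E →L[ℂ] E := ContinuousLinearMap.id ℂ E - ι ∘L P with hR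
  have hRu : ∀ u, R u = u - ι (P u) := fun u => by simp [hR]
  have hPR : ∀ u, P (R u) = 0 := fun u => by rw [hRu, map_sub, hP, sub_self]
  -- A single unknown Y carries both the subspace and the matrix: with V = ι + RY and M = μ₀ + PY,
  -- the part of Y in ker P tilts the subspace and PY changes the matrix. The equation Φ = 0 is the
  -- invariance A V = C V M.
  let Φ : ℂ × (N →L[ℂ] E) → (N →L[ℂ] H) := fun p =>
    A p.1 ∘L (ι + R ∘L p.2) - C ∘L ((ι + R ∘L p.2) ∘L
      (μ₀ • ContinuousLinearMap.id ℂ N + P ∘L p.2))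
  have hA1 : ContDiffAt ℂ ω (fun p : ℂ × (N →L[ℂ] E) => A p.1) (t₀, 0) :=
    ContDiffAt.comp (t₀, (0 : N →L[ℂ] E)) (g := A) hA.contDiffAt contDiffAt_fst
  have hV : ContDiff ℂ ω (fun p : ℂ × (N →L[ℂ] E) => ι + R ∘L p.2) :=
    contDiff_const.add (contDiff_const.clm_comp contDiff_snd)
  have hM : ContDiff ℂ ω (fun p : ℂ × (N →L[ℂ] E) =>
      μ₀ • ContinuousLinearMap.id ℂ N + P ∘L p.2) :=
    contDiff_const.add (contDiff_const.clm_comp contDiff_snd)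
  have hΦ : ContDiffAt ℂ ω Φ (t₀, 0) :=
    (hA1.clm_comp hV.contDiffAt).sub
      (contDiffAt_const.clm_comp (hV.clm_comp hM).contDiffAt)
  have hΦ0 : Φ (t₀, 0) = 0 := by
    ext x; simp [Φ, hker]
  -- At t₀ the map is Y ↦ ΨY plus a quadratic term, so its derivative at 0 is composition with the
  -- isomorphism Ψ and the implicit function theorem applies.
  have hlin : ∀ Y : N →L[ℂ] E, Φ (t₀, Y) =
      ((ContinuousLinearEquiv.refl ℂ N).arrowCongr Ψ : (N →L[ℂ] E) →L[ℂ] (N →L[ℂ] H)) Y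
        - C ∘L ((R ∘L Y) ∘L (P ∘L Y)) := by
    intro Y
    ext x
    simp only [Φ, sub_apply, ContinuousLinearMap.comp_apply,
      add_apply, smul_apply, ContinuousLinearMap.id_apply,
      ContinuousLinearEquiv.coe_coe, ContinuousLinearEquiv.arrowCongr_apply,
      ContinuousLinearEquiv.refl_symm, ContinuousLinearEquiv.coe_refl', id_eq]
    rw [hΨ]
    simp only [hRu, map_add, map_sub, map_smul, hker]
    abel
  have hderiv : fderiv ℂ Φ (t₀, 0) ∘L .inr ℂ ℂ (N →L[ℂ] E) =
      ((ContinuousLinearEquiv.refl ℂ N).arrowCongr Ψ : (N →L[ℂ] E) →L[ℂ] (N →L[ℂ] H)) := by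
    have h1 : HasFDerivAt (fun Y : N →L[ℂ] E => Φ (t₀, Y))
        (fderiv ℂ Φ (t₀, 0) ∘L .inr ℂ ℂ (N →L[ℂ] E)) 0 := by
      have h2 : HasFDerivAt (fun Y : N →L[ℂ] E => (t₀, Y)) (.inr ℂ ℂ (N →L[ℂ] E)) 0 :=
        hasFDerivAt_prodMk_right _ _
      exact HasFDerivAt.comp (g := Φ) (0 : N →L[ℂ] E)
        ((hΦ.differentiableAt (by simp)).hasFDerivAt) h2
    have h3 : HasFDerivAt (fun Y : N →L[ℂ] E => Φ (t₀, Y))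
        ((ContinuousLinearEquiv.refl ℂ N).arrowCongr Ψ : (N →L[ℂ] E) →L[ℂ] (N →L[ℂ] H)) 0 := by
      simp only [hlin]
      have h4 : HasFDerivAt (fun Y : N →L[ℂ] E => C ∘L ((R ∘L Y) ∘L (P ∘L Y))) 
          (0 : (N →L[ℂ] E) →L[ℂ] (N →L[ℂ] H)) 0 := by
        have hid := hasFDerivAt_id (𝕜 := ℂ) (0 : N →L[ℂ] E)
        have e1 := (hasFDerivAt_const (𝕜 := ℂ) R (0 : N →L[ℂ] E)).clm_comp hid
        have e2 := (hasFDerivAt_const (𝕜 := ℂ) P (0 : N →L[ℂ] E)).clm_comp hid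
        have e3 := (hasFDerivAt_const (𝕜 := ℂ) C (0 : N →L[ℂ] E)).clm_comp (e1.clm_comp e2)
        refine e3.congr_fderiv ?_
        ext Y x
        simp
      simpa using HasFDerivAt.fun_sub
        (((ContinuousLinearEquiv.refl ℂ N).arrowCongr Ψ).hasFDerivAt (x := 0)) h4
    exact h1.unique h3
  have hinv : (fderiv ℂ Φ (t₀, 0) ∘L .inr ℂ ℂ (N →L[ℂ] E)).IsInvertible := by
    rw [hderiv]; exact ⟨_, rfl⟩
  let Y := hΦ.implicitFunction (by simp) hinv
  have hYan : AnalyticAt ℂ Y t₀ :=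
    (hΦ.contDiffAt_implicitFunction (by simp) hinv).analyticAt
  have hY0 : Y t₀ = 0 := hΦ.implicitFunction_apply_self (by simp) hinv
  have hYeq : ∀ᶠ t in 𝓝 t₀, Φ (t, Y t) = 0 := by
    have := hΦ.eventually_apply_implicitFunction (by simp) hinv
    rwa [hΦ0] at this
  let V : ℂ → N →L[ℂ] E := fun t => ι + R ∘L Y t
  let M : ℂ → N →L[ℂ] N := fun t => μ₀ • ContinuousLinearMap.id ℂ N + P ∘L Y t
  have hVan : AnalyticAt ℂ V t₀ :=
    (contDiffAt_const.add (contDiffAt_const.clm_comp hYan.contDiffAt) :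
      ContDiffAt ℂ ω V t₀).analyticAt
  have hMan : AnalyticAt ℂ M t₀ :=
    (contDiffAt_const.add (contDiffAt_const.clm_comp hYan.contDiffAt) :
      ContDiffAt ℂ ω M t₀).analyticAt
  have hV0 : V t₀ = ι := by ext x; simp [V, hY0]
  have hM0 : M t₀ = μ₀ • ContinuousLinearMap.id ℂ N := by ext x; simp [M, hY0]
  have hPV : ∀ t x, P (V t x) = x := fun t x => by simp [V, hP, hPR]
  have hinvt : ∀ᶠ t in 𝓝 t₀, ∀ x, A t (V t x) = C (V t (M t x)) := by
    filter_upwards [hYeq] with t ht x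
    have := congrArg (fun T : N →L[ℂ] H => T x) ht
    simp only [Φ, sub_apply, ContinuousLinearMap.comp_apply,
      zero_apply, sub_eq_zero] at this
    exact this
  refine ⟨V, M, hVan, hMan, hV0, hM0, hinvt, hPV, ?_⟩
  -- A bordered operator adapted to the moved subspace. It equals Ψ at (t₀, μ₀) and therefore stays
  -- invertible nearby, which leaves no room for eigenvectors outside the range of V.
  let G : ℂ × ℂ → E →L[ℂ] H := fun p =>
    (A p.1 - p.2 • C) ∘L (ContinuousLinearMap.id ℂ E - V p.1 ∘L P) - C ∘L (V p.1 ∘L P)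
  have hG0 : G (t₀, μ₀) = Ψ := by
    ext u
    simp only [G, hV0, sub_apply, ContinuousLinearMap.comp_apply,
      smul_apply, ContinuousLinearMap.id_apply, ContinuousLinearEquiv.coe_coe,
      hΨ, map_sub, hker]
    abel
  have hGc : ContinuousAt G (t₀, μ₀) := by
    have h1 : ContinuousAt (fun p : ℂ × ℂ => A p.1) (t₀, μ₀) :=
      ContinuousAt.comp (g := A) (x := (t₀, μ₀)) hA.continuousAt continuousAt_fst
    have h2 : ContinuousAt (fun p : ℂ × ℂ => V p.1) (t₀, μ₀) :=
      ContinuousAt.comp (g := V) (x := (t₀, μ₀)) hVan.continuousAt continuousAt_fst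
    exact ((h1.sub (continuousAt_snd.smul continuousAt_const)).clm_comp
      (continuousAt_const.sub (h2.clm_comp continuousAt_const))).sub
      (continuousAt_const.clm_comp (h2.clm_comp continuousAt_const))
  have hGinv : ∀ᶠ p in 𝓝 (t₀, μ₀), ∃ e : E ≃L[ℂ] H, (e : E →L[ℂ] H) = G p := by
    have := Ψ.nhds
    rw [← hG0] at this
    exact hGc this
  have hinvt' : ∀ᶠ p : ℂ × ℂ in 𝓝 (t₀, μ₀), ∀ x, A p.1 (V p.1 x) = C (V p.1 (M p.1 x)) :=
    (continuousAt_fst (p := (t₀, μ₀))).eventually hinvt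
  filter_upwards [hGinv, hinvt'] with p ⟨e, he⟩ hp u hu
  obtain ⟨t, μ⟩ := p
  simp only at *
  set x := P u with hx
  -- This combination lies in the kernel of G. Once it vanishes, applying P gives Mx = μx, and then
  -- u = Vx.
  set y := u - V t x - V t (M t x - μ • x) with hy
  have hPy : P y = -(M t x - μ • x) := by
    rw [hy, map_sub, map_sub, hPV, hPV, ← hx, sub_self, zero_sub]
  have hGy : G (t, μ) y = 0 := by
    simp only [G, sub_apply, ContinuousLinearMap.comp_apply,
      smul_apply, ContinuousLinearMap.id_apply]
    have e1 : y - V t (P y) = u - V t x := by rw [hPy, map_neg, hy]; abel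
    rw [e1, hPy, map_sub, map_sub, hp, hu]
    simp only [map_sub, map_neg, map_smul, smul_sub]
    abel
  have hy0 : y = 0 := by
    rw [← he] at hGy
    exact (e.map_eq_zero_iff).1 hGy
  have h1 : M t x - μ • x = 0 := by
    have := hPy
    rw [hy0, map_zero] at this
    exact neg_eq_zero.1 this.symm
  refine ⟨?_, sub_eq_zero.1 h1⟩
  rw [hy, h1, map_zero, sub_zero] at hy0
  exact sub_eq_zero.1 hy0

end Splitting

end OperatorFamily

/-! ### Rellich's theorem in finite dimension -/

namespace OperatorFamily

open Filter Topology Module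
open scoped ContDiff InnerProductSpace

section Rellich

/-- The trace as a continuous linear functional on the operators of a finite-dimensional space. -/
def traceCLM (Z : Type*) [NormedAddCommGroup Z] [InnerProductSpace ℂ Z] [FiniteDimensional ℂ Z] :
    (Z →L[ℂ] Z) →L[ℂ] ℂ :=
  LinearMap.toContinuousLinearMap
    (LinearMap.trace ℂ Z ∘ₗ ContinuousLinearMap.coeLM ℂ)

variable {Z : Type*} [NormedAddCommGroup Z] [InnerProductSpace ℂ Z] [FiniteDimensional ℂ Z]

lemma traceCLM_apply (T : Z →L[ℂ] Z) : traceCLM Z T = LinearMap.trace ℂ Z (T : Z →ₗ[ℂ] Z) := rfl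

lemma traceCLM_id : traceCLM Z (ContinuousLinearMap.id ℂ Z) = finrank ℂ Z :=
  LinearMap.trace_id ℂ Z

/-- An operator that is symmetric for a nondegenerate sesquilinear form has a real trace. -/
lemma traceCLM_im_eq_zero (M : Z →L[ℂ] Z) (G : Z ≃L[ℂ] Z)
    (h : ∀ x y, ⟪G (M x), y⟫_ℂ = ⟪G x, M y⟫_ℂ) : (traceCLM Z M).im = 0 := by
  -- Symmetry for the form says that the adjoint of M is G M G⁻¹. Its trace is thus both the trace
  -- of M and its conjugate.
  have hadj : (LinearMap.adjoint (M : Z →ₗ[ℂ] Z)) =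
      G.toLinearEquiv.conj (M : Z →ₗ[ℂ] Z) := by
    ext x
    refine ext_inner_right ℂ fun y => ?_
    rw [LinearMap.adjoint_inner_left]
    have := h (G.symm x) y
    rw [G.apply_symm_apply] at this
    simpa [LinearEquiv.conj_apply] using this.symm
  have h1 : LinearMap.trace ℂ Z (LinearMap.adjoint (M : Z →ₗ[ℂ] Z)) = traceCLM Z M := by
    rw [hadj, LinearMap.trace_conj']; rfl
  have h2 : LinearMap.trace ℂ Z (LinearMap.adjoint (M : Z →ₗ[ℂ] Z))
      = starRingEnd ℂ (traceCLM Z M) := by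
    rw [traceCLM_apply, LinearMap.trace_eq_sum_inner _ (stdOrthonormalBasis ℂ Z),
      LinearMap.trace_eq_sum_inner _ (stdOrthonormalBasis ℂ Z), map_sum]
    refine Finset.sum_congr rfl fun i _ => ?_
    rw [LinearMap.adjoint_inner_right, inner_conj_symm]
  exact Complex.conj_eq_iff_im.1 (h2.symm.trans h1)

/-- The eigenspace of a symmetric operator `S` splits off holomorphically. -/
lemma exists_splitting_eigenspace {S : ℂ → Z →L[ℂ] Z} {t₀ : ℂ} (hS : AnalyticAt ℂ S t₀)
    (hsymm : (S t₀ : Z →ₗ[ℂ] Z).IsSymmetric) (τ : ℂ) :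
    ∃ (V : ℂ → End.eigenspace (S t₀ : Z →ₗ[ℂ] Z) τ →L[ℂ] Z)
      (M : ℂ → End.eigenspace (S t₀ : Z →ₗ[ℂ] Z) τ →L[ℂ] End.eigenspace (S t₀ : Z →ₗ[ℂ] Z) τ),
      AnalyticAt ℂ V t₀ ∧ AnalyticAt ℂ M t₀ ∧ V t₀ = Submodule.subtypeL _ ∧
      (∀ᶠ t in 𝓝 t₀, ∀ x, S t (V t x) = V t (M t x)) := by
  set K := End.eigenspace (S t₀ : Z →ₗ[ℂ] Z) τ with hK
  have hmem : ∀ x : K, S t₀ x = τ • (x : Z) := fun x => End.mem_eigenspace_iff.1 x.2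
  let P := K.orthogonalProjectionOnto
  have hP : ∀ x : K, P x = x := fun x => K.orthogonalProjectionOnto_mem_subspace_eq_self x
  let f : Z →L[ℂ] Z := S t₀ - τ • ContinuousLinearMap.id ℂ Z - K.subtypeL ∘L P
  have hf : ∀ u, f u = S t₀ u - τ • u - (P u : Z) := fun u => by simp [f]
  have hinj : Function.Injective (f : Z →ₗ[ℂ] Z) := by
    refine (injective_iff_map_eq_zero _).2 fun u hu => ?_
    change f u = 0 at hu
    rw [hf] at hu
    -- Symmetry moves S - τ onto Pu, where it vanishes. This needs τ to be real, which is known as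
    -- soon as Pu ≠ 0.
    have h1 : ⟪((P u : K) : Z), S t₀ u - τ • u⟫_ℂ = 0 := by
      by_cases h0 : P u = 0
      · simp [h0]
      have hreal : starRingEnd ℂ τ = τ := hsymm.conj_eigenvalue_eq_self
        (End.hasEigenvalue_of_hasEigenvector ⟨(P u).2, fun h => h0 (Subtype.ext h)⟩)
      have := hsymm (P u : Z) u
      simp only [ContinuousLinearMap.coe_coe, hmem, inner_smul_left, hreal] at this
      rw [inner_sub_right, inner_smul_right, ← this, sub_self]
    have h2 : P u = 0 := by
      rw [sub_eq_zero.1 hu, inner_self_eq_zero] at h1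
      exact Subtype.ext h1
    rw [h2, ZeroMemClass.coe_zero, sub_zero] at hu
    have h3 : u ∈ K := End.mem_eigenspace_iff.2 (sub_eq_zero.1 hu)
    have := hP ⟨u, h3⟩
    simp only [h2] at this
    exact (congrArg Subtype.val this).symm
  let Ψ : Z ≃L[ℂ] Z := (LinearEquiv.ofInjectiveEndo (f : Z →ₗ[ℂ] Z) hinj).toContinuousLinearEquiv
  obtain ⟨V, M, h1, h2, h3, -, h5, -⟩ := exists_analytic_splitting hS
    (ContinuousLinearMap.id ℂ Z) τ K.subtypeL P hP (fun x => hmem x) Ψ (fun u => hf u)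
  exact ⟨V, M, h1, h2, h3, h5⟩

/-- **Rellich's theorem**: a holomorphic family of operators on a finite-dimensional space that is
symmetric for real parameters has a holomorphic basis of eigenvectors, with holomorphic
eigenvalues. The inner product may depend continuously on the parameter. -/
theorem exists_analytic_eigenbasis.{u} (n : ℕ) : ∀ (Z : Type u) [NormedAddCommGroup Z]
    [InnerProductSpace ℂ Z] [FiniteDimensional ℂ Z], finrank ℂ Z = n →
    ∀ (t₀ : ℝ) (M : ℂ → Z →L[ℂ] Z) (G : ℝ → Z →L[ℂ] Z), AnalyticAt ℂ M t₀ → ContinuousAt G t₀ →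
      G t₀ = ContinuousLinearMap.id ℂ Z →
      (∀ᶠ t : ℝ in 𝓝 t₀, ∀ x y, ⟪G t (M t x), y⟫_ℂ = ⟪G t x, M t y⟫_ℂ) →
    ∃ (κ : Type) (_ : Fintype κ) (lam : κ → ℂ → ℂ) (w : κ → ℂ → Z),
      (∀ i, AnalyticAt ℂ (lam i) t₀) ∧ (∀ i, AnalyticAt ℂ (w i) t₀) ∧
      (∀ᶠ t : ℝ in 𝓝 t₀, ∀ i, (lam i t).im = 0) ∧
      LinearIndependent ℂ (fun i => w i t₀) ∧ ⊤ ≤ Submodule.span ℂ (range fun i => w i t₀) ∧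
      ∀ᶠ t in 𝓝 (t₀ : ℂ), ∀ i, M t (w i t) = lam i t • w i t := by
  induction n using Nat.strong_induction_on with
  | _ n IH =>
  intro Z _ _ _ hn t₀ M G hM hG hG0 hsymm
  have htend : Tendsto (fun t : ℝ => (t : ℂ)) (𝓝 t₀) (𝓝 (t₀ : ℂ)) :=
    Complex.continuous_ofReal.continuousAt
  have hGinv : ∀ᶠ t in 𝓝 t₀, ∃ e : Z ≃L[ℂ] Z, (e : Z →L[ℂ] Z) = G t := by
    have := (ContinuousLinearEquiv.refl ℂ Z).nhds
    rw [ContinuousLinearEquiv.coe_refl, ← hG0] at this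
    exact hG this
  -- Subtracting the mean eigenvalue makes the family traceless. After division by the largest
  -- possible power of t - t₀, its value at t₀ is nonzero and traceless, hence not scalar, so each
  -- of its eigenspaces is smaller than Z and the induction applies. For n = 0 the quotient is 0,
  -- which does no harm.
  set c : ℂ → ℂ := fun t => traceCLM Z (M t) / n with hc
  have hcan : AnalyticAt ℂ c t₀ := by
    have : AnalyticAt ℂ (fun t => traceCLM Z (M t)) t₀ := (traceCLM Z).analyticAt _ |>.comp hM
    exact this.div_const
  have hcreal : ∀ᶠ t : ℝ in 𝓝 t₀, (c t).im = 0 := by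
    filter_upwards [hGinv, hsymm] with t ⟨e, he⟩ ht
    have h1 : (traceCLM Z (M t)).im = 0 := traceCLM_im_eq_zero _ e (by
      intro x y
      have := ht x y
      rwa [← he] at this)
    simp only [hc]
    rw [← Complex.ofReal_natCast, Complex.div_ofReal_im, h1, zero_div]
  set D : ℂ → Z →L[ℂ] Z := fun t => M t - c t • ContinuousLinearMap.id ℂ Z with hD
  have hDan : AnalyticAt ℂ D t₀ := hM.sub (hcan.smul analyticAt_const)
  have hDtr : ∀ t, traceCLM Z (D t) = 0 := by
    intro t
    simp only [hD, map_sub, map_smul, traceCLM_id, hn, hc, smul_eq_mul]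
    by_cases h0 : n = 0
    · have : Subsingleton Z := finrank_zero_iff.1 (hn.trans h0)
      have : M t = 0 := by ext x; exact Subsingleton.elim _ _
      simp [this]
    · have : (n : ℂ) ≠ 0 := by exact_mod_cast h0
      field_simp; ring
  by_cases hzero : ∀ᶠ t in 𝓝 (t₀ : ℂ), D t = 0
  · refine ⟨Fin (finrank ℂ Z), inferInstance, fun _ => c, fun i _ => stdOrthonormalBasis ℂ Z i,
      fun _ => hcan, fun _ => analyticAt_const, hcreal.mono fun t ht _ => ht, ?_, ?_, ?_⟩
    · exact (stdOrthonormalBasis ℂ Z).orthonormal.linearIndependent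
    · have := (stdOrthonormalBasis ℂ Z).toBasis.span_eq
      rw [OrthonormalBasis.coe_toBasis] at this
      exact this.ge
    · filter_upwards [hzero] with t ht i
      have := congrArg (fun T : Z →L[ℂ] Z => T (stdOrthonormalBasis ℂ Z i)) ht
      simpa [hD, sub_eq_zero] using this
  obtain ⟨k, S, hSan, hS0, hDS⟩ := (hDan.exists_eventuallyEq_pow_smul_nonzero_iff).2 hzero
  have hne : ∀ᶠ t : ℝ in 𝓝[≠] t₀, ((t : ℂ) - t₀) ^ k ≠ 0 := by
    filter_upwards [self_mem_nhdsWithin] with t ht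
    refine pow_ne_zero _ (sub_ne_zero.2 ?_)
    exact_mod_cast ht
  have hScont : ContinuousAt (fun t : ℝ => S t) t₀ :=
    ContinuousAt.comp (g := S) hSan.continuousAt Complex.continuous_ofReal.continuousAt
  have hStr : traceCLM Z (S t₀) = 0 := by
    have h1 : Tendsto (fun t : ℝ => traceCLM Z (S t)) (𝓝[≠] t₀) (𝓝 (traceCLM Z (S t₀))) :=
      (((traceCLM Z).continuous.continuousAt.comp hScont).tendsto).mono_left nhdsWithin_le_nhds
    refine tendsto_nhds_unique h1 (tendsto_const_nhds.congr' ?_)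
    filter_upwards [hne, (htend.eventually hDS).filter_mono nhdsWithin_le_nhds] with t h2 h3
    have h4 := hDtr t
    rw [h3, map_smul, smul_eq_zero] at h4
    exact (h4.resolve_left h2).symm
  have hSsymm' : ∀ᶠ t : ℝ in 𝓝[≠] t₀, ∀ x y, ⟪G t (S t x), y⟫_ℂ = ⟪G t x, S t y⟫_ℂ := by
    filter_upwards [hne, (htend.eventually hDS).filter_mono nhdsWithin_le_nhds,
      hsymm.filter_mono nhdsWithin_le_nhds, hcreal.filter_mono nhdsWithin_le_nhds]
      with t h2 h3 h4 h5 x y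
    have h6 : ⟪G t (D t x), y⟫_ℂ = ⟪G t x, D t y⟫_ℂ := by
      have h7 : starRingEnd ℂ (c t) = c t := Complex.conj_eq_iff_im.2 h5
      simp only [hD, sub_apply, smul_apply, ContinuousLinearMap.id_apply, map_sub, map_smul,
        inner_sub_left, inner_sub_right, inner_smul_left, inner_smul_right, h4 x y, h7]
    rw [h3] at h6
    have h8 : starRingEnd ℂ (((t : ℂ) - t₀) ^ k) = ((t : ℂ) - t₀) ^ k := by simp
    simp only [smul_apply, map_smul, inner_smul_left, inner_smul_right, h8] at h6
    exact mul_left_cancel₀ h2 h6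
  -- The division by (t - t₀)^k keeps the symmetry only for t ≠ t₀; at t₀ it is recovered as a
  -- limit, and there the form is the given inner product because G t₀ is the identity.
  have hSsymm : (S t₀ : Z →ₗ[ℂ] Z).IsSymmetric := by
    intro x y
    have h1 : Tendsto (fun t : ℝ => ⟪G t (S t x), y⟫_ℂ - ⟪G t x, S t y⟫_ℂ) (𝓝[≠] t₀)
        (𝓝 (⟪G t₀ (S t₀ x), y⟫_ℂ - ⟪G t₀ x, S t₀ y⟫_ℂ)) := by
      have : ContinuousAt (fun t : ℝ => ⟪G t (S t x), y⟫_ℂ - ⟪G t x, S t y⟫_ℂ) t₀ :=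
        ((hG.clm_apply (hScont.clm_apply continuousAt_const)).inner continuousAt_const).sub
          ((hG.clm_apply continuousAt_const).inner (hScont.clm_apply continuousAt_const))
      exact this.tendsto.mono_left nhdsWithin_le_nhds
    have h2 : Tendsto (fun t : ℝ => ⟪G t (S t x), y⟫_ℂ - ⟪G t x, S t y⟫_ℂ) (𝓝[≠] t₀) (𝓝 0) :=
      tendsto_const_nhds.congr' (hSsymm'.mono fun t ht => (sub_eq_zero.2 (ht x y)).symm)
    have := tendsto_nhds_unique h1 h2
    simpa [hG0, sub_eq_zero] using this
  replace hSsymm' : ∀ᶠ t : ℝ in 𝓝 t₀, ∀ x y, ⟪G t (S t x), y⟫_ℂ = ⟪G t x, S t y⟫_ℂ := by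
    filter_upwards [eventually_nhdsWithin_iff.1 hSsymm'] with t ht x y
    by_cases h : t = t₀
    · subst h; simpa [hG0] using hSsymm x y
    · exact ht h x y
  have hlt : ∀ τ : ℂ, finrank ℂ (End.eigenspace (S t₀ : Z →ₗ[ℂ] Z) τ) < n := by
    intro τ
    rw [← hn]
    refine Submodule.finrank_lt fun htop => hS0 ?_
    have h1 : S t₀ = τ • ContinuousLinearMap.id ℂ Z := by
      ext x
      have : x ∈ End.eigenspace (S t₀ : Z →ₗ[ℂ] Z) τ := by rw [htop]; trivial
      simpa using End.mem_eigenspace_iff.1 this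
    have h2 := hStr
    rw [h1, map_smul, traceCLM_id, smul_eq_mul, mul_eq_zero] at h2
    rcases h2 with h2 | h2
    · rw [h1, h2, zero_smul]
    · have : Subsingleton Z := finrank_zero_iff.1 (by exact_mod_cast h2)
      ext x; exact Subsingleton.elim _ _
  have hpiece : ∀ τ : End.Eigenvalues (S t₀ : Z →ₗ[ℂ] Z),
      ∃ (κ : Type) (_ : Fintype κ) (lam : κ → ℂ → ℂ) (w : κ → ℂ → Z)
        (b : Basis κ ℂ (End.eigenspace (S t₀ : Z →ₗ[ℂ] Z) τ)),
      (∀ i, AnalyticAt ℂ (lam i) t₀) ∧ (∀ i, AnalyticAt ℂ (w i) t₀) ∧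
      (∀ᶠ t : ℝ in 𝓝 t₀, ∀ i, (lam i t).im = 0) ∧ (∀ i, w i t₀ = b i) ∧
      ∀ᶠ t in 𝓝 (t₀ : ℂ), ∀ i, S t (w i t) = lam i t • w i t := by
    intro τ
    obtain ⟨V, N, hV, hN, hV0, hVN⟩ := exists_splitting_eigenspace hSan hSsymm τ
    have hVc : ContinuousAt (fun t : ℝ => V t) t₀ :=
      ContinuousAt.comp (g := V) hV.continuousAt Complex.continuous_ofReal.continuousAt
    have hVadj : ContinuousAt (fun t : ℝ => ContinuousLinearMap.adjoint (V t)) t₀ :=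
      (ContinuousLinearMap.adjoint (𝕜 := ℂ)).continuous.continuousAt.comp hVc
    -- The form is pulled back to the eigenspace as V* G V. It is again the identity at t₀, since V
    -- t₀ is the isometric inclusion. This change of form is why the induction allows the inner
    -- product to vary.
    obtain ⟨κ, hκ, lam, w, h1, h2, h3, h4, h5, h6⟩ := IH _ (hlt τ) _ rfl t₀ N
      (fun t => ContinuousLinearMap.adjoint (V t) ∘L (G t ∘L V t)) hN
      (hVadj.clm_comp (hG.clm_comp hVc)) (by
        ext x
        refine congrArg Subtype.val (ext_inner_right ℂ fun y => ?_)
        simp only [ContinuousLinearMap.comp_apply, ContinuousLinearMap.adjoint_inner_left, hV0,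
          hG0]
        rfl) (by
        filter_upwards [hSsymm', htend.eventually hVN] with t h1 h2 x y
        simp only [ContinuousLinearMap.comp_apply, ContinuousLinearMap.adjoint_inner_left]
        rw [← h2, h1, h2])
    refine ⟨κ, hκ, lam, fun i t => V t (w i t), Basis.mk h4 h5, h1, fun i =>
      (hV.contDiffAt.clm_apply (h2 i).contDiffAt : ContDiffAt ℂ ω _ _).analyticAt, h3,
      fun i => ?_, ?_⟩
    · simp [hV0]
    · filter_upwards [h6, hVN] with t h7 h8 i
      rw [h8, h7, map_smul]
  choose κ hκ lam w b h1 h2 h3 h4 h5 using hpiece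
  have hint := hSsymm.direct_sum_isInternal
  let B := hint.collectedBasis b
  have hB : (fun a : Σ τ, κ τ => w a.1 a.2 t₀) = B := by
    funext a
    simp only [B, DirectSum.IsInternal.collectedBasis_coe, h4]
  refine ⟨Σ τ, κ τ, inferInstance, fun a t => c t + (t - t₀) ^ k * lam a.1 a.2 t,
    fun a => w a.1 a.2, fun a => ?_, fun a => h2 _ _, ?_, ?_, ?_, ?_⟩
  · exact hcan.add (((analyticAt_id.sub analyticAt_const).pow k).mul (h1 _ _))
  · filter_upwards [hcreal, eventually_all.2 h3] with t h6 h7 a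
    have h8 : ((t : ℂ) - t₀) ^ k = (((t - t₀) ^ k : ℝ) : ℂ) := by push_cast; rfl
    rw [Complex.add_im, h6, h8, Complex.im_ofReal_mul, h7]
    simp
  · rw [hB]; exact B.linearIndependent
  · rw [hB]; exact B.span_eq.ge
  · filter_upwards [hDS, eventually_all.2 h5] with t h6 h7 a
    have h8 : M t = D t + c t • ContinuousLinearMap.id ℂ Z := by simp [hD]
    rw [h8, h6]
    simp only [add_apply, smul_apply, ContinuousLinearMap.id_apply, h7, add_smul, smul_smul]
    rw [add_comm]

end Rellich

end OperatorFamily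

/-! ### Operators of Fredholm index zero and symmetric pencils -/

namespace OperatorFamily

open Filter Topology Module
open scoped ContDiff InnerProductSpace

section FredholmIndexZero

variable {E H : Type*} [NormedAddCommGroup E] [NormedSpace ℂ E]
  [NormedAddCommGroup H] [NormedSpace ℂ H]

/-- Sums of an isomorphism and an operator of finite rank. -/
def IsFinitePerturbation (B : E →L[ℂ] H) : Prop :=
  ∃ (e : E ≃L[ℂ] H) (R : E →L[ℂ] H), FiniteDimensional ℂ (LinearMap.range (R : E →ₗ[ℂ] H)) ∧
    B = e + R

namespace IsFinitePerturbation

variable {B : E →L[ℂ] H}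

/-- On the kernel e x = R(-x), so the isomorphism e embeds the kernel into the range of R. -/
lemma finiteDimensional_ker (hB : IsFinitePerturbation B) :
    FiniteDimensional ℂ (LinearMap.ker (B : E →ₗ[ℂ] H)) := by
  obtain ⟨e, R, hR, rfl⟩ := hB
  let f : LinearMap.ker ((e + R : E →L[ℂ] H) : E →ₗ[ℂ] H) →ₗ[ℂ]
      LinearMap.range (R : E →ₗ[ℂ] H) :=
    ((e : E →L[ℂ] H) : E →ₗ[ℂ] H).restrict fun x hx => by
      have h1 : e x + R x = 0 := hx
      refine ⟨-x, ?_⟩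
      simp [eq_neg_of_add_eq_zero_left h1]
  refine FiniteDimensional.of_injective f fun x y hxy => Subtype.ext (e.injective ?_)
  exact congrArg Subtype.val hxy

lemma add_finiteRank (hB : IsFinitePerturbation B) (T : E →L[ℂ] H)
    (hT : FiniteDimensional ℂ (LinearMap.range (T : E →ₗ[ℂ] H))) :
    IsFinitePerturbation (B + T) := by
  obtain ⟨e, R, hR, rfl⟩ := hB
  refine ⟨e, R + T, ?_, add_assoc _ _ _⟩
  refine Submodule.finiteDimensional_of_le (S₂ := LinearMap.range (R : E →ₗ[ℂ] H) ⊔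
    LinearMap.range (T : E →ₗ[ℂ] H)) ?_
  rintro _ ⟨x, rfl⟩
  exact Submodule.add_mem_sup ⟨x, rfl⟩ ⟨x, rfl⟩

/-- The question reduces to the finite-dimensional range of R: the ansatz u = e⁻¹(g + x) solves (e +
R)u = g when x + R e⁻¹x = -R e⁻¹g, and the left side is an injective endomorphism of that range. -/
lemma surjective_of_injective (hB : IsFinitePerturbation B) (hinj : Function.Injective B) :
    Function.Surjective B := by
  obtain ⟨e, R, hR, rfl⟩ := hB
  set F := LinearMap.range (R : E →ₗ[ℂ] H)
  let f : F →ₗ[ℂ] F := (LinearMap.id + (R : E →ₗ[ℂ] H) ∘ₗ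
    ((e.symm : H →L[ℂ] E) : H →ₗ[ℂ] E)).restrict fun x hx => F.add_mem hx ⟨e.symm x, rfl⟩
  have hf : ∀ x : F, (f x : H) = (x : H) + R (e.symm x) := fun x => rfl
  have hfi : Function.Injective f := by
    refine (injective_iff_map_eq_zero _).2 fun x hx => ?_
    have h1 : (x : H) + R (e.symm x) = 0 := by rw [← hf, hx]; rfl
    have h2 : (e + R : E →L[ℂ] H) (e.symm x) = (e + R : E →L[ℂ] H) 0 := by simpa using h1
    have h3 := hinj h2
    exact Subtype.ext (by simpa using h3)
  have hfs := LinearMap.injective_iff_surjective.1 hfi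
  intro g
  obtain ⟨x, hx⟩ := hfs ⟨-R (e.symm g), F.neg_mem ⟨_, rfl⟩⟩
  refine ⟨e.symm (g + x), ?_⟩
  have h1 : (x : H) + R (e.symm x) = -R (e.symm g) := by rw [← hf, hx]
  simp only [add_apply, ContinuousLinearEquiv.coe_coe, e.apply_symm_apply, map_add]
  rw [h1]
  abel

lemma exists_equiv [CompleteSpace E] [CompleteSpace H] (hB : IsFinitePerturbation B)
    (hinj : Function.Injective B) : ∃ Ψ : E ≃L[ℂ] H, ∀ u, Ψ u = B u :=
  ⟨ContinuousLinearEquiv.ofBijective B (LinearMap.ker_eq_bot.2 hinj)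
    (LinearMap.range_eq_top.2 (hB.surjective_of_injective hinj)), fun _ => rfl⟩

end IsFinitePerturbation

end FredholmIndexZero

/-- For a diagonal operator, comparison of coordinates leaves only the basis vectors whose
eigenvalue is μ. -/
lemma finrank_eigenspace_of_basis {Z κ : Type*} [AddCommGroup Z] [Module ℂ Z] [Fintype κ]
    (b : Basis κ ℂ Z) (M : Z →ₗ[ℂ] Z) (lam : κ → ℂ) (h : ∀ i, M (b i) = lam i • b i) (μ : ℂ) :
    finrank ℂ (End.eigenspace M μ) = Nat.card {i // lam i = μ} := by
  classical
  have h1 : End.eigenspace M μ = Submodule.span ℂ (range fun i : {i // lam i = μ} => b i) := by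
    refine le_antisymm (fun x hx => ?_) (Submodule.span_le.2 ?_)
    · have hx' := End.mem_eigenspace_iff.1 hx
      have hc : ∀ i, b.repr (M x) i = lam i * b.repr x i := by
        intro i
        have h2 : M x = ∑ j, (b.repr x j * lam j) • b j := by
          conv_lhs => rw [← b.sum_repr x]
          simp only [map_sum, map_smul, h, smul_smul]
        rw [h2, b.repr_sum_self, mul_comm]
      rw [← b.sum_repr x]
      refine Submodule.sum_mem _ fun i _ => ?_
      by_cases hi : lam i = μ
      · exact Submodule.smul_mem _ _ (Submodule.subset_span ⟨⟨i, hi⟩, rfl⟩)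
      · have h2 := hc i
        rw [hx', map_smul, Finsupp.smul_apply, smul_eq_mul] at h2
        have h3 : b.repr x i = 0 := by
          have : (lam i - μ) * b.repr x i = 0 := by rw [sub_mul, h2, sub_self]
          exact (mul_eq_zero.1 this).resolve_left (sub_ne_zero.2 hi)
        rw [h3, zero_smul]
        exact Submodule.zero_mem _
    · rintro _ ⟨i, rfl⟩
      refine End.mem_eigenspace_iff.2 ?_
      rw [h, i.2]
  rw [h1, Nat.card_eq_fintype_card]
  exact finrank_span_eq_card (b.linearIndependent.comp _ Subtype.val_injective)

section Pencil

variable {E H : Type*} [NormedAddCommGroup E] [NormedSpace ℂ E]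
  [NormedAddCommGroup H] [InnerProductSpace ℂ H]

/-- The pencils `A t - μ C` are symmetric for real `t`, `μ` when `E` is included in `H` by `J`,
they have Fredholm index `0`, and `C` is positive, with square root `S`. -/
structure IsSymmetricPencil (A : ℂ → E →L[ℂ] H) (C J S : E →L[ℂ] H) : Prop where
  analyticAt : ∀ t, AnalyticAt ℂ A t
  symm : ∀ (t : ℝ) (u v : E), ⟪A t u, J v⟫_ℂ = ⟪J u, A t v⟫_ℂ
  form : ∀ u v : E, ⟪C u, J v⟫_ℂ = ⟪S u, S v⟫_ℂ
  injective : Function.Injective S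
  fredholm : ∀ t μ : ℝ, IsFinitePerturbation (A t - (μ : ℂ) • C)

namespace IsSymmetricPencil

variable {A : ℂ → E →L[ℂ] H} {C J S : E →L[ℂ] H}

lemma form' (h : IsSymmetricPencil A C J S) (u v : E) : ⟪J u, C v⟫_ℂ = ⟪S u, S v⟫_ℂ := by
  rw [← inner_conj_symm, h.form, inner_conj_symm]

lemma symm_sub (h : IsSymmetricPencil A C J S) (t μ : ℝ) (u v : E) :
    ⟪(A t - (μ : ℂ) • C) u, J v⟫_ℂ = ⟪J u, (A t - (μ : ℂ) • C) v⟫_ℂ := by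
  simp only [sub_apply, smul_apply, inner_sub_left, inner_sub_right, inner_smul_left,
    inner_smul_right, h.symm, h.form, h.form', Complex.conj_ofReal]

/-- The eigenspace of the pencil at the parameter `t` for the eigenvalue `μ`. -/
abbrev eigenspace (A : ℂ → E →L[ℂ] H) (C : E →L[ℂ] H) (t μ : ℝ) : Submodule ℂ E :=
  LinearMap.ker ((A t - (μ : ℂ) • C : E →L[ℂ] H) : E →ₗ[ℂ] H)

lemma mem_eigenspace {t μ : ℝ} {u : E} : u ∈ eigenspace A C t μ ↔ A t u = (μ : ℂ) • C u := by
  rw [LinearMap.mem_ker]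
  simp [sub_eq_zero]

lemma finiteDimensional_eigenspace (h : IsSymmetricPencil A C J S) (t μ : ℝ) :
    FiniteDimensional ℂ (eigenspace A C t μ) := (h.fredholm t μ).finiteDimensional_ker

variable [CompleteSpace E] [CompleteSpace H]

/-- A section and a projection for an eigenspace, together with the bordered operator. -/
lemma exists_bordered (h : IsSymmetricPencil A C J S) (t μ : ℝ) :
    ∃ (Z : Submodule ℂ H) (_ : FiniteDimensional ℂ Z) (ι : Z →L[ℂ] E) (P : E →L[ℂ] Z)
      (Ψ : E ≃L[ℂ] H), (∀ x, P (ι x) = x) ∧ (∀ x, S (ι x) = x) ∧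
      (∀ x, A t (ι x) = (μ : ℂ) • C (ι x)) ∧
      (∀ u, Ψ u = A t u - (μ : ℂ) • C u - C (ι (P u))) ∧
      ∀ u ∈ eigenspace A C t μ, ι (P u) = u := by
  have hfin := h.finiteDimensional_eigenspace t μ
  let K := eigenspace A C t μ
  -- E has no inner product, so the eigenspace is replaced by its image under S, on which the inner
  -- product of H is the form of C. Orthogonal projection after S then serves as the projection P.
  let Z : Submodule ℂ H := K.map (S : E →ₗ[ℂ] H)
  have hZ : FiniteDimensional ℂ Z := inferInstanceAs (FiniteDimensional ℂ (K.map (S : E →ₗ[ℂ] H)))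
  let e : K ≃ₗ[ℂ] Z := Submodule.equivMapOfInjective (S : E →ₗ[ℂ] H) h.injective K
  let ι : Z →L[ℂ] E := LinearMap.toContinuousLinearMap (K.subtype ∘ₗ (e.symm : Z →ₗ[ℂ] K))
  have hι : ∀ x, ι x = (e.symm x : E) := fun x => rfl
  have hSι : ∀ x : Z, S (ι x) = x := fun x => by
    have := congrArg Subtype.val (e.apply_symm_apply x)
    exact this
  let P : E →L[ℂ] Z := Z.orthogonalProjectionOnto ∘L S
  have hPι : ∀ x, P (ι x) = x := fun x => by
    change Z.orthogonalProjectionOnto (S (ι x)) = x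
    rw [hSι]
    exact Z.orthogonalProjectionOnto_mem_subspace_eq_self x
  have hker : ∀ x, A t (ι x) = (μ : ℂ) • C (ι x) := fun x => mem_eigenspace.1 (e.symm x).2
  have hιP : ∀ u ∈ eigenspace A C t μ, ι (P u) = u := by
    intro u hu
    have h1 : ι (e ⟨u, hu⟩) = u := by rw [hι, e.symm_apply_apply]
    rw [← h1, hPι]
  have hB := (h.fredholm t μ).add_finiteRank (-(C ∘L (ι ∘L P))) (by
    refine Submodule.finiteDimensional_of_le
      (S₂ := LinearMap.range ((C ∘L ι : Z →L[ℂ] H) : Z →ₗ[ℂ] H)) ?_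
    rintro _ ⟨x, rfl⟩
    exact ⟨-P x, by simp⟩)
  have hBu : ∀ u, ((A t - (μ : ℂ) • C) + -(C ∘L (ι ∘L P))) u
      = A t u - (μ : ℂ) • C u - C (ι (P u)) := fun u => by
    simp [sub_eq_add_neg]
  obtain ⟨Ψ, hΨ⟩ := hB.exists_equiv (by
    refine (injective_iff_map_eq_zero _).2 fun u hu => ?_
    rw [hBu, sub_eq_zero] at hu
    -- Pairing the bordered equation with an eigenvector removes A - μC by symmetry and leaves the
    -- square of the norm of S ι P u.
    have h1 : ⟪C (ι (P u)), J (ι (P u))⟫_ℂ = 0 := by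
      rw [← hu]
      have h2 := h.symm_sub t μ u (ι (P u))
      have h3 : (A t - (μ : ℂ) • C) (ι (P u)) = 0 := by
        simp [hker]
      rw [h3, inner_zero_right] at h2
      exact h2
    rw [h.form, inner_self_eq_zero] at h1
    have h2 : P u = 0 := by
      have := hSι (P u)
      rw [h1] at this
      exact Subtype.ext this.symm
    rw [h2, map_zero, map_zero, sub_eq_zero] at hu
    have h3 := hιP u (mem_eigenspace.2 hu)
    rw [← h3, h2, map_zero])
  exact ⟨Z, hZ, ι, P, Ψ, hPι, hSι, hker, fun u => (hΨ u).trans (hBu u), hιP⟩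

/-- Near `(t₀, μ₀)` the eigenvalues of the pencil are the values of finitely many analytic
functions, with multiplicities; these functions have continuous eigenvectors. -/
theorem exists_local_eigenbasis (h : IsSymmetricPencil A C J S) (t₀ μ₀ : ℝ) :
    ∃ (κ : Type) (_ : Fintype κ) (lam : κ → ℝ → ℝ) (w : κ → ℝ → E),
      (∀ i, AnalyticAt ℝ (lam i) t₀) ∧ (∀ i, lam i t₀ = μ₀) ∧ (∀ i, ContinuousAt (w i) t₀) ∧
      LinearIndependent ℂ (fun i => w i t₀) ∧
      Submodule.span ℂ (range fun i => w i t₀) = eigenspace A C t₀ μ₀ ∧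
      (∀ᶠ t : ℝ in 𝓝 t₀, ∀ i, A t (w i t) = (lam i t : ℂ) • C (w i t)) ∧
      ∀ᶠ p : ℝ × ℝ in 𝓝 (t₀, μ₀),
        finrank ℂ (eigenspace A C p.1 p.2) = Nat.card {i // lam i p.1 = p.2} := by
  obtain ⟨Z, hZ, ι, P, Ψ, hPι, hSι, hker, hΨ, hιP⟩ := h.exists_bordered t₀ μ₀
  obtain ⟨V, M, hV, hM, hV0, hM0, hVM, hPV, hnear⟩ :=
    exists_analytic_splitting (h.analyticAt t₀) C μ₀ ι P hPι hker Ψ hΨ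
  have htend : Tendsto (fun t : ℝ => (t : ℂ)) (𝓝 t₀) (𝓝 (t₀ : ℂ)) :=
    Complex.continuous_ofReal.continuousAt
  have hVc : ContinuousAt (fun t : ℝ => S ∘L V t) t₀ :=
    continuousAt_const.clm_comp
      (ContinuousAt.comp (g := V) hV.continuousAt Complex.continuous_ofReal.continuousAt)
  -- The matrix M t is symmetric for the form ⟨SVx, SVy⟩ = ⟨CVx, JVy⟩, because C V M = A V and A is
  -- symmetric. At t₀ the form is the inner product of Z since S ι x = x.
  obtain ⟨κ, hκ, lam, w, h1, h2, h3, h4, h5, h6⟩ := exists_analytic_eigenbasis _ Z rfl t₀ M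
    (fun t => ContinuousLinearMap.adjoint (S ∘L V t) ∘L (S ∘L V t)) hM
    (((ContinuousLinearMap.adjoint (𝕜 := ℂ)).continuous.continuousAt.comp hVc).clm_comp hVc) (by
      ext x
      refine congrArg Subtype.val (ext_inner_right ℂ fun y => ?_)
      simp only [ContinuousLinearMap.comp_apply, ContinuousLinearMap.adjoint_inner_left, hV0, hSι]
      rfl) (by
      filter_upwards [htend.eventually hVM] with t ht x y
      simp only [ContinuousLinearMap.comp_apply, ContinuousLinearMap.adjoint_inner_left]
      rw [← h.form, ← ht, h.symm, ht, h.form'])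
  have hw0 : ∀ i, w i t₀ ≠ 0 := fun i => h4.ne_zero i
  have hwc : ContinuousAt (fun t : ℝ => fun i => w i t) t₀ :=
    continuousAt_pi.2 fun i => ContinuousAt.comp (g := w i) (h2 i).continuousAt
      Complex.continuous_ofReal.continuousAt
  have hindep : ∀ᶠ t : ℝ in 𝓝 t₀, LinearIndependent ℂ fun i => w i t :=
    hwc (isOpen_setOfPred_linearIndependent.mem_nhds h4)
  have hcard : Fintype.card κ = finrank ℂ Z := by
    rw [finrank_eq_card_basis (Basis.mk h4 h5)]
  refine ⟨κ, hκ, fun i t => (lam i t).re, fun i t => V t (w i t), fun i => (h1 i).re_ofReal,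
    fun i => ?_, fun i => ?_, ?_, ?_, ?_, ?_⟩
  · have h7 := h6.self_of_nhds i
    rw [hM0] at h7
    have h8 : ((μ₀ : ℂ) - lam i t₀) • w i t₀ = 0 := by
      rw [sub_smul, ← h7]; simp
    have h9 := (smul_eq_zero.1 h8).resolve_right (hw0 i)
    have := congrArg Complex.re (sub_eq_zero.1 h9)
    simpa using this.symm
  · exact (ContinuousAt.comp (g := V) hV.continuousAt
      Complex.continuous_ofReal.continuousAt).clm_apply (ContinuousAt.comp (g := w i)
      (h2 i).continuousAt Complex.continuous_ofReal.continuousAt)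
  · have : Function.Injective ι := Function.LeftInverse.injective hPι
    simp only [hV0]
    exact h4.map' (ι : Z →ₗ[ℂ] E) (LinearMap.ker_eq_bot.2 this)
  · have h7 : (range fun i => V t₀ (w i t₀)) = ι '' (range fun i => w i t₀) := by
      rw [← range_comp, hV0]; rfl
    rw [h7]
    have h8 := Submodule.map_span (ι : Z →ₗ[ℂ] E) (range fun i => w i t₀)
    rw [top_le_iff.1 h5] at h8
    refine h8.symm.trans (le_antisymm ?_ fun u hu => ?_)
    · rintro _ ⟨x, -, rfl⟩
      exact mem_eigenspace.2 (hker x)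
    · exact ⟨P u, trivial, hιP u hu⟩
  · filter_upwards [htend.eventually hVM, htend.eventually h6, h3] with t h7 h8 h9 i
    have : ((lam i t).re : ℂ) = lam i t := Complex.ext (by simp) (by simp [h9])
    rw [h7, h8, this, map_smul, map_smul]
  · have htend2 : Tendsto (fun p : ℝ × ℝ => ((p.1 : ℂ), (p.2 : ℂ))) (𝓝 (t₀, μ₀))
        (𝓝 ((t₀ : ℂ), (μ₀ : ℂ))) := by
      have : Continuous fun p : ℝ × ℝ => ((p.1 : ℂ), (p.2 : ℂ)) := by fun_prop
      exact this.continuousAt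
    have hfst : Tendsto (Prod.fst : ℝ × ℝ → ℝ) (𝓝 (t₀, μ₀)) (𝓝 t₀) := continuousAt_fst
    filter_upwards [htend2.eventually hnear, hfst.eventually (htend.eventually hVM),
      hfst.eventually (htend.eventually h6), hfst.eventually h3, hfst.eventually hindep]
      with ⟨t, μ⟩ h7 h8 h9 h10 h11
    simp only at h7 h8 h9 h10 h11 ⊢
    let b : Basis κ ℂ Z := basisOfLinearIndependentOfCardEqFinrank' _ h11 hcard
    have hb : ∀ i, b i = w i t := fun i => by simp [b]
    have h12 := finrank_eigenspace_of_basis b (M t : Z →ₗ[ℂ] Z) (fun i => lam i t)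
      (fun i => by rw [hb]; exact h9 i) μ
    have h13 : Nat.card {i // (lam i t).re = μ} = Nat.card {i // lam i t = μ} := by
      congr 1
      refine congrArg Subtype (funext fun i => propext ?_)
      constructor
      · intro hi; exact Complex.ext (by simp [hi]) (by simp [h10])
      · intro hi; simp [hi]
    rw [h13, ← h12]
    have hVi : Function.Injective (V t) := Function.LeftInverse.injective (hPV t)
    -- The uniqueness part of the splitting gives one inclusion and the invariance of the range of V
    -- the other, so multiplicities of the pencil are those of M t.
    have h14 : eigenspace A C t μ =
        (End.eigenspace (M t : Z →ₗ[ℂ] Z) μ).map (V t : Z →ₗ[ℂ] E) := by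
      ext u
      constructor
      · intro hu
        obtain ⟨h15, h16⟩ := h7 u (mem_eigenspace.1 hu)
        exact ⟨P u, End.mem_eigenspace_iff.2 h16, h15.symm⟩
      · rintro ⟨x, hx, rfl⟩
        have hx' : M t x = (μ : ℂ) • x := End.mem_eigenspace_iff.1 hx
        refine mem_eigenspace.2 ?_
        simp only [ContinuousLinearMap.coe_coe]
        rw [h8, hx', map_smul, map_smul]
    rw [h14]
    exact (LinearEquiv.finrank_eq (Submodule.equivMapOfInjective (V t : Z →ₗ[ℂ] E) hVi _)).symm

end IsSymmetricPencil

end Pencil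

end OperatorFamily

/-! ### First-order perturbation and Jordan chains -/

namespace OperatorFamily

open Filter Topology Module
open scoped ContDiff InnerProductSpace

namespace IsSymmetricPencil

variable {E H : Type*} [NormedAddCommGroup E] [NormedSpace ℂ E]
  [NormedAddCommGroup H] [InnerProductSpace ℂ H]
variable {A : ℂ → E →L[ℂ] H} {C J S : E →L[ℂ] H}

lemma hasDerivAt_apply (h : IsSymmetricPencil A C J S) (t : ℝ) (u : E) :
    HasDerivAt (fun s : ℝ => A s u) (deriv A t u) t := by
  have h1 : HasDerivAt A (deriv A t) (t : ℂ) := (h.analyticAt t).differentiableAt.hasDerivAt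
  have h2 := h1.clm_apply (hasDerivAt_const (t : ℂ) u)
  simp only [map_zero, add_zero] at h2
  have h3 := HasDerivAt.scomp t h2 Complex.ofRealCLM.hasDerivAt
  rw [Complex.ofRealCLM_apply, Complex.ofReal_one, one_smul] at h3
  exact h3

lemma deriv_symm (h : IsSymmetricPencil A C J S) (t : ℝ) (u v : E) :
    ⟪deriv A t u, J v⟫_ℂ = ⟪J u, deriv A t v⟫_ℂ := by
  have h1 := (h.hasDerivAt_apply t u).inner ℂ (hasDerivAt_const t (J v))
  have h2 := (hasDerivAt_const t (J u)).inner ℂ (h.hasDerivAt_apply t v)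
  simp only [h.symm] at h1
  simpa using h1.unique h2

/-- The first-order relation for an analytic eigenvalue of the pencil. -/
lemma inner_deriv (h : IsSymmetricPencil A C J S) {t₀ : ℝ} {lam : ℝ → ℝ} {w : ℝ → E}
    (hlam : DifferentiableAt ℝ lam t₀) (hw : ContinuousAt w t₀)
    (heq : ∀ᶠ t : ℝ in 𝓝 t₀, A t (w t) = (lam t : ℂ) • C (w t)) {v : E}
    (hv : v ∈ eigenspace A C t₀ (lam t₀)) :
    ⟪J (w t₀), deriv A t₀ v⟫_ℂ = ((deriv lam t₀ : ℝ) : ℂ) * ⟪J (w t₀), C v⟫_ℂ := by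
  -- Here v is fixed and only the pairing vector w t moves. By symmetry w t is orthogonal to f t,
  -- and f vanishes at t₀, so the limit of the slopes of f gives the relation. Only continuity of w
  -- is needed.
  set f : ℝ → H := fun t => A t v - (lam t : ℂ) • C v with hf
  have hf0 : f t₀ = 0 := by rw [hf, sub_eq_zero]; exact mem_eigenspace.1 hv
  have hd : HasDerivAt f (deriv A t₀ v - ((deriv lam t₀ : ℝ) : ℂ) • C v) t₀ :=
    (h.hasDerivAt_apply t₀ v).sub (hlam.hasDerivAt.ofReal_comp.smul_const (C v))
  have h1 : Tendsto (fun t => ⟪J (w t), (t - t₀)⁻¹ • f t⟫_ℂ) (𝓝[≠] t₀)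
      (𝓝 ⟪J (w t₀), deriv A t₀ v - ((deriv lam t₀ : ℝ) : ℂ) • C v⟫_ℂ) := by
    refine Tendsto.inner ?_ ?_
    · exact ((J.continuous.continuousAt.comp hw).tendsto).mono_left nhdsWithin_le_nhds
    · have := hasDerivAt_iff_tendsto_slope.1 hd
      refine this.congr fun t => ?_
      rw [slope_def_module, hf0, sub_zero]
  have h2 : Tendsto (fun t => ⟪J (w t), (t - t₀)⁻¹ • f t⟫_ℂ) (𝓝[≠] t₀) (𝓝 0) := by
    refine tendsto_const_nhds.congr' ?_
    filter_upwards [heq.filter_mono nhdsWithin_le_nhds] with t ht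
    have h3 := h.symm_sub t (lam t) (w t) v
    simp only [sub_apply, smul_apply, ht, sub_self, inner_zero_left] at h3
    rw [← Complex.coe_smul, inner_smul_right, ← h3, mul_zero]
  have h3 := tendsto_nhds_unique h1 h2
  rwa [inner_sub_right, inner_smul_right, sub_eq_zero] at h3

variable [CompleteSpace E] [CompleteSpace H]

/-- The Fredholm alternative. The bordered equation is always solvable, and pairing it with the
eigenvector ι P y shows that the border term vanishes when g is orthogonal to the eigenspace. -/
lemma exists_eq_of_orthogonal (h : IsSymmetricPencil A C J S) (t μ : ℝ) (g : H)
    (hg : ∀ v ∈ eigenspace A C t μ, ⟪g, J v⟫_ℂ = 0) : ∃ u, A t u - (μ : ℂ) • C u = g := by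
  obtain ⟨Z, hZ, ι, P, Ψ, hPι, hSι, hker, hΨ, hιP⟩ := h.exists_bordered t μ
  have h1 : A t (Ψ.symm g) - (μ : ℂ) • C (Ψ.symm g) - C (ι (P (Ψ.symm g))) = g := by
    rw [← hΨ, Ψ.apply_symm_apply]
  set y := Ψ.symm g
  have hmem : ι (P y) ∈ eigenspace A C t μ := mem_eigenspace.2 (hker _)
  have h2 : ⟪C (ι (P y)), J (ι (P y))⟫_ℂ = 0 := by
    have h3 := h.symm_sub t μ y (ι (P y))
    rw [show (A t - (μ : ℂ) • C) (ι (P y)) = 0 from hmem, inner_zero_right] at h3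
    have h4 := hg _ hmem
    rw [← h1, inner_sub_left] at h4
    simp only [sub_apply, smul_apply] at h3
    rwa [h3, zero_sub, neg_eq_zero] at h4
  rw [h.form, inner_self_eq_zero] at h2
  have h3 : ι (P y) = 0 := h.injective (by rw [h2, map_zero])
  exact ⟨y, by rw [← h1, h3, map_zero, sub_zero]⟩

/-- A critical point of an analytic eigenvalue amounts to a Jordan chain of length two. -/
theorem exists_deriv_eq_zero_iff (h : IsSymmetricPencil A C J S) {t₀ μ₀ : ℝ} {κ : Type*}
    [Fintype κ] {lam : κ → ℝ → ℝ} {w : κ → ℝ → E}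
    (hlam : ∀ i, DifferentiableAt ℝ (lam i) t₀) (hlam0 : ∀ i, lam i t₀ = μ₀)
    (hw : ∀ i, ContinuousAt (w i) t₀) (hind : LinearIndependent ℂ fun i => w i t₀)
    (hspan : Submodule.span ℂ (range fun i => w i t₀) = eigenspace A C t₀ μ₀)
    (heq : ∀ᶠ t : ℝ in 𝓝 t₀, ∀ i, A t (w i t) = (lam i t : ℂ) • C (w i t)) :
    (∃ i, deriv (lam i) t₀ = 0) ↔ ∃ u₀ u₁ : E, u₀ ≠ 0 ∧ A t₀ u₀ = (μ₀ : ℂ) • C u₀ ∧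
      A t₀ u₁ - (μ₀ : ℂ) • C u₁ + deriv A t₀ u₀ = 0 := by
  have hfirst : ∀ i, ∀ v ∈ eigenspace A C t₀ μ₀,
      ⟪J (w i t₀), deriv A t₀ v⟫_ℂ = ((deriv (lam i) t₀ : ℝ) : ℂ) * ⟪J (w i t₀), C v⟫_ℂ :=
    fun i v hv => h.inner_deriv (hlam i) (hw i) (heq.mono fun t ht => ht i) (by rwa [hlam0])
  have hwmem : ∀ i, w i t₀ ∈ eigenspace A C t₀ μ₀ := fun i => by
    rw [← hspan]; exact Submodule.subset_span ⟨i, rfl⟩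
  constructor
  · rintro ⟨i, hi⟩
    obtain ⟨u₁, hu₁⟩ := h.exists_eq_of_orthogonal t₀ μ₀ (-deriv A t₀ (w i t₀)) fun v hv => by
      rw [inner_neg_left, h.deriv_symm, hfirst i v hv, hi]; simp
    exact ⟨w i t₀, u₁, hind.ne_zero i, mem_eigenspace.1 (hwmem i), by rw [hu₁, neg_add_cancel]⟩
  · rintro ⟨u₀, u₁, hu0, hu, hu1⟩
    by_contra! hne
    have hmem : u₀ ∈ eigenspace A C t₀ μ₀ := mem_eigenspace.2 hu
    rw [← hspan, Submodule.mem_span_range_iff_exists_fun] at hmem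
    obtain ⟨c, hc⟩ := hmem
    have horth : ∀ v ∈ eigenspace A C t₀ μ₀, ⟪J u₀, deriv A t₀ v⟫_ℂ = 0 := by
      intro v hv
      rw [← h.deriv_symm, eq_neg_of_add_eq_zero_right hu1, inner_neg_left]
      have h1 := h.symm_sub t₀ μ₀ u₁ v
      rw [show (A t₀ - (μ₀ : ℂ) • C) v = 0 from hv, inner_zero_right] at h1
      simp only [sub_apply, smul_apply] at h1
      rw [h1, neg_zero]
    -- A chain forces A'u₀ to be orthogonal to the eigenspace. With u₀ = ∑ c_i w_i, this test vector
    -- turns the first-order relation into ⟨Jv, Cv⟩ = ⟨Ju₀, A'v⟩ = 0, whence every λ_i' c_i is zero.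
    set v := ∑ i, (((deriv (lam i) t₀ : ℝ) : ℂ) * c i) • w i t₀ with hv
    have hvmem : v ∈ eigenspace A C t₀ μ₀ :=
      Submodule.sum_mem _ fun i _ => Submodule.smul_mem _ _ (hwmem i)
    have h1 : ⟪J v, C v⟫_ℂ = ⟪J u₀, deriv A t₀ v⟫_ℂ := by
      rw [← hc]
      nth_rewrite 1 [hv]
      simp only [map_sum, map_smul, sum_inner, inner_smul_left, hfirst _ v hvmem, map_mul,
        Complex.conj_ofReal]
      exact Finset.sum_congr rfl fun i _ => by ring
    rw [horth v hvmem, h.form', inner_self_eq_zero] at h1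
    have hv0 : v = 0 := h.injective (by rw [h1, map_zero])
    have h2 := Fintype.linearIndependent_iff.1 hind _ (hv.symm.trans hv0)
    refine hu0 ?_
    rw [← hc]
    refine Finset.sum_eq_zero fun i _ => ?_
    have h3 := (mul_eq_zero.1 (h2 i)).resolve_left (by exact_mod_cast hne i)
    rw [h3, zero_smul]

end IsSymmetricPencil

end OperatorFamily

/-! ### Analytic continuation of eigenvalue branches along the real line -/

namespace OperatorFamily

open Filter Topology

/-- `mult t μ` counts, locally, the analytic functions of `t` that take the value `μ`, and the
derivatives of these functions are bounded affinely by their values. -/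
structure HasAnalyticBranches (mult : ℝ → ℝ → ℕ) : Prop where
  exists_local : ∀ t₀ μ₀ : ℝ, ∃ (κ : Type) (_ : Fintype κ) (lam : κ → ℝ → ℝ),
    (∀ i, AnalyticAt ℝ (lam i) t₀) ∧ (∀ i, lam i t₀ = μ₀) ∧
    ∀ᶠ p : ℝ × ℝ in 𝓝 (t₀, μ₀), mult p.1 p.2 = Nat.card {i // lam i p.1 = p.2}
  exists_bound : ∃ K : ℝ, 0 ≤ K ∧ ∀ (t : ℝ) (f : ℝ → ℝ), AnalyticAt ℝ f t →
    (∀ᶠ s in 𝓝 t, mult s (f s) ≠ 0) → ‖deriv f t‖ ≤ K * ‖f t‖ + K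

namespace HasAnalyticBranches

variable {mult : ℝ → ℝ → ℕ}

/-- Reflection reduces continuation across left end points to continuation across right end points.
-/
lemma neg (h : HasAnalyticBranches mult) : HasAnalyticBranches fun t μ => mult (-t) μ := by
  have hneg : ∀ t₀ : ℝ, Tendsto (fun t : ℝ => -t) (𝓝 t₀) (𝓝 (-t₀)) := fun t₀ =>
    continuous_neg.continuousAt
  have han : ∀ t : ℝ, AnalyticAt ℝ (fun s : ℝ => -s) t := fun t => analyticAt_id.neg
  refine ⟨fun t₀ μ₀ => ?_, ?_⟩
  · obtain ⟨κ, hκ, lam, h1, h2, h3⟩ := h.exists_local (-t₀) μ₀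
    refine ⟨κ, hκ, fun i t => lam i (-t), fun i => (h1 i).comp (han t₀), h2, ?_⟩
    have h4 : Tendsto (fun p : ℝ × ℝ => (-p.1, p.2)) (𝓝 (t₀, μ₀)) (𝓝 (-t₀, μ₀)) := by
      have : Continuous fun p : ℝ × ℝ => (-p.1, p.2) := by fun_prop
      exact this.continuousAt
    exact h4.eventually h3
  · obtain ⟨K, hK, hb⟩ := h.exists_bound
    refine ⟨K, hK, fun t f hf hm => ?_⟩
    have hf' : AnalyticAt ℝ (fun s => f (-s)) (-t) :=
      AnalyticAt.comp (g := f) (by rwa [neg_neg]) (han (-t))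
    have h1 := hb (-t) (fun s => f (-s)) hf' (by
      have := (hneg (-t)).eventually (by rwa [neg_neg] :
        ∀ᶠ s in 𝓝 (- -t), mult (-s) (f s) ≠ 0)
      simpa using this)
    have h2 : deriv (fun s => f (-s)) (-t) = -deriv f t := by
      rw [deriv_comp_neg, neg_neg]
    rw [h2, norm_neg, neg_neg] at h1
    exact h1

/-- A continuous curve of eigenvalues follows one of the local branches, if it is analytic. -/
lemma exists_eventuallyEq {κ : Type} [Fintype κ] {lam : κ → ℝ → ℝ} {s : ℝ} {f : ℝ → ℝ}
    (hlam : ∀ i, AnalyticAt ℝ (lam i) s) (hf : AnalyticAt ℝ f s)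
    (hcount : ∀ᶠ p : ℝ × ℝ in 𝓝 (s, f s), mult p.1 p.2 = Nat.card {i // lam i p.1 = p.2})
    (hm : ∃ᶠ t in 𝓝[≠] s, mult t (f t) ≠ 0) : ∃ i, lam i =ᶠ[𝓝 s] f := by
  have hc : Tendsto (fun t => (t, f t)) (𝓝[≠] s) (𝓝 (s, f s)) :=
    ((continuousAt_id.prodMk hf.continuousAt).tendsto).mono_left nhdsWithin_le_nhds
  have h1 : ∃ᶠ t in 𝓝[≠] s, ∃ i, lam i t = f t := by
    refine (hm.and_eventually (hc.eventually hcount)).mono fun t ht => ?_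
    obtain ⟨h2, h3⟩ := ht
    rw [h3] at h2
    obtain ⟨⟨i, hi⟩⟩ := (Nat.card_ne_zero.1 h2).1
    exact ⟨i, hi⟩
  -- As there are finitely many branches, one of them meets f at points accumulating at s, and the
  -- identity theorem finishes.
  obtain ⟨i, hi⟩ := Filter.frequently_exists.1 h1 |> fun h => h
  exact ⟨i, ((hlam i).frequently_eq_iff_eventually_eq hf).1 hi⟩

/-- Grönwall's inequality: a derivative bounded affinely by the value cannot lead to blow-up at a
finite end point. -/
lemma bounded_of_analytic (h : HasAnalyticBranches mult) {a b : ℝ} (hab : a < b) {f : ℝ → ℝ}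
    (hf : AnalyticOnNhd ℝ f (Ioo a b)) (hm : ∀ t ∈ Ioo a b, mult t (f t) ≠ 0) :
    ∃ R : ℝ, ∀ᶠ t in 𝓝[<] b, ‖f t‖ ≤ R := by
  obtain ⟨K, hK, hb⟩ := h.exists_bound
  obtain ⟨m, hm1, hm2⟩ := exists_between hab
  refine ⟨gronwallBound ‖f m‖ K K (b - m), ?_⟩
  filter_upwards [Ioo_mem_nhdsLT hm2] with t ht
  have hsub : ∀ x ∈ Icc m t, x ∈ Ioo a b := fun x hx =>
    ⟨hm1.trans_le hx.1, hx.2.trans_lt ht.2⟩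
  refine (norm_le_gronwallBound_of_norm_deriv_right_le (f := f) (f' := deriv f) (δ := ‖f m‖)
    (K := K) (ε := K) (a := m) (b := t)
    (fun x hx => (hf x (hsub x hx)).continuousAt.continuousWithinAt)
    (fun x hx => ((hf x (hsub x (Ico_subset_Icc_self hx))).differentiableAt.hasDerivAt
      ).hasDerivWithinAt) le_rfl (fun x hx => ?_) t ⟨ht.1.le, le_rfl⟩).trans ?_
  · have hx' := hsub x (Ico_subset_Icc_self hx)
    exact hb x f (hf x hx') ((isOpen_Ioo.eventually_mem hx').mono hm)
  · exact gronwallBound_mono (norm_nonneg _) hK hK (by linarith [ht.2])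

/-- An analytic branch on an interval extends across the right end point. -/
lemma exists_extension_right (h : HasAnalyticBranches mult) {a b : ℝ} (hab : a < b) {f : ℝ → ℝ}
    (hf : AnalyticOnNhd ℝ f (Ioo a b)) (hm : ∀ t ∈ Ioo a b, mult t (f t) ≠ 0) :
    ∃ δ > 0, ∃ g : ℝ → ℝ, AnalyticOnNhd ℝ g (Ioo a (b + δ)) ∧
      (∀ t ∈ Ioo a (b + δ), mult t (g t) ≠ 0) ∧ EqOn g f (Ioo a b) := by
  obtain ⟨R, hR⟩ := h.bounded_of_analytic hab hf hm
  -- A limit of f at b is not known to exist, but a cluster value suffices: f comes near it at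
  -- parameters arbitrarily close to b, where it must coincide with one of the local branches at (b,
  -- μ).
  obtain ⟨μ, -, hμ⟩ := (isCompact_closedBall (0 : ℝ) R).exists_mapClusterPt (u := f)
    (f := 𝓝[<] b) (Filter.le_principal_iff.2 (by
      rw [Filter.mem_map]
      filter_upwards [hR] with t ht
      simpa using ht))
  obtain ⟨κ, hκ, lam, h1, h2, h3⟩ := h.exists_local b μ
  have h4 : ∀ᶠ t in 𝓝 b, ∀ i, AnalyticAt ℝ (lam i) t :=
    eventually_all.2 fun i => (h1 i).eventually_analyticAt
  -- The count is needed in a neighborhood of (s, f s) and not only at that point, hence the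
  -- iterated form.
  rw [← eventually_eventually_nhds, nhds_prod_eq] at h3
  obtain ⟨p, hp, q, hq, hpq⟩ := Filter.eventually_prod_iff.1 h3
  obtain ⟨δ, hδ, hδ'⟩ := Metric.eventually_nhds_iff_ball.1 (hp.and (h4.and
    (eventually_all.2 fun i => ((h1 i).continuousAt.tendsto).eventually (by rwa [h2 i]) :
      ∀ᶠ t in 𝓝 b, ∀ i, q (lam i t))))
  have hball : ∀ t, b - δ < t → t < b + δ → t ∈ Metric.ball b δ := fun t h5 h6 => by
    rw [Real.ball_eq_Ioo]; exact ⟨h5, h6⟩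
  have hcb : max a (b - δ) < b := max_lt hab (by linarith)
  obtain ⟨s, hsq, hs⟩ : ∃ s, q (f s) ∧ s ∈ Ioo (max a (b - δ)) b := by
    have h5 : ∃ᶠ t in 𝓝[<] b, q (f t) := hμ.frequently hq
    exact (h5.and_eventually (Ioo_mem_nhdsLT hcb)).exists
  have hsa : s ∈ Ioo a b := ⟨(le_max_left _ _).trans_lt hs.1, hs.2⟩
  have hsδ : s ∈ Metric.ball b δ := hball s ((le_max_right _ _).trans_lt hs.1) (by linarith [hs.2])
  obtain ⟨i, hi⟩ := exists_eventuallyEq (hδ' s hsδ).2.1 (hf s hsa) (hpq (hδ' s hsδ).1 hsq)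
    (((isOpen_Ioo.eventually_mem hsa).mono hm).filter_mono nhdsWithin_le_nhds).frequently
  have heq : EqOn (lam i) f (Ioo (max a (b - δ)) b) :=
    AnalyticOnNhd.eqOn_of_preconnected_of_eventuallyEq
      (fun t ht => (hδ' t (hball t ((le_max_right _ _).trans_lt ht.1)
        (by linarith [ht.2]))).2.1 i)
      (fun t ht => hf t ⟨(le_max_left _ _).trans_lt ht.1, ht.2⟩) isPreconnected_Ioo hs hi
  classical
  refine ⟨δ, hδ, fun t => if t < b then f t else lam i t, fun t ht => ?_, fun t ht => ?_,
    fun t ht => if_pos ht.2⟩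
  · rcases lt_or_ge t b with htb | htb
    · refine (hf t ⟨ht.1, htb⟩).congr ?_
      filter_upwards [Iio_mem_nhds htb] with x hx
      exact (if_pos hx).symm
    · refine ((hδ' t (hball t (by linarith) ht.2)).2.1 i).congr ?_
      filter_upwards [Ioi_mem_nhds (hcb.trans_le htb)] with x hx
      split_ifs with hxb
      · exact heq ⟨hx, hxb⟩
      · rfl
  · simp only
    split_ifs with htb
    · exact hm t ⟨ht.1, htb⟩
    · have h5 := hδ' t (hball t (by linarith) ht.2)
      have h6 := (hpq h5.1 (h5.2.2 i)).self_of_nhds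
      simp only at h6
      rw [h6]
      exact Nat.card_ne_zero.2 ⟨⟨⟨i, rfl⟩⟩, inferInstance⟩

lemma exists_extension_left (h : HasAnalyticBranches mult) {a b : ℝ} (hab : a < b) {f : ℝ → ℝ}
    (hf : AnalyticOnNhd ℝ f (Ioo a b)) (hm : ∀ t ∈ Ioo a b, mult t (f t) ≠ 0) :
    ∃ δ > 0, ∃ g : ℝ → ℝ, AnalyticOnNhd ℝ g (Ioo (a - δ) b) ∧
      (∀ t ∈ Ioo (a - δ) b, mult t (g t) ≠ 0) ∧ EqOn g f (Ioo a b) := by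
  have hmem : ∀ {c d t : ℝ}, t ∈ Ioo c d → -t ∈ Ioo (-d) (-c) := fun ht =>
    ⟨neg_lt_neg ht.2, neg_lt_neg ht.1⟩
  have han : ∀ t : ℝ, AnalyticAt ℝ (fun s : ℝ => -s) t := fun t => analyticAt_id.neg
  obtain ⟨δ, hδ, g, h1, h2, h3⟩ := h.neg.exists_extension_right (a := -b) (b := -a)
    (neg_lt_neg hab) (f := fun t => f (-t))
    (fun t ht => AnalyticAt.comp (g := f) (hf (-t) (by simpa using hmem ht)) (han t))
    (fun t ht => hm (-t) (by simpa using hmem ht))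
  have hmem' : ∀ {t}, t ∈ Ioo (a - δ) b → -t ∈ Ioo (-b) (-a + δ) := fun ht =>
    ⟨by linarith [ht.2], by linarith [ht.1]⟩
  refine ⟨δ, hδ, fun t => g (-t), fun t ht => AnalyticAt.comp (g := g) (h1 _ (hmem' ht)) (han t),
    fun t ht => by simpa using h2 _ (hmem' ht), fun t ht => ?_⟩
  have := h3 (hmem ht)
  simpa using this

/-- Every local analytic branch extends to the whole real line. -/
theorem exists_global_extension (h : HasAnalyticBranches mult) {t₀ : ℝ} {f : ℝ → ℝ}
    (hf : AnalyticAt ℝ f t₀) (hm : ∀ᶠ t in 𝓝 t₀, mult t (f t) ≠ 0) :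
    ∃ F : ℝ → ℝ, AnalyticOnNhd ℝ F univ ∧ (∀ t, mult t (F t) ≠ 0) ∧ F =ᶠ[𝓝 t₀] f := by
  let I : ℝ → Set ℝ := fun R => Ioo (t₀ - R) (t₀ + R)
  let Good : ℝ → (ℝ → ℝ) → Prop := fun R g =>
    AnalyticOnNhd ℝ g (I R) ∧ (∀ t ∈ I R, mult t (g t) ≠ 0) ∧ g =ᶠ[𝓝 t₀] f
  have hImem : ∀ {R s : ℝ}, s ∈ I R ↔ |s - t₀| < R := fun {R s} => by
    rw [abs_sub_lt_iff, mem_Ioo]; constructor <;> intro h <;> constructor <;> linarith [h.1, h.2]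
  have hImono : ∀ {R R' : ℝ}, R ≤ R' → I R ⊆ I R' := fun hR s hs =>
    hImem.2 ((hImem.1 hs).trans_le hR)
  have huniq : ∀ {R R' g g'}, 0 < R → R ≤ R' → Good R g → Good R' g' → EqOn g g' (I R) := by
    intro R R' g g' hR hRR hg hg'
    exact hg.1.eqOn_of_preconnected_of_eventuallyEq (hg'.1.mono (hImono hRR))
      isPreconnected_Ioo (hImem.2 (by simpa using hR)) (hg.2.2.trans hg'.2.2.symm)
  have hglue : ∀ T : Set ℝ, T.Nonempty → (∀ R ∈ T, 0 < R ∧ ∃ g, Good R g) →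
      ∃ g, ∀ R ∈ T, Good R g := by
    intro T hT hgood
    choose! hpos G hG using hgood
    classical
    let g : ℝ → ℝ := fun s => if hs : ∃ R ∈ T, s ∈ I R then G hs.choose s else 0
    have hgeq : ∀ R ∈ T, EqOn g (G R) (I R) := by
      intro R hR s hs
      have hex : ∃ R ∈ T, s ∈ I R := ⟨R, hR, hs⟩
      have h1 := hex.choose_spec
      simp only [g, dif_pos hex]
      rcases le_total hex.choose R with h2 | h2
      · exact huniq (hpos _ h1.1) h2 (hG _ h1.1) (hG _ hR) h1.2
      · exact (huniq (hpos _ hR) h2 (hG _ hR) (hG _ h1.1) hs).symm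
    refine ⟨g, fun R hR => ⟨fun s hs => ((hG R hR).1 s hs).congr ?_, fun s hs => ?_, ?_⟩⟩
    · exact ((hgeq R hR).eventuallyEq_of_mem (isOpen_Ioo.mem_nhds hs)).symm
    · rw [hgeq R hR hs]; exact (hG R hR).2.1 s hs
    · exact ((hgeq R hR).eventuallyEq_of_mem (isOpen_Ioo.mem_nhds
        (hImem.2 (by simpa using hpos R hR)))).trans (hG R hR).2.2
  have hsmall : ∃ R > 0, Good R f := by
    obtain ⟨R, hR, hR'⟩ := Metric.eventually_nhds_iff_ball.1 (hf.eventually_analyticAt.and hm)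
    rw [Real.ball_eq_Ioo] at hR'
    exact ⟨R, hR, fun s hs => (hR' s hs).1, fun s hs => (hR' s hs).2, EventuallyEq.rfl⟩
  obtain ⟨R₀, hR₀, hgood₀⟩ := hsmall
  have hall : ∀ R, 0 < R → ∃ g, Good R g := by
    by_contra! hcon
    obtain ⟨Q, hQ, hQ'⟩ := hcon
    -- If some radius were bad, the good radii would be bounded. Gluing gives a branch on the open
    -- interval of radius sup T, and continuation across both ends contradicts the supremum.
    let T : Set ℝ := {R | 0 < R ∧ ∃ g, Good R g}
    have hTne : T.Nonempty := ⟨R₀, hR₀, f, hgood₀⟩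
    have hTbdd : BddAbove T := by
      refine ⟨Q, fun R hR => ?_⟩
      by_contra! hlt
      obtain ⟨-, g, hg⟩ := hR
      exact hQ' g ⟨hg.1.mono (hImono hlt.le), fun s hs => hg.2.1 s (hImono hlt.le hs), hg.2.2⟩
    obtain ⟨g, hg⟩ := hglue T hTne fun R hR => hR
    have hRs : 0 < sSup T := hR₀.trans_le (le_csSup hTbdd ⟨hR₀, f, hgood₀⟩)
    have hcover : ∀ s ∈ I (sSup T), ∃ R ∈ T, s ∈ I R := by
      intro s hs
      obtain ⟨R, hR, hlt⟩ := exists_lt_of_lt_csSup hTne (hImem.1 hs)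
      exact ⟨R, hR, hImem.2 hlt⟩
    obtain ⟨δ, hδ, g₁, h1, h2, h3⟩ := h.exists_extension_right (a := t₀ - sSup T)
      (b := t₀ + sSup T) (by linarith) (f := g)
      (fun s hs => by obtain ⟨R, hR, hs'⟩ := hcover s hs; exact (hg R hR).1 s hs')
      (fun s hs => by obtain ⟨R, hR, hs'⟩ := hcover s hs; exact (hg R hR).2.1 s hs')
    obtain ⟨δ', hδ', g₂, h4, h5, h6⟩ := h.exists_extension_left (by linarith) h1 h2
    have hη : 0 < min δ δ' := lt_min hδ hδ'
    have hsub : I (sSup T + min δ δ') ⊆ Ioo (t₀ - sSup T - δ') (t₀ + sSup T + δ) := fun s hs =>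
      ⟨by linarith [hs.1, min_le_right δ δ'], by linarith [hs.2, min_le_left δ δ']⟩
    have hmem : sSup T + min δ δ' ∈ T := by
      refine ⟨by linarith, g₂, h4.mono hsub, fun s hs => h5 s (hsub hs), ?_⟩
      have h7 : t₀ ∈ I (sSup T) := hImem.2 (by simpa using hRs)
      have h8 : EqOn g₂ g (I (sSup T)) := fun s hs =>
        (h6 ⟨hs.1, by linarith [hs.2]⟩).trans (h3 hs)
      exact (h8.eventuallyEq_of_mem (isOpen_Ioo.mem_nhds h7)).trans (hg R₀ ⟨hR₀, f, hgood₀⟩).2.2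
    linarith [le_csSup hTbdd hmem]
  obtain ⟨F, hF⟩ := hglue (Ioi 0) ⟨1, mem_Ioi.2 one_pos⟩ fun R hR => ⟨hR, hall R hR⟩
  have hin : ∀ s, |s - t₀| + 1 ∈ Ioi (0 : ℝ) ∧ s ∈ I (|s - t₀| + 1) := fun s =>
    ⟨mem_Ioi.2 (add_pos_of_nonneg_of_pos (abs_nonneg _) one_pos), hImem.2 (lt_add_one _)⟩
  exact ⟨F, fun s _ => (hF _ (hin s).1).1 s (hin s).2, fun s => (hF _ (hin s).1).2.1 s (hin s).2,
    (hF 1 (mem_Ioi.2 one_pos)).2.2⟩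

end HasAnalyticBranches

end OperatorFamily

/-! ### Counting and enumerating the global branches -/

namespace OperatorFamily

open Filter Topology

namespace HasAnalyticBranches

variable {mult : ℝ → ℝ → ℕ}

/-- The local branches that coincide with a given analytic branch are counted by the multiplicity
at nearby parameters. -/
lemma eventually_mult_eq {κ : Type} [Fintype κ] {lam : κ → ℝ → ℝ} {t₀ : ℝ} {f : ℝ → ℝ}
    (hlam : ∀ i, AnalyticAt ℝ (lam i) t₀) (hf : AnalyticAt ℝ f t₀)
    (hcount : ∀ᶠ p : ℝ × ℝ in 𝓝 (t₀, f t₀), mult p.1 p.2 = Nat.card {i // lam i p.1 = p.2}) :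
    ∀ᶠ s in 𝓝[≠] t₀, mult s (f s) = Nat.card {i // lam i =ᶠ[𝓝 t₀] f} := by
  have h1 : ∀ᶠ s in 𝓝[≠] t₀, ∀ i, lam i s = f s ↔ lam i =ᶠ[𝓝 t₀] f := by
    refine eventually_all.2 fun i => ?_
    rcases (hlam i).eventually_eq_or_eventually_ne hf with h2 | h2
    · filter_upwards [h2.filter_mono nhdsWithin_le_nhds] with s hs
      exact ⟨fun _ => h2, fun _ => hs⟩
    · filter_upwards [h2] with s hs
      refine ⟨fun h3 => absurd h3 hs, fun h3 => ?_⟩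
      have h4 : ∀ᶠ z in 𝓝[≠] t₀, lam i z = f z := h3.filter_mono nhdsWithin_le_nhds
      obtain ⟨z, hz, hz'⟩ := (h4.and h2).exists
      exact absurd hz hz'
  have hc : Tendsto (fun t => (t, f t)) (𝓝[≠] t₀) (𝓝 (t₀, f t₀)) :=
    ((continuousAt_id.prodMk hf.continuousAt).tendsto).mono_left nhdsWithin_le_nhds
  filter_upwards [h1, hc.eventually hcount] with s h2 h3
  rw [h3]
  exact congrArg (fun p : κ → Prop => Nat.card (Subtype p)) (funext fun i => propext (h2 i))

/-- The global analytic branches. -/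
abbrev Branch (mult : ℝ → ℝ → ℕ) : Type :=
  {f : ℝ → ℝ // AnalyticOnNhd ℝ f univ ∧ ∀ t, mult t (f t) ≠ 0}

lemma Branch.ext_of_eventuallyEq {f g : Branch mult} {t : ℝ} (h : f.1 =ᶠ[𝓝 t] g.1) : f = g :=
  Subtype.ext (f.2.1.eq_of_eventuallyEq g.2.1 h)

/-- Near each t the multiplicity along f is constant off t. This punctured value depends on t in a
locally constant way, so connectedness of ℝ makes it global. -/
lemma exists_generic_mult (h : HasAnalyticBranches mult) (f : Branch mult) :
    ∃ m : ℕ, ∀ t, ∀ᶠ s in 𝓝[≠] t, mult s (f.1 s) = m := by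
  have hloc : ∀ t, ∃ m, ∀ᶠ s in 𝓝[≠] t, mult s (f.1 s) = m := fun t => by
    obtain ⟨κ, hκ, lam, h1, h2, h3⟩ := h.exists_local t (f.1 t)
    exact ⟨_, eventually_mult_eq h1 (f.2.1 t trivial) h3⟩
  choose m hm using hloc
  have hconst : IsLocallyConstant m := by
    refine (IsLocallyConstant.iff_eventually_eq m).2 fun t => ?_
    have h1 : ∀ᶠ s in 𝓝[≠] t, m s = m t := by
      filter_upwards [eventually_eventually_nhdsWithin.2 (hm t), self_mem_nhdsWithin] with s hs hst
      have h2 : ∀ᶠ x in 𝓝[≠] s, mult x (f.1 x) = m t := by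
        rw [isOpen_compl_singleton.nhdsWithin_eq hst] at hs
        exact hs.filter_mono nhdsWithin_le_nhds
      obtain ⟨x, hx, hx'⟩ := ((hm s).and h2).exists
      exact hx.symm.trans hx'
    rw [eventually_nhdsWithin_iff] at h1
    filter_upwards [h1] with s hs
    by_cases hst : s = t
    · rw [hst]
    · exact hs hst
  exact ⟨m 0, fun t => (hconst.apply_eq_of_preconnectedSpace 0 t) ▸ hm t⟩

/-- The generic multiplicity of a global analytic branch. -/
def genericMult (h : HasAnalyticBranches mult) (f : Branch mult) : ℕ :=
  (h.exists_generic_mult f).choose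

lemma genericMult_eq (h : HasAnalyticBranches mult) (f : Branch mult) {κ : Type} [Fintype κ]
    {lam : κ → ℝ → ℝ} {t : ℝ} (hlam : ∀ i, AnalyticAt ℝ (lam i) t)
    (hcount : ∀ᶠ p : ℝ × ℝ in 𝓝 (t, f.1 t), mult p.1 p.2 = Nat.card {i // lam i p.1 = p.2}) :
    Nat.card {i // lam i =ᶠ[𝓝 t] f.1} = h.genericMult f := by
  obtain ⟨s, h1, h2⟩ := (((h.exists_generic_mult f).choose_spec t).and
    (eventually_mult_eq hlam (f.2.1 t trivial) hcount)).exists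
  exact h2.symm.trans h1

/-- The branches with value `μ` at `t`, counted with their generic multiplicities, are as many as
the multiplicity of `μ` at `t`. -/
lemma nonempty_equiv_fin (h : HasAnalyticBranches mult) (t μ : ℝ) :
    Nonempty ({x : Σ f : Branch mult, Fin (h.genericMult f) // x.1.1 t = μ} ≃ Fin (mult t μ)) := by
  obtain ⟨κ, hκ, lam, h1, h2, h3⟩ := h.exists_local t μ
  have hκcard : mult t μ = Nat.card κ := by
    have h4 := h3.self_of_nhds
    rw [h4]
    exact Nat.card_congr (Equiv.subtypeUnivEquiv h2)
  have hext : ∀ i, ∃ F : Branch mult, F.1 =ᶠ[𝓝 t] lam i := fun i => by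
    obtain ⟨F, hF1, hF2, hF3⟩ := h.exists_global_extension (h1 i) (by
      have hc : Tendsto (fun s => (s, lam i s)) (𝓝 t) (𝓝 (t, μ)) := by
        have := (continuousAt_id.prodMk (h1 i).continuousAt).tendsto
        simp only [id_eq, h2 i] at this
        exact this
      filter_upwards [hc.eventually h3] with s hs
      rw [hs]
      exact Nat.card_ne_zero.2 ⟨⟨⟨i, rfl⟩⟩, inferInstance⟩)
    exact ⟨⟨F, hF1, hF2⟩, hF3⟩
  choose F hF using hext
  have hFt : ∀ i, (F i).1 t = μ := fun i => (hF i).eq_of_nhds.trans (h2 i)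
  -- The local branches at (t, μ) are sorted by the global branch that continues them. By unique
  -- continuation each class is the set of local branches with the germ of f, and the generic
  -- multiplicity counts it.
  have hfib : ∀ f : Branch mult, f.1 t = μ → Nonempty (Fin (h.genericMult f) ≃ {i // F i = f}) := by
    intro f hf
    have h4 := h.genericMult_eq f h1 (by rwa [hf])
    have h5 : {i // lam i =ᶠ[𝓝 t] f.1} ≃ {i // F i = f} :=
      Equiv.subtypeEquivRight fun i =>
        ⟨fun h6 => Branch.ext_of_eventuallyEq ((hF i).trans h6), fun h6 => h6 ▸ (hF i).symm⟩
    rw [← h4]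
    exact ⟨(Finite.equivFin _).symm.trans h5⟩
  have e1 : {x : Σ f : Branch mult, Fin (h.genericMult f) // x.1.1 t = μ} ≃
      Σ f : {f : Branch mult // f.1 t = μ}, Fin (h.genericMult f) :=
    { toFun := fun x => ⟨⟨x.1.1, x.2⟩, x.1.2⟩
      invFun := fun x => ⟨⟨x.1.1, x.2⟩, x.1.2⟩
      left_inv := fun _ => rfl
      right_inv := fun _ => rfl }
  have e2 : (Σ f : {f : Branch mult // f.1 t = μ}, Fin (h.genericMult f)) ≃
      Σ f : {f : Branch mult // f.1 t = μ}, {i // (⟨F i, hFt i⟩ : {f : Branch mult // f.1 t = μ}) = f} :=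
    Equiv.sigmaCongrRight fun f => (hfib f.1 f.2).some.trans
      (Equiv.subtypeEquivRight fun i => ⟨fun h6 => Subtype.ext h6, fun h6 => congrArg Subtype.val h6⟩)
  have e3 := Equiv.sigmaFiberEquiv fun i => (⟨F i, hFt i⟩ : {f : Branch mult // f.1 t = μ})
  rw [hκcard]
  exact ⟨e1.trans (e2.trans (e3.trans (Finite.equivFin κ)))⟩

/-- The local branches at (t, μ₀) all take the value μ₀ at t, so no other number near μ₀ has
positive multiplicity: the set is discrete. -/
lemma countable_setOf_mult_ne_zero (h : HasAnalyticBranches mult) (t : ℝ) :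
    {μ | mult t μ ≠ 0}.Countable := by
  have hd : DiscreteTopology {μ | mult t μ ≠ 0} := by
    refine discreteTopology_subtype_iff.2 fun μ₀ _ => ?_
    rw [← disjoint_iff, Filter.disjoint_principal_right]
    obtain ⟨κ, hκ, lam, h1, h2, h3⟩ := h.exists_local t μ₀
    have hc : Tendsto (fun μ => (t, μ)) (𝓝[≠] μ₀) (𝓝 (t, μ₀)) :=
      ((continuousAt_const.prodMk continuousAt_id).tendsto).mono_left nhdsWithin_le_nhds
    filter_upwards [hc.eventually h3, self_mem_nhdsWithin] with μ h4 h5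
    simp only [h2] at h4
    simp only [mem_compl_iff, mem_ofPred_eq, not_not]
    rw [h4]
    have : IsEmpty {i : κ // μ₀ = μ} := ⟨fun x => h5 x.2.symm⟩
    exact Nat.card_of_isEmpty
  exact Set.countable_coe_iff.1 (TopologicalSpace.separableSpace_iff_countable.1 inferInstance)

/-- If infinitely many numbers have a positive multiplicity at some parameter, then the
multiplicities are those of the values of a sequence of analytic functions. -/
theorem exists_enumeration (h : HasAnalyticBranches mult) {t₀ : ℝ}
    (hinf : {μ | mult t₀ μ ≠ 0}.Infinite) :
    ∃ lam : ℕ → ℝ → ℝ, (∀ m, AnalyticOnNhd ℝ (lam m) univ) ∧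
      ∀ t μ, Nonempty ({m // lam m t = μ} ≃ Fin (mult t μ)) := by
  -- Evaluation at t₀ maps this index set onto an infinite countable set with finite fibers, so it
  -- can be enumerated by ℕ.
  let I := Σ f : Branch mult, Fin (h.genericMult f)
  let v : I → {μ | mult t₀ μ ≠ 0} := fun x => ⟨x.1.1 t₀, x.1.2.2 t₀⟩
  have hv : Function.Surjective v := by
    rintro ⟨μ, hμ⟩
    obtain ⟨e⟩ := h.nonempty_equiv_fin t₀ μ
    obtain ⟨x, hx⟩ := e.symm ⟨0, Nat.pos_of_ne_zero hμ⟩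
    exact ⟨x, Subtype.ext hx⟩
  have hI : Infinite I := by
    have := hinf.to_subtype
    exact Infinite.of_surjective v hv
  have hIc : Countable I := by
    have h1 : (univ : Set I).Countable := by
      have h2 : (univ : Set I) ⊆ ⋃ μ ∈ {μ | mult t₀ μ ≠ 0}, {x : I | x.1.1 t₀ = μ} := fun x _ =>
        mem_biUnion (x.1.2.2 t₀) rfl
      refine Countable.mono h2 ((h.countable_setOf_mult_ne_zero t₀).biUnion fun μ _ => ?_)
      obtain ⟨e⟩ := h.nonempty_equiv_fin t₀ μ
      have : Countable {x : I // x.1.1 t₀ = μ} := e.injective.countable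
      exact Set.countable_coe_iff.1 this
    exact countable_univ_iff.1 h1
  obtain ⟨e⟩ : Nonempty (ℕ ≃ I) := nonempty_equiv_of_countable
  refine ⟨fun m => (e m).1.1, fun m => (e m).1.2.1, fun t μ => ?_⟩
  obtain ⟨e'⟩ := h.nonempty_equiv_fin t μ
  exact ⟨(e.subtypeEquiv fun m => Iff.rfl).trans e'⟩

end HasAnalyticBranches

end OperatorFamily

/-! ### Star algebras that separate points determine integrable functions -/

namespace Waveguide

open BoundaryCondition
open scoped BoundedContinuousFunction ComplexConjugate

section Separation

variable {X : Type*} [TopologicalSpace X] [PolishSpace X] [MeasurableSpace X] [BorelSpace X]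
  {μ : Measure X}

/-- The positive and the negative part of r are densities of two finite measures that agree on a
separating star algebra. On a Polish space the measures then coincide, and the two parts are never
both positive. -/
lemma ae_eq_zero_of_forall_integral_mul_real {A : StarSubalgebra ℂ (X →ᵇ ℂ)}
    (hA : (A.map (BoundedContinuousFunction.toContinuousMapStarₐ ℂ)).SeparatesPoints)
    {r : X → ℝ} (hr : Integrable r μ) (h : ∀ g ∈ A, ∫ x, g x * (r x : ℂ) ∂μ = 0) :
    r =ᵐ[μ] 0 := by
  have hfin : ∀ {s : X → ℝ}, Integrable s μ →
      IsFiniteMeasure (μ.withDensity fun x => ENNReal.ofReal (s x)) := fun hs =>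
    isFiniteMeasure_withDensity_ofReal hs.2
  have h1 := hfin hr
  have h2 := hfin hr.neg
  have hint : ∀ {s : X → ℝ}, Integrable s μ → ∀ g : X →ᵇ ℂ,
      ∫ x, g x ∂(μ.withDensity fun x => ENNReal.ofReal (s x)) = ∫ x, g x * (max (s x) 0 : ℝ) ∂μ := by
    intro s hs g
    rw [integral_withDensity_eq_integral_toReal_smul₀ hs.1.aemeasurable.ennreal_ofReal
      (Filter.Eventually.of_forall fun _ => ENNReal.ofReal_lt_top)]
    refine integral_congr_ae (Filter.Eventually.of_forall fun x => ?_)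
    simp only [ENNReal.toReal_ofReal', Complex.real_smul]
    exact mul_comm _ _
  have hgi : ∀ (g : X →ᵇ ℂ) {s : X → ℝ}, Integrable s μ →
      Integrable (fun x => g x * (max (s x) 0 : ℝ)) μ := fun g s hs =>
    (hs.pos_part.ofReal (𝕜 := ℂ)).bdd_mul g.continuous.aestronglyMeasurable
      (Filter.Eventually.of_forall fun x => g.norm_coe_le_norm x)
  have heq := ext_of_forall_mem_subalgebra_integral_eq_of_polish (𝕜 := ℂ) hA (P := μ.withDensity fun x => ENNReal.ofReal (r x))
    (P' := μ.withDensity fun x => ENNReal.ofReal ((-r) x)) (fun g hg => by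
      rw [hint hr, hint hr.neg, ← sub_eq_zero, ← integral_sub (hgi g hr) (hgi g hr.neg), ← h g hg]
      refine integral_congr_ae (Filter.Eventually.of_forall fun x => ?_)
      simp only [Pi.neg_apply]
      rw [← mul_sub, ← Complex.ofReal_sub, max_zero_sub_max_neg_zero_eq_self])
  have h3 := (withDensity_eq_iff hr.1.aemeasurable.ennreal_ofReal
    hr.neg.1.aemeasurable.ennreal_ofReal (by
      have := h1.measure_univ_lt_top.ne
      rwa [withDensity_apply _ MeasurableSet.univ, Measure.restrict_univ] at this)).1 heq
  filter_upwards [h3] with x hx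
  simp only [Pi.neg_apply, Pi.zero_apply] at hx ⊢
  rcases lt_trichotomy (r x) 0 with h4 | h4 | h4
  · rw [ENNReal.ofReal_of_nonpos h4.le, eq_comm, ENNReal.ofReal_eq_zero] at hx
    linarith
  · exact h4
  · rw [ENNReal.ofReal_of_nonpos (by linarith : -r x ≤ 0), ENNReal.ofReal_eq_zero] at hx
    linarith

/-- An integrable function vanishes if its integrals against the elements of a star algebra of
bounded continuous functions that separates points vanish. -/
lemma ae_eq_zero_of_forall_integral_mul {A : StarSubalgebra ℂ (X →ᵇ ℂ)}
    (hA : (A.map (BoundedContinuousFunction.toContinuousMapStarₐ ℂ)).SeparatesPoints)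
    {F : X → ℂ} (hF : Integrable F μ) (h : ∀ g ∈ A, ∫ x, g x * F x ∂μ = 0) :
    F =ᵐ[μ] 0 := by
  -- Closure of the algebra under conjugation passes the hypothesis on to the conjugate of F, and so
  -- to its real and imaginary parts.
  have hconj : ∀ g ∈ A, ∫ x, g x * conj (F x) ∂μ = 0 := by
    intro g hg
    have h1 := h (star g) (star_mem hg)
    have h2 := congrArg conj h1
    rw [← integral_conj, map_zero] at h2
    rw [← h2]
    refine integral_congr_ae (Filter.Eventually.of_forall fun x => ?_)
    simp
  have hgi : ∀ (g : X →ᵇ ℂ) {G : X → ℂ}, Integrable G μ → Integrable (fun x => g x * G x) μ :=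
    fun g G hG => hG.bdd_mul g.continuous.aestronglyMeasurable
      (Filter.Eventually.of_forall fun x => g.norm_coe_le_norm x)
  have hFc : Integrable (fun x => conj (F x)) μ :=
    (Complex.conjLIE.toContinuousLinearEquiv : ℂ →L[ℝ] ℂ).integrable_comp hF
  have hre := ae_eq_zero_of_forall_integral_mul_real hA hF.re fun g hg => by
    have h1 : ∀ x, g x * (RCLike.re (F x) : ℝ) = (1 / 2 : ℂ) * (g x * F x + g x * conj (F x)) := by
      intro x
      have h2 : ((RCLike.re (F x) : ℝ) : ℂ) = (F x + conj (F x)) / 2 := by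
        rw [RCLike.re_eq_complex_re, Complex.re_eq_add_conj]
      rw [h2]; ring
    simp only [h1]
    rw [integral_const_mul, integral_add (hgi g hF) (hgi g hFc), h g hg, hconj g hg]
    simp
  have him := ae_eq_zero_of_forall_integral_mul_real hA hF.im fun g hg => by
    have h1 : ∀ x, g x * (RCLike.im (F x) : ℝ)
        = (1 / (2 * Complex.I) : ℂ) * (g x * F x - g x * conj (F x)) := by
      intro x
      have h2 : ((RCLike.im (F x) : ℝ) : ℂ) = (F x - conj (F x)) / (2 * Complex.I) := by
        rw [RCLike.im_eq_complex_im, Complex.im_eq_sub_conj]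
      rw [h2]; ring
    simp only [h1]
    rw [integral_const_mul, integral_sub (hgi g hF) (hgi g hFc), h g hg, hconj g hg]
    simp
  filter_upwards [hre, him] with x h1 h2
  exact Complex.ext h1 h2

/-- A family of integrable functions with vanishing integrals vanishes, if its span is invariant
under multiplication by functions that separate points. -/
lemma ae_eq_zero_of_span_invariant {ι : Type*} {F : ι → X → ℂ} (hF : ∀ i, Integrable (F i) μ)
    (hF0 : ∀ i, ∫ x, F i x ∂μ = 0) (s : Set (X →ᵇ ℂ))
    (hs : ∀ g ∈ s ∪ star s, ∀ i, (fun x => g x * F i x) ∈ Submodule.span ℂ (range F))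
    (hsep : ∀ x y, x ≠ y → ∃ g ∈ s, g x ≠ g y) (i : ι) : F i =ᵐ[μ] 0 := by
  have h1 : ∀ G ∈ Submodule.span ℂ (range F), Integrable G μ ∧ ∫ x, G x ∂μ = 0 := by
    intro G hG
    induction hG using Submodule.span_induction with
    | mem x hx => obtain ⟨j, rfl⟩ := hx; exact ⟨hF j, hF0 j⟩
    | zero => exact ⟨integrable_zero _ _ _, by simp⟩
    | add a b _ _ ha hb =>
      exact ⟨ha.1.add hb.1, by simp only [Pi.add_apply]; rw [integral_add ha.1 hb.1, ha.2, hb.2, add_zero]⟩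
    | smul c a _ ha =>
      refine ⟨ha.1.smul c, ?_⟩
      simp only [Pi.smul_apply]
      rw [integral_smul, ha.2, smul_zero]
  have h2 : ∀ g ∈ s ∪ star s, ∀ G ∈ Submodule.span ℂ (range F),
      (fun x => g x * G x) ∈ Submodule.span ℂ (range F) := by
    intro g hg G hG
    induction hG using Submodule.span_induction with
    | mem x hx => obtain ⟨j, rfl⟩ := hx; exact hs g hg j
    | zero => simp only [Pi.zero_apply, mul_zero]; exact Submodule.zero_mem _
    | add a b _ _ ha hb =>
      simp only [Pi.add_apply, mul_add]
      exact Submodule.add_mem _ ha hb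
    | smul c a _ ha =>
      simp only [Pi.smul_apply, smul_eq_mul, mul_left_comm _ c]
      exact Submodule.smul_mem _ c ha
  have h3 : ∀ g ∈ StarAlgebra.adjoin ℂ s, ∀ G ∈ Submodule.span ℂ (range F),
      (fun x => g x * G x) ∈ Submodule.span ℂ (range F) := by
    intro g hg
    change g ∈ Algebra.adjoin ℂ (s ∪ star s) at hg
    induction hg using Algebra.adjoin_induction with
    | mem x hx => exact h2 x hx
    | algebraMap r =>
      intro G hG
      have : (fun x => (algebraMap ℂ (X →ᵇ ℂ) r) x * G x) = r • G := by
        funext x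
        simp [Algebra.algebraMap_eq_smul_one]
      rw [this]
      exact Submodule.smul_mem _ _ hG
    | add a b _ _ ha hb =>
      intro G hG
      simp only [BoundedContinuousFunction.coe_add, Pi.add_apply, add_mul]
      exact Submodule.add_mem _ (ha G hG) (hb G hG)
    | mul a b _ _ ha hb =>
      intro G hG
      simp only [BoundedContinuousFunction.coe_mul, Pi.mul_apply, mul_assoc]
      exact ha _ (hb G hG)
  refine ae_eq_zero_of_forall_integral_mul (A := StarAlgebra.adjoin ℂ s) ?_ (hF i) fun g hg =>
    (h1 _ (h3 g hg _ (Submodule.subset_span ⟨i, rfl⟩))).2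
  intro x y hxy
  obtain ⟨g, hg, hgxy⟩ := hsep x y hxy
  exact ⟨g, ⟨g.toContinuousMap, ⟨g, StarAlgebra.subset_adjoin ℂ s hg, rfl⟩, rfl⟩, hgxy⟩

end Separation

end Waveguide

/-! ### Completeness of the basis φ_l -/

namespace Waveguide

open BoundaryCondition
open scoped BoundedContinuousFunction ComplexConjugate

/-- A function that is injective on the cross section and acts on the transversal
eigenfunctions as a combination of two of them. -/
structure IsTransversalMultiplier (γ : BoundaryCondition) (L : ℝ) (w : ℝ → ℂ) : Prop where
  continuous : Continuous w
  norm_le : ∀ t, ‖w t‖ ≤ 1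
  injOn : InjOn w (Ioo 0 L)
  mul_psi : ∀ k : γ.index, ∃ (i j : γ.index) (a b : ℂ), ∀ t,
    w t * γ.psi L k t = a * γ.psi L i t + b * γ.psi L j t
  conj_mul_psi : ∀ k : γ.index, ∃ (i j : γ.index) (a b : ℂ), ∀ t,
    conj (w t) * γ.psi L k t = a * γ.psi L i t + b * γ.psi L j t

/-- The lowest Dirichlet, Neumann and mixed modes, and any exponential, have no zeros in the open
interval; such a factor can be cancelled at the end of the completeness proof. -/
lemma exists_ne_zero_psi (γ : BoundaryCondition) {L : ℝ} (hL : 0 < L) :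
    ∃ k : γ.index, ∀ t ∈ Ioo 0 L, γ.psi L k t ≠ 0 := by
  have h2 : ((√(2 / L) : ℝ) : ℂ) ≠ 0 := by
    exact_mod_cast (Real.sqrt_pos.2 (by positivity)).ne'
  have h1 : ((√(1 / L) : ℝ) : ℂ) ≠ 0 := by
    exact_mod_cast (Real.sqrt_pos.2 (by positivity)).ne'
  cases γ with
  | dirichlet =>
    refine ⟨⟨1, by simp [index]⟩, fun t ht => ?_⟩
    simp only [psi, kappa]
    refine mul_ne_zero h2 ?_
    rw [← Complex.ofReal_mul, ← Complex.ofReal_sin]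
    have h3 : Real.pi * (1 : ℤ) / L * t = Real.pi * (t / L) := by push_cast; field_simp
    have h4 : t / L < 1 := (div_lt_one hL).2 ht.2
    have h5 : 0 < t / L := div_pos ht.1 hL
    rw [h3]
    exact_mod_cast (Real.sin_pos_of_pos_of_lt_pi (mul_pos Real.pi_pos h5)
      (by nlinarith [Real.pi_pos])).ne'
  | neumann =>
    refine ⟨⟨0, by simp [index]⟩, fun t ht => ?_⟩
    simp only [psi, kappa]
    simpa using h1
  | mixed =>
    refine ⟨⟨1, by simp [index]⟩, fun t ht => ?_⟩
    simp only [psi, kappa]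
    refine mul_ne_zero h2 ?_
    rw [← Complex.ofReal_mul, ← Complex.ofReal_sin]
    have h3 : Real.pi * (2 * (1 : ℤ) - 1) / (2 * L) * t = Real.pi * (t / L) / 2 := by
      push_cast; field_simp; ring
    have h4 : t / L < 1 := (div_lt_one hL).2 ht.2
    have h5 : 0 < t / L := div_pos ht.1 hL
    have h6 := mul_pos Real.pi_pos h5
    rw [h3]
    exact_mod_cast (Real.sin_pos_of_pos_of_lt_pi (by linarith)
      (by nlinarith [Real.pi_pos])).ne'
  | quasiPeriodic β hβ =>
    refine ⟨⟨0, by simp [index]⟩, fun t ht => ?_⟩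
    simp only [psi]
    exact mul_ne_zero h1 (Complex.exp_ne_zero _)

lemma isTransversalMultiplier_cos (γ : BoundaryCondition) {L : ℝ} (hL : 0 < L)
    (h : ∀ k : γ.index, ∃ (i j : γ.index) (a b : ℂ), ∀ t : ℝ,
      ((Real.cos (Real.pi / L * t) : ℝ) : ℂ) * γ.psi L k t = a * γ.psi L i t + b * γ.psi L j t) :
    IsTransversalMultiplier γ L (fun t => ((Real.cos (Real.pi / L * t) : ℝ) : ℂ)) where
  continuous := by fun_prop
  norm_le t := by
    rw [Complex.norm_real, Real.norm_eq_abs]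
    exact Real.abs_cos_le_one _
  injOn := by
    intro s hs t ht hst
    have h1 : ∀ u ∈ Ioo 0 L, Real.pi / L * u ∈ Icc 0 Real.pi := fun u hu => by
      have h3 : Real.pi / L * u = Real.pi * (u / L) := by field_simp
      have h4 : u / L < 1 := (div_lt_one hL).2 hu.2
      have h5 : 0 < u / L := div_pos hu.1 hL
      rw [h3]
      exact ⟨(mul_pos Real.pi_pos h5).le, by nlinarith [Real.pi_pos]⟩
    have h2 := Real.injOn_cos (h1 s hs) (h1 t ht) (Complex.ofReal_injective hst)
    exact mul_left_cancel₀ (div_pos Real.pi_pos hL).ne' h2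
  mul_psi := h
  conj_mul_psi k := by
    simp only [Complex.conj_ofReal]
    exact h k

/-- Multiplication by cos(πt/L) moves a sine or cosine mode to its two neighbors, and exp(2πit/L)
shifts the quasi-periodic modes by one. Only the lowest index of a half-line of modes needs care. -/
lemma exists_isTransversalMultiplier (γ : BoundaryCondition) {L : ℝ} (hL : 0 < L) :
    ∃ w, IsTransversalMultiplier γ L w := by
  have hL' : (L : ℂ) ≠ 0 := by exact_mod_cast hL.ne'
  have hs : ∀ x y : ℂ, Complex.cos x * Complex.sin y
      = 1 / 2 * Complex.sin (y + x) + 1 / 2 * Complex.sin (y - x) := by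
    intro x y; rw [Complex.sin_add, Complex.sin_sub]; ring
  have hc : ∀ x y : ℂ, Complex.cos x * Complex.cos y
      = 1 / 2 * Complex.cos (y + x) + 1 / 2 * Complex.cos (y - x) := by
    intro x y; rw [Complex.cos_add, Complex.cos_sub]; ring
  cases γ with
  | dirichlet =>
    refine ⟨_, isTransversalMultiplier_cos _ hL fun ⟨k, hk⟩ => ?_⟩
    simp only [index, mem_Ici] at hk
    -- The lower neighbor would be sin 0 = 0, so its coefficient is set to zero.
    by_cases h : k = 1
    · subst h
      refine ⟨⟨2, by simp [index]⟩, ⟨1, by simp [index]⟩, 1 / 2, 0, fun t => ?_⟩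
      simp only [psi, kappa]
      push_cast
      rw [mul_left_comm, hs, show (Real.pi : ℂ) * 1 / L * t - Real.pi / L * t = 0 by ring,
        show (Real.pi : ℂ) * 1 / L * t + Real.pi / L * t = Real.pi * 2 / L * t by ring]
      simp; ring
    · refine ⟨⟨k + 1, by simp [index]; omega⟩, ⟨k - 1, by simp [index]; omega⟩, 1 / 2, 1 / 2,
        fun t => ?_⟩
      simp only [psi, kappa]
      push_cast
      rw [mul_left_comm, hs,
        show (Real.pi : ℂ) * k / L * t - Real.pi / L * t = Real.pi * (k - 1) / L * t by ring,
        show (Real.pi : ℂ) * k / L * t + Real.pi / L * t = Real.pi * (k + 1) / L * t by ring]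
      ring
  | neumann =>
    have h1 : ((√(1 / L) : ℝ) : ℂ) ≠ 0 := by
      exact_mod_cast (Real.sqrt_pos.2 (by positivity)).ne'
    have h2 : ((√(2 / L) : ℝ) : ℂ) ≠ 0 := by
      exact_mod_cast (Real.sqrt_pos.2 (by positivity)).ne'
    refine ⟨_, isTransversalMultiplier_cos _ hL fun ⟨k, hk⟩ => ?_⟩
    simp only [index, mem_Ici] at hk
    -- Both neighbors of the constant mode are the same cosine, and the ratio of square roots
    -- corrects the different normalization of the constant. The index k - 1 = 0 below needs the
    -- same correction.
    by_cases h : k = 0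
    · subst h
      refine ⟨⟨1, by simp [index]⟩, ⟨1, by simp [index]⟩,
        ((√(1 / L) : ℝ) : ℂ) / ((√(2 / L) : ℝ) : ℂ), 0, fun t => ?_⟩
      simp only [psi, kappa, if_true, one_ne_zero, if_false]
      push_cast
      simp only [mul_zero, zero_div, zero_mul, Complex.cos_zero, add_zero, mul_one]
      field_simp
    · refine ⟨⟨k + 1, by simp [index]; omega⟩, ⟨k - 1, by simp [index]; omega⟩, 1 / 2,
        ((√(2 / L) : ℝ) : ℂ) / ((√((if k - 1 = 0 then 1 else 2) / L) : ℝ) : ℂ) / 2,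
        fun t => ?_⟩
      have h3 : ((√((if k - 1 = 0 then 1 else 2) / L) : ℝ) : ℂ) ≠ 0 := by
        split_ifs <;> assumption
      simp only [psi, kappa, if_neg h, if_neg (by omega : ¬ k + 1 = 0)]
      generalize ((√((if k - 1 = 0 then 1 else 2) / L) : ℝ) : ℂ) = c at h3
      push_cast
      rw [mul_left_comm, hc,
        show (Real.pi : ℂ) * k / L * t - Real.pi / L * t = Real.pi * (k - 1) / L * t by ring,
        show (Real.pi : ℂ) * k / L * t + Real.pi / L * t = Real.pi * (k + 1) / L * t by ring]
      field_simp
  | mixed =>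
    refine ⟨_, isTransversalMultiplier_cos _ hL fun ⟨k, hk⟩ => ?_⟩
    simp only [index, mem_Ici] at hk
    have e : ∀ t : ℝ, ((Real.cos (Real.pi / L * t) : ℝ) : ℂ) * BoundaryCondition.mixed.psi L k t
        = 1 / 2 * BoundaryCondition.mixed.psi L (k + 1) t
          + 1 / 2 * BoundaryCondition.mixed.psi L (k - 1) t := by
      intro t
      simp only [psi, kappa]
      push_cast
      rw [mul_left_comm, hs, show (Real.pi : ℂ) * (2 * k - 1) / (2 * L) * t - Real.pi / L * t
          = Real.pi * (2 * (k - 1) - 1) / (2 * L) * t by field_simp; ring,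
        show (Real.pi : ℂ) * (2 * k - 1) / (2 * L) * t + Real.pi / L * t
          = Real.pi * (2 * (k + 1) - 1) / (2 * L) * t by field_simp; ring]
      ring
    -- The neighbor with index 0 lies outside the index set but equals minus the mode with index 1.
    by_cases h : k = 1
    · subst h
      refine ⟨⟨2, by simp [index]⟩, ⟨1, by simp [index]⟩, 1 / 2, -(1 / 2), fun t => ?_⟩
      have h0 : BoundaryCondition.mixed.psi L (1 - 1) t = -BoundaryCondition.mixed.psi L 1 t := by
        simp only [psi, kappa]
        push_cast
        rw [← mul_neg, ← Complex.sin_neg]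
        congr 2
        ring
      rw [e, h0]
      norm_num
    · exact ⟨⟨k + 1, by simp [index]; omega⟩, ⟨k - 1, by simp [index]; omega⟩, 1 / 2, 1 / 2, e⟩
  | quasiPeriodic β hβ =>
    refine ⟨fun t : ℝ => Complex.exp (((2 * Real.pi / L * t : ℝ) : ℂ) * Complex.I), by fun_prop,
      fun t => (Complex.norm_exp_ofReal_mul_I _).le, ?_, ?_, ?_⟩
    · intro s hs t ht hst
      obtain ⟨n, hn⟩ := Complex.exp_eq_exp_iff_exists_int.1 hst
      have h1 : 2 * Real.pi / L * s = 2 * Real.pi / L * t + n * (2 * Real.pi) := by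
        have := congrArg Complex.im hn
        simpa using this
      have h2 : s - t = n * L := by
        have := Real.pi_pos
        field_simp at h1
        linarith
      have h3 : n = 0 := by
        have h4 : (n : ℝ) < 1 := by
          by_contra! h5
          nlinarith [hs.1, hs.2, ht.1, ht.2]
        have h5 : (-1 : ℝ) < n := by
          by_contra! h5
          nlinarith [hs.1, hs.2, ht.1, ht.2]
        have h6 : n < 1 := by exact_mod_cast h4
        have h7 : -1 < n := by exact_mod_cast h5
        omega
      rw [h3] at h2
      simp at h2
      linarith
    · rintro ⟨k, hk⟩
      refine ⟨⟨k + 1, trivial⟩, ⟨k, hk⟩, 1, 0, fun t => ?_⟩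
      simp only [psi, kappa]
      rw [mul_left_comm, ← Complex.exp_add]
      simp only [one_mul, zero_mul, add_zero]
      congr 2
      push_cast
      field_simp
      ring
    · rintro ⟨k, hk⟩
      refine ⟨⟨k - 1, trivial⟩, ⟨k, hk⟩, 1, 0, fun t => ?_⟩
      simp only [psi, kappa, ← Complex.exp_conj, map_mul, Complex.conj_ofReal, Complex.conj_I]
      rw [mul_left_comm, ← Complex.exp_add]
      simp only [one_mul, zero_mul, add_zero]
      congr 2
      push_cast
      field_simp
      ring

/-- A function in `L²(Ω)` that is orthogonal to all basis functions vanishes. -/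
lemma eq_zero_of_forall_inner_phi (γ : BoundaryCondition) {L : ℝ} (hL : 0 < L) {f : L2 L}
    (hf : ∀ l, inner ℂ (phi γ L l) f = 0) : f = 0 := by
  obtain ⟨w, hw⟩ := exists_isTransversalMultiplier γ hL
  obtain ⟨k₀, hk₀⟩ := exists_ne_zero_psi γ hL
  have hO : IsOpen (Ioo (0 : ℝ) 1 ×ˢ Ioo (0 : ℝ) L) := isOpen_Ioo.prod isOpen_Ioo
  have hM := hO.measurableSet
  let X := {x : ℝ × ℝ // x ∈ Ioo (0 : ℝ) 1 ×ˢ Ioo (0 : ℝ) L}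
  have : PolishSpace X := hO.polishSpace
  let μ : Measure X := Measure.comap Subtype.val volume
  have hμ : μ.map Subtype.val = cellMeasure L := map_comap_subtype_coe hM _
  have hemb : MeasurableEmbedding (Subtype.val : X → ℝ × ℝ) := MeasurableEmbedding.subtype_coe hM
  -- The span of these products is invariant under exp(2πi x₁), which shifts l₁, under the
  -- transversal multiplier, and under the conjugates of both. Together these functions separate the
  -- points of the open cell.
  let G : Index γ → ℝ × ℝ → ℂ := fun l x => conj (f x) * phiFun γ L l x
  have hG : ∀ l, Integrable (G l) (cellMeasure L) ∧ ∫ x, G l x ∂(cellMeasure L) = 0 := by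
    intro l
    have h1 : (fun x => inner ℂ (f x) (phi γ L l x)) =ᵐ[cellMeasure L] G l := by
      filter_upwards [(memLp_phiFun γ L l).coeFn_toLp] with x hx
      rw [phi, hx, RCLike.inner_apply']
    refine ⟨(MeasureTheory.L2.integrable_inner f (phi γ L l)).congr h1, ?_⟩
    rw [← integral_congr_ae h1, ← MeasureTheory.L2.inner_def, ← inner_conj_symm, hf, map_zero]
  let F : Index γ → X → ℂ := fun l x => G l x
  have hF : ∀ l, Integrable (F l) μ := fun l => by
    have h1 := (hG l).1
    rw [← hμ, hemb.integrable_map_iff] at h1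
    exact h1
  have hF0 : ∀ l, ∫ x, F l x ∂μ = 0 := fun l => by
    have h1 := (hG l).2
    rw [← hμ, hemb.integral_map] at h1
    exact h1
  let z : X →ᵇ ℂ := BoundedContinuousFunction.ofNormedAddCommGroup
    (fun x => Complex.exp (((2 * Real.pi * x.1.1 : ℝ) : ℂ) * Complex.I)) (by fun_prop) 1
    (fun x => (Complex.norm_exp_ofReal_mul_I _).le)
  let w' : X →ᵇ ℂ := BoundedContinuousFunction.ofNormedAddCommGroup
    (fun x => w x.1.2) (hw.continuous.comp (by fun_prop)) 1 (fun x => hw.norm_le _)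
  have hcomb : ∀ (l₁ : ℤ) (g : ℝ → ℂ) (k : γ.index),
      (∃ (i j : γ.index) (a b : ℂ), ∀ t, g t * γ.psi L k t = a * γ.psi L i t + b * γ.psi L j t) →
      (fun x : X => g x.1.2 * F (l₁, k) x) ∈ Submodule.span ℂ (range F) := by
    rintro l₁ g k ⟨i, j, a, b, h⟩
    have h1 : (fun x : X => g x.1.2 * F (l₁, k) x) = a • F (l₁, i) + b • F (l₁, j) := by
      funext x
      simp only [F, G, phiFun, Pi.add_apply, Pi.smul_apply, smul_eq_mul]
      linear_combination (conj (f x.1) * Complex.exp (2 * Real.pi * Complex.I * l₁ * x.1.1))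
        * h x.1.2
    rw [h1]
    exact Submodule.add_mem _ (Submodule.smul_mem _ _ (Submodule.subset_span ⟨_, rfl⟩))
      (Submodule.smul_mem _ _ (Submodule.subset_span ⟨_, rfl⟩))
  have hz : ∀ (n : ℤ) (l : Index γ) (c : X → ℂ),
      (∀ x, c x = Complex.exp (2 * Real.pi * Complex.I * n * x.1.1)) →
      (fun x => c x * F l x) ∈ Submodule.span ℂ (range F) := by
    intro n l c hc
    have h1 : (fun x => c x * F l x) = F (l.1 + n, l.2) := by
      funext x
      simp only [F, G, phiFun, hc x]
      push_cast
      rw [show 2 * (Real.pi : ℂ) * Complex.I * (l.1 + n) * x.1.1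
        = 2 * Real.pi * Complex.I * n * x.1.1 + 2 * Real.pi * Complex.I * l.1 * x.1.1 by ring,
        Complex.exp_add]
      ring
    rw [h1]
    exact Submodule.subset_span ⟨_, rfl⟩
  have hs : ∀ g ∈ ({z, w'} : Set (X →ᵇ ℂ)) ∪ star {z, w'}, ∀ l,
      (fun x => g x * F l x) ∈ Submodule.span ℂ (range F) := by
    rintro g (hg | hg) l
    · rcases hg with rfl | rfl
      · exact hz 1 l _ fun x => by
          simp only [z, BoundedContinuousFunction.coe_ofNormedAddCommGroup]
          congr 1; push_cast; ring
      · exact hcomb l.1 w l.2 (hw.mul_psi l.2)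
    · rw [Set.mem_star] at hg
      rcases hg with hg | hg
      · rw [star_eq_iff_star_eq] at hg
        rw [← hg]
        exact hz (-1) l _ fun x => by
          simp only [z, BoundedContinuousFunction.star_apply,
            BoundedContinuousFunction.coe_ofNormedAddCommGroup, Complex.star_def,
            ← Complex.exp_conj, map_mul, Complex.conj_ofReal, Complex.conj_I]
          congr 1; push_cast; ring
      · have hg' : star g = w' := hg
        rw [star_eq_iff_star_eq] at hg'
        rw [← hg']
        exact hcomb l.1 (fun t => conj (w t)) l.2 (hw.conj_mul_psi l.2)
  have hsep : ∀ x y : X, x ≠ y → ∃ g ∈ ({z, w'} : Set (X →ᵇ ℂ)), g x ≠ g y := by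
    intro x y hxy
    by_contra! hcon
    have h1 : z x = z y := hcon z (by simp)
    have h2 : w x.1.2 = w y.1.2 := hcon w' (by simp)
    have h3 := hw.injOn x.2.2 y.2.2 h2
    apply hxy
    refine Subtype.ext (Prod.ext ?_ h3)
    obtain ⟨n, hn⟩ := Complex.exp_eq_exp_iff_exists_int.1 h1
    have h4 : 2 * Real.pi * x.1.1 = 2 * Real.pi * y.1.1 + n * (2 * Real.pi) := by
      have := congrArg Complex.im hn
      simpa using this
    have h5 : x.1.1 = y.1.1 + n := by
      have := Real.pi_pos
      field_simp at h4
      linarith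
    have hx := x.2.1
    have hy := y.2.1
    have h6 : (n : ℝ) < 1 := by linarith [hx.2, hy.1]
    have h7 : (-1 : ℝ) < n := by linarith [hx.1, hy.2]
    have h8 : n < 1 := by exact_mod_cast h6
    have h9 : -1 < n := by exact_mod_cast h7
    have h10 : n = 0 := by omega
    rw [h5, h10]; simp
  have hfin := ae_eq_zero_of_span_invariant hF hF0 _ hs hsep (0, k₀)
  have h1 : G (0, k₀) =ᵐ[cellMeasure L] 0 := by
    rw [← hμ]
    exact (hemb.ae_map_iff (p := fun x => G (0, k₀) x = 0)).2 hfin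
  refine (Lp.eq_zero_iff_ae_eq_zero).2 ?_
  filter_upwards [h1, ae_restrict_mem hM] with x hx hxm
  simp only [G, phiFun, Pi.zero_apply] at hx
  simpa [hk₀ x.2 hxm.2] using hx

/-- The basis `φ_l` of `L²(Ω)`. -/
def phiBasis (γ : BoundaryCondition) {L : ℝ} (hL : 0 < L) : HilbertBasis (Index γ) ℂ (L2 L) :=
  HilbertBasis.mkOfOrthogonalEqBot (orthonormal_phi γ hL) <| by
    rw [Submodule.eq_bot_iff]
    intro f hf
    refine eq_zero_of_forall_inner_phi γ hL fun l => ?_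
    exact (Submodule.mem_orthogonal _ _).1 hf _ (Submodule.subset_span ⟨l, rfl⟩)

@[simp]
lemma phiBasis_apply (γ : BoundaryCondition) {L : ℝ} (hL : 0 < L) (l : Index γ) :
    phiBasis γ hL l = phi γ L l := by
  simp [phiBasis]

end Waveguide

/-! ### Fourier symbols and the Hilbert space structure of H² -/

namespace Waveguide

open BoundaryCondition
open scoped ComplexConjugate InnerProductSpace

variable {γ : BoundaryCondition} {L : ℝ}

/-- The operator `F` acts on the Fourier coefficients as multiplication by `m`. -/
def HasSymbol (F : H2 γ L →L[ℂ] L2 L) (m : Index γ → ℂ) : Prop :=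
  ∀ u l, ⟪phi γ L l, F u⟫_ℂ = m l * ⟪phi γ L l, H2.incl γ L u⟫_ℂ

namespace HasSymbol

variable {F G : H2 γ L →L[ℂ] L2 L} {m n : Index γ → ℂ}

lemma add (hF : HasSymbol F m) (hG : HasSymbol G n) : HasSymbol (F + G) (fun l => m l + n l) :=
  fun u l => by rw [add_apply, inner_add_right, hF, hG, add_mul]

lemma sub (hF : HasSymbol F m) (hG : HasSymbol G n) : HasSymbol (F - G) (fun l => m l - n l) :=
  fun u l => by rw [sub_apply, inner_sub_right, hF, hG, sub_mul]

lemma neg (hF : HasSymbol F m) : HasSymbol (-F) (fun l => -m l) :=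
  fun u l => by rw [neg_apply, inner_neg_right, hF, neg_mul]

lemma smul (c : ℂ) (hF : HasSymbol F m) : HasSymbol (c • F) (fun l => c * m l) :=
  fun u l => by rw [smul_apply, inner_smul_right, hF, mul_assoc]

lemma congr (hF : HasSymbol F m) (h : ∀ l, m l = n l) : HasSymbol F n :=
  fun u l => by rw [hF, h]

end HasSymbol

lemma hasSymbol_incl : HasSymbol (H2.incl γ L) (fun _ => 1) := fun _ _ => (one_mul _).symm

lemma hasSymbol_fourierMul (hL : 0 < L) (m : Index γ → ℂ) (hm : ∀ l, ‖m l‖ ≤ weight γ L l) :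
    HasSymbol (fourierMul γ hL m hm) m := by
  intro u l
  have h1 := (hasSum_fourierMul γ hL m hm u).mapL (innerSL ℂ (phi γ L l))
  refine h1.unique ?_
  have h2 := hasSum_single (f := fun k => innerSL ℂ (phi γ L l)
      ((m k * ⟪phi γ L k, H2.incl γ L u⟫_ℂ) • phi γ L k)) l fun k hk => by
    simp [(orthonormal_phi γ hL).inner_eq_zero hk.symm]
  simpa [inner_smul_right, (orthonormal_phi γ hL).norm_eq_one] using! h2

lemma hasSymbol_deltaXi (hL : 0 < L) (ξ : ℂ) :
    HasSymbol (deltaXi γ hL ξ)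
      (fun l => -((2 * Real.pi * l.1 + ξ) ^ 2 + (γ.kappa L l.2 : ℂ) ^ 2)) := by
  refine (((hasSymbol_fourierMul hL _ _).add ((hasSymbol_fourierMul hL _ _).smul _)).sub
    (hasSymbol_incl.smul _)).congr fun l => ?_
  push_cast
  linear_combination (4 * ξ * Real.pi * l.1) * Complex.I_sq

lemma hasSum_norm_sq (γ : BoundaryCondition) (hL : 0 < L) (f : L2 L) :
    HasSum (fun l => ‖⟪phi γ L l, f⟫_ℂ‖ ^ 2) (‖f‖ ^ 2) := by
  have h := (phiBasis γ hL).hasSum_inner_mul_inner f f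
  simp only [phiBasis_apply] at h
  have h2 := Complex.hasSum_re h
  rw [inner_self_eq_norm_sq_to_K] at h2
  convert! h2 using 1
  · funext l
    rw [← inner_conj_symm f, RCLike.conj_mul]
    norm_cast
  · norm_cast

lemma norm_le_of_forall_inner (γ : BoundaryCondition) (hL : 0 < L) {f g : L2 L} {δ : ℝ} (hδ : 0 ≤ δ)
    (h : ∀ l, ‖⟪phi γ L l, f⟫_ℂ‖ ≤ δ * ‖⟪phi γ L l, g⟫_ℂ‖) : ‖f‖ ≤ δ * ‖g‖ := by
  have h1 : ‖f‖ ^ 2 ≤ (δ * ‖g‖) ^ 2 := by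
    rw [mul_pow]
    refine hasSum_le (fun l => ?_) (hasSum_norm_sq γ hL f) ((hasSum_norm_sq γ hL g).mul_left (δ ^ 2))
    rw [← mul_pow]
    exact pow_le_pow_left₀ (norm_nonneg _) (h l) 2
  exact (pow_le_pow_iff_left₀ (norm_nonneg _) (by positivity) two_ne_zero).1 h1

/-- Parseval. The comparison is required only for modes that occur in u, which allows high-frequency
functions to be estimated separately. -/
lemma HasSymbol.norm_le (hL : 0 < L) {F G : H2 γ L →L[ℂ] L2 L} {m n : Index γ → ℂ}
    (hF : HasSymbol F m) (hG : HasSymbol G n) {δ : ℝ} (hδ : 0 ≤ δ) {u : H2 γ L}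
    (h : ∀ l, ⟪phi γ L l, H2.incl γ L u⟫_ℂ ≠ 0 → ‖m l‖ ≤ δ * ‖n l‖) : ‖F u‖ ≤ δ * ‖G u‖ := by
  refine norm_le_of_forall_inner γ hL hδ fun l => ?_
  rw [hF, hG, norm_mul, norm_mul, ← mul_assoc]
  by_cases h0 : ⟪phi γ L l, H2.incl γ L u⟫_ℂ = 0
  · simp [h0]
  · exact mul_le_mul_of_nonneg_right (h l h0) (norm_nonneg _)

lemma HasSymbol.inner_symm (hL : 0 < L) {F : H2 γ L →L[ℂ] L2 L} {m : Index γ → ℝ}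
    (hF : HasSymbol F (fun l => (m l : ℂ))) (u v : H2 γ L) :
    ⟪F u, H2.incl γ L v⟫_ℂ = ⟪H2.incl γ L u, F v⟫_ℂ := by
  rw [← (phiBasis γ hL).tsum_inner_mul_inner, ← (phiBasis γ hL).tsum_inner_mul_inner]
  refine tsum_congr fun l => ?_
  rw [phiBasis_apply, hF v l, ← inner_conj_symm, hF u l, map_mul, Complex.conj_ofReal,
    inner_conj_symm]
  ring

lemma HasSymbol.re_inner_nonneg (hL : 0 < L) {F : H2 γ L →L[ℂ] L2 L} {m : Index γ → ℝ}
    (hF : HasSymbol F (fun l => (m l : ℂ))) (hm : ∀ l, 0 ≤ m l) (u : H2 γ L) :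
    0 ≤ (⟪H2.incl γ L u, F u⟫_ℂ).re := by
  have h := Complex.hasSum_re ((phiBasis γ hL).hasSum_inner_mul_inner (H2.incl γ L u) (F u))
  refine h.nonneg fun l => ?_
  rw [phiBasis_apply, hF u l, ← inner_conj_symm, mul_left_comm, Complex.re_ofReal_mul,
    RCLike.conj_mul]
  refine mul_nonneg (hm l) ?_
  norm_cast
  exact sq_nonneg _

/-! ### The space `H²_γ(Ω)` -/

lemma one_le_weight (l : Index γ) : 1 ≤ weight γ L l := by
  unfold weight
  nlinarith [sq_nonneg (2 * Real.pi * l.1), sq_nonneg (γ.kappa L l.2)]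

/-- The operator with the symbol `1 + (2π l₁)² + κ_{l₂}²`. -/
def weightOp (γ : BoundaryCondition) (hL : 0 < L) : H2 γ L →L[ℂ] L2 L :=
  fourierMul γ hL (fun l => (weight γ L l : ℂ)) fun l => by
    rw [Complex.norm_real, Real.norm_of_nonneg (weight_pos γ l).le]

lemma hasSymbol_weightOp (hL : 0 < L) :
    HasSymbol (weightOp γ hL) (fun l => (weight γ L l : ℂ)) :=
  hasSymbol_fourierMul hL _ _

lemma norm_coeffs (hL : 0 < L) (u : H2 γ L) : ‖H2.coeffs γ L u‖ = ‖weightOp γ hL u‖ := by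
  have h1 : H2.coeffs γ L u = (phiBasis γ hL).repr (weightOp γ hL u) := by
    ext l
    rw [HilbertBasis.repr_apply_apply, phiBasis_apply, hasSymbol_weightOp hL]
    rfl
  rw [h1, LinearIsometryEquiv.norm_map]

lemma norm_weightOp (hL : 0 < L) (u : H2 γ L) : ‖weightOp γ hL u‖ = ‖u‖ := by
  rw [H2.norm_def, ← norm_coeffs, max_eq_right]
  rw [norm_coeffs hL]
  have := hasSymbol_incl.norm_le hL (hasSymbol_weightOp hL) zero_le_one (u := u) fun l _ => by
    rw [one_mul, norm_one, Complex.norm_real, Real.norm_of_nonneg (weight_pos γ l).le]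
    exact one_le_weight l
  rwa [one_mul] at this

lemma weightOp_surjective (hL : 0 < L) : Function.Surjective (weightOp γ hL) := by
  intro f
  let a := (phiBasis γ hL).repr f
  have ha : Memℓp (fun l => ((weight γ L l : ℂ))⁻¹ * a l) 2 := by
    refine (lp.memℓp a).norm.mono fun l => ?_
    rw [norm_mul, norm_inv, Complex.norm_real, Real.norm_of_nonneg (weight_pos γ l).le]
    exact mul_le_of_le_one_left (norm_nonneg _) (inv_le_one_of_one_le₀ (one_le_weight l))
  let v : L2 L := (phiBasis γ hL).repr.symm ⟨_, ha⟩
  have hv : ∀ l, ⟪phi γ L l, v⟫_ℂ = ((weight γ L l : ℂ))⁻¹ * a l := fun l => by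
    rw [← phiBasis_apply γ hL, ← HilbertBasis.repr_apply_apply, LinearIsometryEquiv.apply_symm_apply]
  have hw : ∀ l, (weight γ L l : ℂ) ≠ 0 := fun l => by exact_mod_cast (weight_pos γ l).ne'
  have hv2 : ∀ l, (weight γ L l : ℂ) * ⟪phi γ L l, v⟫_ℂ = a l := fun l => by
    rw [hv, mul_inv_cancel_left₀ (hw l)]
  have hmem : v ∈ H2Submodule γ L := by
    change Memℓp (fun l : Index γ => (weight γ L l : ℂ) * ⟪phi γ L l, v⟫_ℂ) 2
    simp only [hv2]
    exact lp.memℓp a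
  let u : H2 γ L := ⟨v, hmem⟩
  refine ⟨u, ?_⟩
  rw [← sub_eq_zero]
  refine eq_zero_of_forall_inner_phi γ hL fun l => ?_
  rw [inner_sub_right, hasSymbol_weightOp hL]
  change (weight γ L l : ℂ) * ⟪phi γ L l, v⟫_ℂ - _ = 0
  rw [hv2, sub_eq_zero, HilbertBasis.repr_apply_apply, phiBasis_apply]

/-- The isometry of `H²_γ(Ω)` onto `L²(Ω)` with the symbol `1 + (2π l₁)² + κ_{l₂}²`. -/
def weightEquiv (γ : BoundaryCondition) (hL : 0 < L) : H2 γ L ≃ₗᵢ[ℂ] L2 L :=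
  LinearIsometryEquiv.ofSurjective
    { (weightOp γ hL : H2 γ L →ₗ[ℂ] L2 L) with norm_map' := norm_weightOp hL }
    (weightOp_surjective hL)

lemma weightEquiv_apply (hL : 0 < L) (u : H2 γ L) : weightEquiv γ hL u = weightOp γ hL u := rfl

lemma completeSpace_H2 (γ : BoundaryCondition) (hL : 0 < L) : CompleteSpace (H2 γ L) :=
  (completeSpace_congr (e := (weightEquiv γ hL).toEquiv)
    (weightEquiv γ hL).isometry.isUniformEmbedding).2 inferInstance

lemma incl_injective : Function.Injective (H2.incl γ L) := fun _ _ h => Subtype.ext h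

end Waveguide

/-! ### Analytic Fredholm theory: a bound for the orders of zeros -/

namespace OperatorFamily

open Filter Topology

section AnalyticFredholm

lemma analyticAt_apply {E F : Type*} [NormedAddCommGroup E] [NormedSpace ℂ E]
    [NormedAddCommGroup F] [NormedSpace ℂ F] {A : ℂ → E →L[ℂ] F} {u : ℂ → E} {ξ : ℂ}
    (hA : AnalyticAt ℂ A ξ) (hu : AnalyticAt ℂ u ξ) : AnalyticAt ℂ (fun ζ => A ζ (u ζ)) ξ :=
  ((ContinuousLinearMap.apply ℂ F).flip.analyticAt_bilinear (A ξ, u ξ)).comp₂ hA hu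

variable {H : Type*} [NormedAddCommGroup H] [NormedSpace ℂ H] {ι : Type*} [Fintype ι]

/-- The finite rank operator `f ↦ ∑ p_i(f) e_i`. -/
def finiteRank (e : ι → H) (p : ι → H →L[ℂ] ℂ) : H →L[ℂ] H := ∑ i, (p i).smulRight (e i)

lemma finiteRank_apply (e : ι → H) (p : ι → H →L[ℂ] ℂ) (f : H) :
    finiteRank e p f = ∑ i, p i f • e i := by
  simp [finiteRank]

/-- The matrix whose determinant detects the kernel of `1 - K`. -/
def perturbationMatrix [DecidableEq ι] (e : ι → H) (p : ι → H →L[ℂ] ℂ) (W K : H →L[ℂ] H) : Matrix ι ι ℂ :=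
  fun i j => (1 : Matrix ι ι ℂ) i j - p i (W (K (e j)))

lemma perturbationMatrix_mulVec [DecidableEq ι] (e : ι → H) (p : ι → H →L[ℂ] ℂ) (W K : H →L[ℂ] H) (v : ι → ℂ)
    (i : ι) :
    (perturbationMatrix e p W K).mulVec v i = v i - p i (W (K (∑ j, v j • e j))) := by
  simp only [perturbationMatrix, Matrix.mulVec, dotProduct, sub_mul, Finset.sum_sub_distrib,
    Matrix.one_apply, ite_mul, one_mul, zero_mul, Finset.sum_ite_eq, Finset.mem_univ, if_true,
    map_sum, map_smul, smul_eq_mul]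
  congr 1
  exact Finset.sum_congr rfl fun j _ => mul_comm _ _

variable [CompleteSpace H]

lemma isUnit_one_sub_comp {e : ι → H} {p : ι → H →L[ℂ] ℂ} {K : H →L[ℂ] H}
    (hK : ‖K * (1 - finiteRank e p)‖ < 1) : IsUnit (1 - K * (1 - finiteRank e p)) :=
  isUnit_one_sub_of_norm_lt_one hK

/-- With P of finite rank, 1 - K = (1 - K(1 - P)) - KP, and the first summand is invertible. Its
inverse turns 1 - K into a perturbation of the identity that sees only the finitely many numbers
p_i(u). -/
lemma inverse_apply_sub {e : ι → H} {p : ι → H →L[ℂ] ℂ} {K : H →L[ℂ] H}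
    (hK : ‖K * (1 - finiteRank e p)‖ < 1) (u : H) :
    Ring.inverse (1 - K * (1 - finiteRank e p)) (u - K u)
      = u - Ring.inverse (1 - K * (1 - finiteRank e p)) (K (finiteRank e p u)) := by
  have h1 : u - K u = (1 - K * (1 - finiteRank e p)) u - K (finiteRank e p u) := by
    simp [sub_apply, sub_sub]
  rw [h1, map_sub]
  congr 1
  exact congrArg (fun T : H →L[ℂ] H => T u) (Ring.inverse_mul_cancel _ (isUnit_one_sub_comp hK))

/-- A null vector v of the matrix yields u = WK ∑ v_j e_j with p_i(u) = v_i, and this u is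
annihilated by 1 - K. -/
lemma perturbationMatrix_det_ne_zero [DecidableEq ι] {e : ι → H} {p : ι → H →L[ℂ] ℂ} {K : H →L[ℂ] H}
    (hK : ‖K * (1 - finiteRank e p)‖ < 1) (hinj : ∀ u, u - K u = 0 → u = 0) :
    (perturbationMatrix e p (Ring.inverse (1 - K * (1 - finiteRank e p))) K).det ≠ 0 := by
  intro hdet
  obtain ⟨v, hv, hv0⟩ := Matrix.exists_mulVec_eq_zero_iff.2 hdet
  set W := Ring.inverse (1 - K * (1 - finiteRank e p)) with hW
  set u := W (K (∑ j, v j • e j)) with hu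
  have hpu : ∀ i, p i u = v i := fun i => by
    have := congrFun hv0 i
    rw [perturbationMatrix_mulVec, Pi.zero_apply, sub_eq_zero] at this
    exact this.symm
  have hPu : finiteRank e p u = ∑ j, v j • e j := by
    simp only [finiteRank_apply, hpu]
  have h1 : (1 - K * (1 - finiteRank e p)) u = K (finiteRank e p u) := by
    rw [hPu, hu]
    exact congrArg (fun T : H →L[ℂ] H => T (K (∑ j, v j • e j)))
      (Ring.mul_inverse_cancel _ (isUnit_one_sub_comp hK))
  have h2 : u - K u = 0 := by
    have : u - K u = (1 - K * (1 - finiteRank e p)) u - K (finiteRank e p u) := by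
      simp [sub_apply, sub_sub]
    rw [this, h1, sub_self]
  apply hv
  funext i
  rw [← hpu i, hinj u h2, map_zero, Pi.zero_apply]

lemma analyticAt_det [DecidableEq ι] {A : ℂ → Matrix ι ι ℂ} {ξ : ℂ}
    (hA : ∀ i j, AnalyticAt ℂ (fun ζ => A ζ i j) ξ) : AnalyticAt ℂ (fun ζ => (A ζ).det) ξ := by
  simp only [Matrix.det_apply']
  refine Finset.analyticAt_fun_sum _ fun σ _ => analyticAt_const.mul ?_
  exact Finset.analyticAt_fun_prod _ fun i _ => hA _ _

/-- The orders of the zeros of `ξ ↦ u_ξ - K_ξ u_ξ` at a given point are bounded, if the operators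
`K_ξ` are uniformly close to operators of finite rank and `1 - K_ξ` is injective for some `ξ`. -/
theorem exists_analyticOrderAt_le [DecidableEq ι] {e : ι → H} {p : ι → H →L[ℂ] ℂ} {K : ℂ → H →L[ℂ] H}
    {U : Set ℂ} (hU : IsPreconnected U) (hK : AnalyticOnNhd ℂ K U)
    (hsmall : ∀ ξ ∈ U, ‖K ξ * (1 - finiteRank e p)‖ < 1)
    (hinj : ∃ ξ ∈ U, ∀ u, u - K ξ u = 0 → u = 0) {ξ₀ : ℂ} (hξ₀ : ξ₀ ∈ U) :
    ∃ n : ℕ, ∀ u : ℂ → H, AnalyticAt ℂ u ξ₀ → u ξ₀ ≠ 0 →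
      analyticOrderAt (fun ξ => u ξ - K ξ (u ξ)) ξ₀ ≤ n := by
  obtain ⟨ξ₁, hξ₁, hinj⟩ := hinj
  let W : ℂ → H →L[ℂ] H := fun ξ => Ring.inverse (1 - K ξ * (1 - finiteRank e p))
  have hW : ∀ ξ ∈ U, AnalyticAt ℂ W ξ := by
    intro ξ hξ
    obtain ⟨z, hz⟩ := isUnit_one_sub_comp (hsmall ξ hξ)
    have h1 : AnalyticAt ℂ (fun ξ => 1 - K ξ * (1 - finiteRank e p)) ξ :=
      analyticAt_const.sub ((hK ξ hξ).mul analyticAt_const)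
    have h2 := analyticAt_inverse (𝕜 := ℂ) z
    rw [hz] at h2
    exact h2.comp_of_eq h1 rfl
  let G : ℂ → Matrix ι ι ℂ := fun ξ => perturbationMatrix e p (W ξ) (K ξ)
  have hG : ∀ ξ ∈ U, ∀ i j, AnalyticAt ℂ (fun ζ => G ζ i j) ξ := by
    intro ξ hξ i j
    exact analyticAt_const.sub (((p i).analyticAt _).comp
      (analyticAt_apply (hW ξ hξ) (analyticAt_apply (hK ξ hξ) analyticAt_const)))
  let d : ℂ → ℂ := fun ξ => (G ξ).det
  have hd : AnalyticOnNhd ℂ d U := fun ξ hξ => analyticAt_det (hG ξ hξ)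
  have hd₁ : d ξ₁ ≠ 0 := perturbationMatrix_det_ne_zero (hsmall ξ₁ hξ₁) hinj
  -- The bound is the order of the determinant at ξ₀. It is finite by the identity theorem, since
  -- the determinant is nonzero at ξ₁.
  have htop : analyticOrderAt d ξ₀ ≠ ⊤ := by
    intro h
    rw [analyticOrderAt_eq_top] at h
    exact hd₁ (hd.eqOn_zero_of_preconnected_of_eventuallyEq_zero hU hξ₀ h hξ₁)
  refine ⟨(analyticOrderAt d ξ₀).toNat, fun u hu hu0 => ?_⟩
  by_contra! hlt
  rw [ENat.natCast_toNat htop] at hlt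
  have hfan : AnalyticAt ℂ (fun ξ => u ξ - K ξ (u ξ)) ξ₀ := hu.sub (analyticAt_apply (hK ξ₀ hξ₀) hu)
  set m := (analyticOrderAt d ξ₀).toNat with hm
  have hdm : analyticOrderAt d ξ₀ = m := (ENat.natCast_toNat htop).symm
  have hle : ((m + 1 : ℕ) : ℕ∞) ≤ analyticOrderAt (fun ξ => u ξ - K ξ (u ξ)) ξ₀ := by
    push_cast
    rw [hdm] at hlt
    exact Order.add_one_le_of_lt hlt
  obtain ⟨g, hg, hfg⟩ := (natCast_le_analyticOrderAt hfan).1 hle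
  have hUev : ∀ᶠ ξ in 𝓝 ξ₀, ∀ f : H, W ξ (f - K ξ f) = f - W ξ (K ξ (finiteRank e p f)) := by
    have h1 : ∀ᶠ ξ in 𝓝 ξ₀, ‖K ξ * (1 - finiteRank e p)‖ < 1 := by
      have h2 : ContinuousAt (fun ξ => ‖K ξ * (1 - finiteRank e p)‖) ξ₀ :=
        ((hK ξ₀ hξ₀).continuousAt.mul continuousAt_const).norm
      exact h2.eventually_lt_const (hsmall ξ₀ hξ₀)
    filter_upwards [h1] with ξ hξ f using inverse_apply_sub hξ f
  have hmul : ∀ᶠ ξ in 𝓝 ξ₀, (G ξ).mulVec (fun i => p i (u ξ))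
      = (ξ - ξ₀) ^ (m + 1) • fun i => p i (W ξ (g ξ)) := by
    filter_upwards [hUev, hfg] with ξ h1 h2
    funext i
    rw [perturbationMatrix_mulVec, ← finiteRank_apply, ← map_sub, ← h1, h2]
    simp
  -- If all p_i(u) vanished at ξ₀, then u = W(u - Ku) = 0 there, because u - Ku has a zero of
  -- positive order.
  have hi : ∃ i, p i (u ξ₀) ≠ 0 := by
    by_contra! hcon
    have h1 := hUev.self_of_nhds (u ξ₀)
    have h2 : finiteRank e p (u ξ₀) = 0 := by simp [finiteRank_apply, hcon]
    rw [hfg.self_of_nhds, h2] at h1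
    simp at h1
    exact hu0 h1.symm
  obtain ⟨i, hi⟩ := hi
  let c : ℂ → ℂ := fun ξ => (G ξ).cramer (fun i => p i (W ξ (g ξ))) i
  have hWg : ∀ j, AnalyticAt ℂ (fun ξ => p j (W ξ (g ξ))) ξ₀ := fun j =>
    ((p j).analyticAt _).comp (analyticAt_apply (hW ξ₀ hξ₀) hg)
  have hc : AnalyticAt ℂ c ξ₀ := by
    simp only [c, Matrix.cramer_apply]
    refine analyticAt_det fun j k => ?_
    simp only [Matrix.updateCol_apply]
    split_ifs
    · exact hWg j
    · exact hG ξ₀ hξ₀ j k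
  -- Cramer's rule. The left side has order exactly m, as its second factor does not vanish at ξ₀,
  -- while the right side has order at least m + 1.
  have heq : (fun ξ => d ξ * p i (u ξ)) =ᶠ[𝓝 ξ₀] fun ξ => (ξ - ξ₀) ^ (m + 1) • c ξ := by
    filter_upwards [hmul] with ξ h1
    have h2 := congrArg (fun v => (G ξ).cramer v i) h1
    simp only [map_smul, Matrix.cramer_eq_adjugate_mulVec, Matrix.mulVec_mulVec,
      Matrix.adjugate_mul] at h2
    simp only [Matrix.smul_mulVec, Matrix.one_mulVec] at h2
    simpa [c, d, Matrix.cramer_eq_adjugate_mulVec] using h2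
  have hpu : AnalyticAt ℂ (fun ξ => p i (u ξ)) ξ₀ := ((p i).analyticAt _).comp hu
  have h1 : ((m + 1 : ℕ) : ℕ∞) ≤ analyticOrderAt (fun ξ => d ξ * p i (u ξ)) ξ₀ :=
    (natCast_le_analyticOrderAt ((hd ξ₀ hξ₀).mul hpu)).2 ⟨c, hc, heq⟩
  have h2 : analyticOrderAt (fun ξ => d ξ * p i (u ξ)) ξ₀ = m := by
    have h3 := analyticOrderAt_mul (hd ξ₀ hξ₀) hpu
    have h4 : analyticOrderAt (fun ξ => p i (u ξ)) ξ₀ = 0 := hpu.analyticOrderAt_eq_zero.2 hi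
    rw [h4, add_zero, hdm] at h3
    exact h3
  rw [h2] at h1
  have : m + 1 ≤ m := by exact_mod_cast h1
  omega

end AnalyticFredholm

end OperatorFamily

/-! ### Finite rank approximation and the Fredholm property of Δ_ξ + μ ε -/

namespace Waveguide

open BoundaryCondition OperatorFamily
open scoped ComplexConjugate InnerProductSpace

variable {γ : BoundaryCondition} {L : ℝ}

/-! ### Finite rank approximation -/

lemma HasSymbol.ext (hL : 0 < L) {F G : H2 γ L →L[ℂ] L2 L} {m : Index γ → ℂ}
    (hF : HasSymbol F m) (hG : HasSymbol G m) : F = G := by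
  ext1 u
  rw [← sub_eq_zero]
  refine eq_zero_of_forall_inner_phi γ hL fun l => ?_
  rw [inner_sub_right, hF, hG, sub_self]

/-- The orthogonal projection of `L²(Ω)` onto the span of the `φ_l` with `l ∈ s`. -/
def truncation (γ : BoundaryCondition) (L : ℝ) (s : Finset (Index γ)) : L2 L →L[ℂ] L2 L :=
  finiteRank (fun l : s => phi γ L l) fun l => innerSL ℂ (phi γ L l)

lemma inner_phi_truncation (hL : 0 < L) (s : Finset (Index γ)) (f : L2 L) (l : Index γ) :
    ⟪phi γ L l, truncation γ L s f⟫_ℂ = if l ∈ s then ⟪phi γ L l, f⟫_ℂ else 0 := by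
  classical
  rw [truncation, finiteRank_apply, Finset.univ_eq_attach,
    Finset.sum_attach s (fun k => (innerSL ℂ (phi γ L k)) f • phi γ L k), inner_sum]
  simp only [inner_smul_right, innerSL_apply_apply, orthonormal_iff_ite.1 (orthonormal_phi γ hL)]
  simp

lemma inner_phi_one_sub_truncation (hL : 0 < L) (s : Finset (Index γ)) (f : L2 L) (l : Index γ) :
    ⟪phi γ L l, (1 - truncation γ L s) f⟫_ℂ = if l ∈ s then 0 else ⟪phi γ L l, f⟫_ℂ := by
  rw [sub_apply, inner_sub_right, inner_phi_truncation hL]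
  split_ifs <;> simp

lemma norm_one_sub_truncation_le (hL : 0 < L) (s : Finset (Index γ)) (f : L2 L) :
    ‖(1 - truncation γ L s) f‖ ≤ ‖f‖ := by
  rw [← one_mul ‖f‖]
  refine norm_le_of_forall_inner γ hL zero_le_one fun l => ?_
  rw [inner_phi_one_sub_truncation hL]
  split_ifs
  · simp
  · rw [one_mul]

lemma finite_abs_le_of_affine {a : ℝ} (ha : a ≠ 0) (b R : ℝ) :
    {k : ℤ | |a * k + b| ≤ R}.Finite := by
  refine (Set.finite_Icc (-⌈(R + |b|) / |a|⌉) ⌈(R + |b|) / |a|⌉).subset fun k hk => ?_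
  have h1 : |a| * |(k : ℝ)| ≤ R + |b| := by
    rw [← abs_mul]
    have h2 := abs_sub (a * k + b) b
    rw [add_sub_cancel_right] at h2
    have h3 : |a * k + b| ≤ R := hk
    linarith
  have h2 : |(k : ℝ)| ≤ (R + |b|) / |a| := by
    rw [le_div_iff₀ (abs_pos.2 ha)]
    linarith
  have h3 := abs_le.1 (h2.trans (Int.le_ceil _))
  constructor
  · exact_mod_cast h3.1
  · exact_mod_cast h3.2

lemma exists_kappa_eq (γ : BoundaryCondition) (hL : 0 < L) :
    ∃ a b : ℝ, a ≠ 0 ∧ ∀ k, γ.kappa L k = a * k + b := by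
  have hp := Real.pi_pos
  cases γ with
  | dirichlet => exact ⟨Real.pi / L, 0, by positivity, fun k => by simp only [kappa]; ring⟩
  | neumann => exact ⟨Real.pi / L, 0, by positivity, fun k => by simp only [kappa]; ring⟩
  | mixed =>
    exact ⟨Real.pi / L, -(Real.pi / (2 * L)), by positivity, fun k => by
      simp only [kappa]; field_simp; ring⟩
  | quasiPeriodic β hβ =>
    exact ⟨2 * Real.pi / L, β / L, by positivity, fun k => by simp only [kappa]; ring⟩

lemma finite_weight_le (γ : BoundaryCondition) (hL : 0 < L) (R : ℝ) :
    {l : Index γ | weight γ L l ≤ R}.Finite := by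
  obtain ⟨a, b, ha, hab⟩ := exists_kappa_eq γ hL
  have h1 := finite_abs_le_of_affine (a := 2 * Real.pi) (by positivity) 0 (√R)
  have h2 := (finite_abs_le_of_affine ha b (√R)).preimage
    (Subtype.val_injective.injOn (s := Subtype.val ⁻¹' _) : InjOn (Subtype.val : γ.index → ℤ) _)
  refine (h1.prod h2).subset fun l hl => ?_
  have hl' : 1 + (2 * Real.pi * l.1) ^ 2 + γ.kappa L l.2 ^ 2 ≤ R := hl
  rw [mem_prod]
  constructor
  · rw [mem_ofPred_eq, add_zero]
    exact Real.abs_le_sqrt (by nlinarith [sq_nonneg (γ.kappa L l.2)])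
  · rw [mem_preimage, mem_ofPred_eq, ← hab]
    exact Real.abs_le_sqrt (by nlinarith [sq_nonneg (2 * Real.pi * l.1)])

lemma hasSymbol_partialX (hL : 0 < L) :
    HasSymbol (partialX γ hL) (fun l => 2 * Real.pi * Complex.I * l.1) :=
  hasSymbol_fourierMul hL _ _

/-- Lower order operators are small away from finitely many Fourier modes. -/
lemma exists_truncation (γ : BoundaryCondition) (hL : 0 < L) {δ : ℝ} (hδ : 0 < δ) :
    ∃ s : Finset (Index γ), ∀ f : L2 L,
      ‖H2.incl γ L ((weightEquiv γ hL).symm ((1 - truncation γ L s) f))‖ ≤ δ * ‖f‖ ∧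
      ‖partialX γ hL ((weightEquiv γ hL).symm ((1 - truncation γ L s) f))‖ ≤ δ * ‖f‖ := by
  -- The symbol of ∂₁ is at most the square root of the weight, so relative to the weight it is
  -- below δ once the weight exceeds δ⁻². The inclusion, with symbol 1, is smaller still.
  refine ⟨(finite_weight_le γ hL (1 / δ ^ 2)).toFinset, fun f => ?_⟩
  set s := (finite_weight_le γ hL (1 / δ ^ 2)).toFinset
  set g := (weightEquiv γ hL).symm ((1 - truncation γ L s) f) with hg
  have hQ : weightOp γ hL g = (1 - truncation γ L s) f := by
    rw [← weightEquiv_apply, hg, LinearIsometryEquiv.apply_symm_apply]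
  have hw : ∀ l, ⟪phi γ L l, H2.incl γ L g⟫_ℂ ≠ 0 → 1 < δ ^ 2 * weight γ L l := by
    intro l hl
    have h1 : l ∉ s := by
      intro h2
      have h3 := inner_phi_one_sub_truncation hL s f l
      rw [if_pos h2, ← hQ, hasSymbol_weightOp hL] at h3
      have h4 : (weight γ L l : ℂ) ≠ 0 := by exact_mod_cast (weight_pos γ l).ne'
      exact hl ((mul_eq_zero.1 h3).resolve_left h4)
    have h2 : 1 / δ ^ 2 < weight γ L l := by
      by_contra! h3
      exact h1 ((Set.Finite.mem_toFinset _).2 h3)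
    rw [div_lt_iff₀ (by positivity)] at h2
    linarith
  have hnorm : ‖weightOp γ hL g‖ ≤ ‖f‖ := by
    rw [hQ]; exact norm_one_sub_truncation_le hL s f
  constructor
  · refine (hasSymbol_incl.norm_le hL (hasSymbol_weightOp hL) hδ.le fun l hl => ?_).trans
      (mul_le_mul_of_nonneg_left hnorm hδ.le)
    rw [norm_one, Complex.norm_real, Real.norm_of_nonneg (weight_pos γ l).le]
    have h1 := hw l hl
    have h2 := one_le_weight (L := L) l
    have h3 := weight_pos (L := L) γ l
    by_contra! h4
    nlinarith [mul_pos hδ h3]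
  · refine ((hasSymbol_partialX hL).norm_le hL (hasSymbol_weightOp hL) hδ.le fun l hl => ?_).trans
      (mul_le_mul_of_nonneg_left hnorm hδ.le)
    rw [Complex.norm_real, Real.norm_of_nonneg (weight_pos γ l).le]
    have h1 := hw l hl
    have h3 := weight_pos (L := L) γ l
    have h4 : ‖2 * (Real.pi : ℂ) * Complex.I * l.1‖ = |2 * Real.pi * l.1| := by
      rw [abs_mul, abs_of_pos (by positivity)]
      simp [abs_of_pos Real.pi_pos]
    rw [h4]
    refine abs_le_of_sq_le_sq ?_ (by positivity)
    have h5 : (2 * Real.pi * l.1) ^ 2 ≤ weight γ L l := by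
      unfold weight
      nlinarith [sq_nonneg (γ.kappa L l.2)]
    nlinarith

/-! ### The pencil `Δ_ξ + μ ε` -/

variable (ε : Permittivity L)

/-- The operator `Δ_ξ + μ ε`. -/
def pencil (γ : BoundaryCondition) (hL : 0 < L) (ε : Permittivity L) (ξ μ : ℂ) :
    H2 γ L →L[ℂ] L2 L :=
  deltaXi γ hL ξ + μ • (ε.mulL ∘L H2.incl γ L)

/-- The compact operator `K` with `Δ_ξ + μ ε = -(1 - K) Q`, where `Q` is `weightEquiv`. -/
def pencilRemainder (γ : BoundaryCondition) (hL : 0 < L) (ε : Permittivity L) (ξ μ : ℂ) :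
    L2 L →L[ℂ] L2 L :=
  ((2 * Complex.I * ξ) • partialX γ hL + (1 - ξ ^ 2) • H2.incl γ L
    + μ • (ε.mulL ∘L H2.incl γ L)) ∘L
    ((weightEquiv γ hL).symm.toContinuousLinearEquiv : L2 L →L[ℂ] H2 γ L)

lemma laplacian_eq (hL : 0 < L) : laplacian γ hL = H2.incl γ L - weightOp γ hL := by
  refine HasSymbol.ext hL (hasSymbol_fourierMul hL _ _)
    ((hasSymbol_incl.sub (hasSymbol_weightOp hL)).congr fun l => ?_)
  rw [weight]
  push_cast
  ring

lemma pencil_apply (hL : 0 < L) (ξ μ : ℂ) (u : H2 γ L) :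
    pencil γ hL ε ξ μ u = -(weightEquiv γ hL u - pencilRemainder γ hL ε ξ μ (weightEquiv γ hL u)) := by
  have h1 : pencilRemainder γ hL ε ξ μ (weightEquiv γ hL u)
      = ((2 * Complex.I * ξ) • partialX γ hL + (1 - ξ ^ 2) • H2.incl γ L
        + μ • (ε.mulL ∘L H2.incl γ L)) u := by
    simp [pencilRemainder]
  rw [h1, pencil, deltaXi, laplacian_eq, weightEquiv_apply]
  simp only [add_apply, sub_apply, smul_apply]
  module

lemma analyticAt_pencilRemainder (hL : 0 < L) (μ ξ : ℂ) :
    AnalyticAt ℂ (fun ξ => pencilRemainder γ hL ε ξ μ) ξ := by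
  have h1 : AnalyticAt ℂ (fun ξ : ℂ => (2 * Complex.I * ξ) • partialX γ hL
      + (1 - ξ ^ 2) • H2.incl γ L + μ • (ε.mulL ∘L H2.incl γ L)) ξ :=
    (((analyticAt_const.mul analyticAt_id).smul analyticAt_const).add
      ((analyticAt_const.sub (analyticAt_id.pow 2)).smul analyticAt_const)).add analyticAt_const
  exact (((ContinuousLinearMap.compL ℂ (L2 L) (H2 γ L) (L2 L)).flip
    ((weightEquiv γ hL).symm.toContinuousLinearEquiv : L2 L →L[ℂ] H2 γ L)).analyticAt _).comp h1

/-- The remainder contains only lower order operators, with coefficients of total size at most c on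
the ball; modes cut off at accuracy 1/(c + 1) leave norm at most c/(c + 1). One cutoff serves all ξ
of the ball. -/
lemma exists_norm_pencilRemainder_lt (hL : 0 < L) (R : ℝ) (μ : ℂ) :
    ∃ s : Finset (Index γ), ∀ ξ : ℂ, ‖ξ‖ ≤ R →
      ‖pencilRemainder γ hL ε ξ μ * (1 - truncation γ L s)‖ < 1 := by
  set c := 2 * |R| + (1 + R ^ 2) + ‖μ‖ * ‖ε.mulL‖ with hc
  have hc0 : 0 ≤ c := by positivity
  obtain ⟨s, hs⟩ := exists_truncation γ hL (δ := 1 / (c + 1)) (by positivity)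
  refine ⟨s, fun ξ hξ => ?_⟩
  refine (ContinuousLinearMap.opNorm_le_bound _ (M := c / (c + 1)) (by positivity)
    fun f => ?_).trans_lt ((div_lt_one (by positivity)).2 (by linarith))
  obtain ⟨h1, h2⟩ := hs f
  set g := (weightEquiv γ hL).symm ((1 - truncation γ L s) f) with hg
  have h3 : (pencilRemainder γ hL ε ξ μ * (1 - truncation γ L s)) f
      = (2 * Complex.I * ξ) • partialX γ hL g + (1 - ξ ^ 2) • H2.incl γ L g
        + μ • ε.mulL (H2.incl γ L g) := by
    simp [pencilRemainder, hg]
  have hξ2 : ‖1 - ξ ^ 2‖ ≤ 1 + R ^ 2 := by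
    refine (norm_sub_le _ _).trans ?_
    rw [norm_one, norm_pow]
    gcongr
  have hξ1 : ‖2 * Complex.I * ξ‖ ≤ 2 * |R| := by
    simp only [norm_mul, Complex.norm_ofNat, Complex.norm_I, mul_one]
    gcongr
    exact hξ.trans (le_abs_self R)
  rw [h3]
  calc _ ≤ ‖(2 * Complex.I * ξ) • partialX γ hL g‖ + ‖(1 - ξ ^ 2) • H2.incl γ L g‖
        + ‖μ • ε.mulL (H2.incl γ L g)‖ := norm_add₃_le
    _ ≤ 2 * |R| * (1 / (c + 1) * ‖f‖) + (1 + R ^ 2) * (1 / (c + 1) * ‖f‖)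
        + ‖μ‖ * (‖ε.mulL‖ * (1 / (c + 1) * ‖f‖)) := by
      rw [norm_smul, norm_smul, norm_smul]
      gcongr
      exact (ε.mulL.le_opNorm _).trans (by gcongr)
    _ = c / (c + 1) * ‖f‖ := by
      rw [hc]; ring

/-- The operators `Δ_ξ + μ ε` are finite rank perturbations of isomorphisms. -/
lemma isFinitePerturbation_pencil (hL : 0 < L) (ξ μ : ℂ) :
    IsFinitePerturbation (pencil γ hL ε ξ μ) := by
  obtain ⟨s, hs⟩ := exists_norm_pencilRemainder_lt (γ := γ) ε hL ‖ξ‖ μ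
  obtain ⟨z, hz⟩ := isUnit_one_sub_of_norm_lt_one (hs ξ le_rfl)
  -- With P the truncation, -(1 - K)Q = -(1 - K(1 - P))Q + KPQ: an isomorphism plus an operator of
  -- finite rank.
  refine ⟨((weightEquiv γ hL).toContinuousLinearEquiv.trans
    (ContinuousLinearEquiv.unitsEquiv ℂ _ z)).trans (ContinuousLinearEquiv.neg ℂ),
    (pencilRemainder γ hL ε ξ μ * truncation γ L s) ∘L
      ((weightEquiv γ hL).toContinuousLinearEquiv : H2 γ L →L[ℂ] L2 L), ?_, ?_⟩
  · have h1 : LinearMap.range (((pencilRemainder γ hL ε ξ μ * truncation γ L s) ∘L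
      ((weightEquiv γ hL).toContinuousLinearEquiv : H2 γ L →L[ℂ] L2 L) :
        H2 γ L →L[ℂ] L2 L) : H2 γ L →ₗ[ℂ] L2 L) ≤ Submodule.span ℂ
        (range fun l : s => pencilRemainder γ hL ε ξ μ (phi γ L l)) := by
      rintro _ ⟨u, rfl⟩
      have h2 : ((pencilRemainder γ hL ε ξ μ * truncation γ L s) ∘L
          ((weightEquiv γ hL).toContinuousLinearEquiv : H2 γ L →L[ℂ] L2 L)) u
          = pencilRemainder γ hL ε ξ μ (truncation γ L s (weightEquiv γ hL u)) := rfl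
      rw [ContinuousLinearMap.coe_coe, h2, truncation, finiteRank_apply, map_sum]
      refine Submodule.sum_mem _ fun l _ => ?_
      rw [map_smul]
      exact Submodule.smul_mem _ _ (Submodule.subset_span ⟨l, rfl⟩)
    have := FiniteDimensional.span_of_finite ℂ
      (finite_range fun l : s => pencilRemainder γ hL ε ξ μ (phi γ L l))
    exact Submodule.finiteDimensional_of_le h1
  · ext1 u
    rw [pencil_apply]
    have h3 : (z : L2 L →L[ℂ] L2 L) (weightEquiv γ hL u)
        = weightEquiv γ hL u - pencilRemainder γ hL ε ξ μ
          (weightEquiv γ hL u - truncation γ L s (weightEquiv γ hL u)) := by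
      rw [hz]; simp [sub_apply]
    have h4 : (ContinuousLinearEquiv.unitsEquiv ℂ (L2 L) z) (weightEquiv γ hL u)
      = (z : L2 L →L[ℂ] L2 L) (weightEquiv γ hL u) := rfl
    simp only [add_apply, ContinuousLinearMap.comp_apply, ContinuousLinearEquiv.coe_coe,
      ContinuousLinearEquiv.trans_apply, LinearIsometryEquiv.coe_toContinuousLinearEquiv,
      ContinuousLinearEquiv.neg_apply, h4, h3, map_sub]
    simp only [mul_apply_eq_comp]
    abel

end Waveguide

/-! ### The symmetric pencil, the slope estimate, and bounded multiplicities -/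

namespace Waveguide

open BoundaryCondition OperatorFamily
open scoped ComplexConjugate InnerProductSpace

variable {γ : BoundaryCondition} {L : ℝ}

namespace Permittivity

variable (ε : Permittivity L)

lemma inner_mulL (u v : L2 L) : ⟪ε.mulL u, v⟫_ℂ = ⟪u, ε.mulL v⟫_ℂ := by
  rw [MeasureTheory.L2.inner_def, MeasureTheory.L2.inner_def]
  refine integral_congr_ae ?_
  filter_upwards [ε.coeFn_mulL u, ε.coeFn_mulL v] with x h1 h2
  rw [h1, h2, RCLike.inner_apply', RCLike.inner_apply', map_mul, Complex.conj_ofReal]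
  ring

lemma exists_le_norm_mulL : ∃ c : ℝ, 0 < c ∧ ∀ u, c * ‖u‖ ≤ ‖ε.mulL u‖ := by
  obtain ⟨c, hc, hc'⟩ := ε.lower_bound
  refine ⟨c, hc, fun u => ?_⟩
  have h1 : ‖(c : ℂ) • u‖ ≤ ‖ε.mulL u‖ := by
    refine Lp.norm_le_norm_of_ae_le ?_
    filter_upwards [ε.coeFn_mulL u, ae_mono cellMeasure_le hc', Lp.coeFn_smul (c : ℂ) u]
      with x h1 h2 h3
    rw [h1, h3, Pi.smul_apply, smul_eq_mul, norm_mul, norm_mul, Complex.norm_real,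
      Complex.norm_real, Real.norm_of_nonneg hc.le, Real.norm_of_nonneg (hc.le.trans h2)]
    exact mul_le_mul_of_nonneg_right h2 (norm_nonneg _)
  rwa [norm_smul, Complex.norm_real, Real.norm_of_nonneg hc.le] at h1

/-- The square root of a permittivity. -/
def sqrt : Permittivity L where
  toFun x := √(ε.toFun x)
  aestronglyMeasurable := Real.continuous_sqrt.comp_aestronglyMeasurable ε.aestronglyMeasurable
  periodic x₁ x₂ h := by rw [ε.periodic x₁ x₂ h]
  lower_bound := by
    obtain ⟨c, hc, hc'⟩ := ε.lower_bound
    exact ⟨√c, Real.sqrt_pos.2 hc, hc'.mono fun x hx => Real.sqrt_le_sqrt hx⟩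
  upper_bound := by
    obtain ⟨C, hC⟩ := ε.upper_bound
    exact ⟨√C, hC.mono fun x hx => Real.sqrt_le_sqrt hx⟩

lemma mulL_sqrt_sqrt (u : L2 L) : ε.sqrt.mulL (ε.sqrt.mulL u) = ε.mulL u := by
  obtain ⟨c, hc, hc'⟩ := ε.lower_bound
  refine Lp.ext ?_
  filter_upwards [ε.coeFn_mulL u, ae_mono cellMeasure_le hc', ε.sqrt.coeFn_mulL u,
    ε.sqrt.coeFn_mulL (ε.sqrt.mulL u)] with x h1 h2 h3 h4
  rw [h1, h4, h3, ← mul_assoc, ← Complex.ofReal_mul]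
  congr 2
  exact Real.mul_self_sqrt (hc.le.trans h2)

lemma mulL_injective : Function.Injective ε.mulL := by
  obtain ⟨c, hc, h⟩ := ε.exists_le_norm_mulL
  refine (injective_iff_map_eq_zero _).2 fun u hu => ?_
  have h1 := h u
  rw [hu, norm_zero] at h1
  exact norm_le_zero_iff.1 (by nlinarith [norm_nonneg u])

end Permittivity

variable (ε : Permittivity L)

/-- The operator `u ↦ ε u` from `H²_γ(Ω)` to `L²(Ω)`. -/
def epsOp (γ : BoundaryCondition) (ε : Permittivity L) : H2 γ L →L[ℂ] L2 L :=
  ε.mulL ∘L H2.incl γ L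

lemma hasSymbol_deltaXi_real (hL : 0 < L) (t : ℝ) :
    HasSymbol (deltaXi γ hL t)
      (fun l => ((-((2 * Real.pi * l.1 + t) ^ 2 + γ.kappa L l.2 ^ 2) : ℝ) : ℂ)) :=
  (hasSymbol_deltaXi hL t).congr fun l => by push_cast; ring

lemma neg_deltaXi_sub (hL : 0 < L) (ξ μ : ℂ) :
    -deltaXi γ hL ξ - μ • epsOp γ ε = -pencil γ hL ε ξ μ := by
  rw [pencil, epsOp]; abel

lemma analyticAt_deltaXi (hL : 0 < L) (ξ : ℂ) : AnalyticAt ℂ (deltaXi γ hL) ξ :=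
  (analyticAt_const.add ((analyticAt_const.mul analyticAt_id).smul analyticAt_const)).sub
    ((analyticAt_id.pow 2).smul analyticAt_const)

lemma deriv_neg_deltaXi (hL : 0 < L) (ξ : ℂ) :
    deriv (fun ξ => -deltaXi γ hL ξ) ξ
      = -((2 * Complex.I) • partialX γ hL - (2 * ξ) • H2.incl γ L) := by
  have h1 : HasDerivAt (fun ξ : ℂ => 2 * Complex.I * ξ) (2 * Complex.I) ξ := by
    simpa using (hasDerivAt_id ξ).const_mul (2 * Complex.I)
  have h2 : HasDerivAt (fun ξ : ℂ => ξ ^ 2) (2 * ξ) ξ := by simpa using hasDerivAt_pow 2 ξ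
  have h3 : HasDerivAt (fun ξ => deltaXi γ hL ξ)
      ((2 * Complex.I) • partialX γ hL - (2 * ξ) • H2.incl γ L) ξ :=
    ((h1.smul_const (partialX γ hL)).const_add (laplacian γ hL)).sub
      (h2.smul_const (H2.incl γ L))
  exact h3.neg.deriv

lemma isFinitePerturbation_neg {E H : Type*} [NormedAddCommGroup E] [NormedSpace ℂ E]
    [NormedAddCommGroup H] [NormedSpace ℂ H] {B : E →L[ℂ] H} (hB : IsFinitePerturbation B) :
    IsFinitePerturbation (-B) := by
  obtain ⟨e, R, hR, rfl⟩ := hB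
  refine ⟨e.trans (ContinuousLinearEquiv.neg ℂ), -R, ?_, ?_⟩
  · rwa [show ((-R : E →L[ℂ] H) : E →ₗ[ℂ] H) = -(R : E →ₗ[ℂ] H) from rfl, LinearMap.range_neg]
  · ext1 u
    simp [add_comm]

/-- The operators `-Δ_ξ` and multiplication by `ε` form a symmetric pencil. -/
lemma isSymmetricPencil (γ : BoundaryCondition) (hL : 0 < L) (ε : Permittivity L) :
    IsSymmetricPencil (fun ξ => -deltaXi γ hL ξ) (epsOp γ ε) (H2.incl γ L) (epsOp γ ε.sqrt) where
  analyticAt ξ := (analyticAt_deltaXi hL ξ).neg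
  symm t u v := by
    rw [neg_apply, neg_apply, inner_neg_left, inner_neg_right,
      (hasSymbol_deltaXi_real hL t).inner_symm hL]
  form u v := by
    change ⟪ε.mulL _, _⟫_ℂ = ⟪ε.sqrt.mulL _, ε.sqrt.mulL _⟫_ℂ
    rw [← ε.sqrt.inner_mulL, ε.mulL_sqrt_sqrt]
    rfl
  injective := ε.sqrt.mulL_injective.comp incl_injective
  fredholm t μ := by
    rw [neg_deltaXi_sub]
    exact isFinitePerturbation_neg (isFinitePerturbation_pencil ε hL t μ)

lemma eigenspace_eq (hL : 0 < L) (t μ : ℝ) :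
    IsSymmetricPencil.eigenspace (fun ξ => -deltaXi γ hL ξ) (epsOp γ ε) t μ
      = bandEigenspace γ hL ε t μ := by
  ext u
  change (-deltaXi γ hL t - (μ : ℂ) • epsOp γ ε) u = 0 ↔ pencil γ hL ε t μ u = 0
  rw [neg_deltaXi_sub, neg_apply, neg_eq_zero]

/-- The multiplicity of `μ` as an eigenvalue of `A_t`. -/
def bandMult (γ : BoundaryCondition) (hL : 0 < L) (ε : Permittivity L) (t μ : ℝ) : ℕ :=
  Module.finrank ℂ (bandEigenspace γ hL ε t μ)

instance finiteDimensional_bandEigenspace (hL : 0 < L) (t μ : ℝ) :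
    FiniteDimensional ℂ (bandEigenspace γ hL ε t μ) := by
  rw [← eigenspace_eq]
  exact (isSymmetricPencil γ hL ε).finiteDimensional_eigenspace t μ

/-- The derivative of an eigenvalue of `A_t` is controlled by the eigenvalue. -/
lemma norm_deriv_le (hL : 0 < L) : ∃ K : ℝ, 0 ≤ K ∧ ∀ (t : ℝ) (lam : ℝ → ℝ) (w : ℝ → H2 γ L),
    DifferentiableAt ℝ lam t → ContinuousAt w t → w t ≠ 0 →
    (∀ᶠ s : ℝ in nhds t, -deltaXi γ hL s (w s) = (lam s : ℂ) • epsOp γ ε (w s)) →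
    ‖deriv lam t‖ ≤ K * ‖lam t‖ + K := by
  obtain ⟨c, hc, hbound⟩ := ε.sqrt.exists_le_norm_mulL
  have hP := isSymmetricPencil γ hL ε
  refine ⟨1 + 1 / c ^ 2, by positivity, fun t lam w hlam hw hw0 heq => ?_⟩
  have hmem : w t ∈ IsSymmetricPencil.eigenspace (fun ξ => -deltaXi γ hL ξ) (epsOp γ ε) t (lam t) :=
    IsSymmetricPencil.mem_eigenspace.2 heq.self_of_nhds
  have h1 := hP.inner_deriv hlam hw (by simpa using heq) hmem
  rw [hP.form', inner_self_eq_norm_sq_to_K, deriv_neg_deltaXi] at h1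
  set v := w t with hv
  set S := ‖epsOp γ ε.sqrt v‖ with hS
  have hSpos : 0 < S := norm_pos_iff.2 fun h0 => hw0 (hP.injective (h0.trans (map_zero _).symm))
  have hJS : c ^ 2 * ‖H2.incl γ L v‖ ^ 2 ≤ S ^ 2 := by
    rw [← mul_pow]
    exact pow_le_pow_left₀ (by positivity) (hbound _) 2
  have h2 : ⟪H2.incl γ L v, -deltaXi γ hL t v⟫_ℂ = (lam t * S ^ 2 : ℝ) := by
    have h3 : -deltaXi γ hL t v = (lam t : ℂ) • epsOp γ ε v := heq.self_of_nhds
    rw [h3, inner_smul_right, hP.form', inner_self_eq_norm_sq_to_K]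
    push_cast
    rfl
  -- For σ = ±1 the operator 1 - Δ_t + σ(-Δ_t)' has the symbol (1 + σ(2πl₁ + t))² + κ² ≥ 0. Its form
  -- at the eigenvector bounds ±λ' by λ and the ratio of ‖v‖² to ‖√ε v‖², which is at most 1/c².
  have h4 : ∀ σ : ℝ, σ ^ 2 = 1 →
      0 ≤ ‖H2.incl γ L v‖ ^ 2 + lam t * S ^ 2 + σ * (deriv lam t * S ^ 2) := by
    intro σ hσ
    have h5 : HasSymbol (H2.incl γ L + -deltaXi γ hL t
        + (σ : ℂ) • -((2 * Complex.I) • partialX γ hL - (2 * (t : ℂ)) • H2.incl γ L))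
        (fun l => (((1 + σ * (2 * Real.pi * l.1 + t)) ^ 2 + γ.kappa L l.2 ^ 2 : ℝ) : ℂ)) := by
      refine ((hasSymbol_incl.add (hasSymbol_deltaXi_real hL t).neg).add
        ((((hasSymbol_partialX hL).smul _).sub (hasSymbol_incl.smul _)).neg.smul _)).congr
        fun l => ?_
      have hσ' : (σ : ℂ) ^ 2 = 1 := by exact_mod_cast hσ
      push_cast
      linear_combination (-4 * σ * Real.pi * l.1) * Complex.I_sq
        - (2 * Real.pi * (l.1 : ℂ) + t) ^ 2 * hσ'
    have h6 := h5.re_inner_nonneg hL (fun l => by positivity) v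
    rw [add_apply, add_apply, smul_apply, inner_add_right, inner_add_right, inner_smul_right, h1,
      neg_apply, h2, inner_self_eq_norm_sq_to_K] at h6
    convert! h6 using 1
    simp only [Complex.coe_algebraMap]
    norm_cast
  have h7 := h4 1 (by norm_num)
  have h8 := h4 (-1) (by norm_num)
  have h9 : |deriv lam t| * S ^ 2 ≤ ‖H2.incl γ L v‖ ^ 2 + |lam t| * S ^ 2 := by
    have h10 : lam t * S ^ 2 ≤ |lam t| * S ^ 2 :=
      mul_le_mul_of_nonneg_right (le_abs_self _) (sq_nonneg _)
    rcases abs_cases (deriv lam t) with ⟨h, -⟩ | ⟨h, -⟩ <;> rw [h] <;> linarith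
  have h11 : ‖H2.incl γ L v‖ ^ 2 ≤ 1 / c ^ 2 * S ^ 2 := by
    rw [div_mul_eq_mul_div, le_div_iff₀ (by positivity)]
    linarith
  have h12 : |deriv lam t| * S ^ 2 ≤ (1 / c ^ 2 + |lam t|) * S ^ 2 := by linarith
  have h13 := le_of_mul_le_mul_right h12 (by positivity)
  rw [Real.norm_eq_abs, Real.norm_eq_abs]
  have : 0 ≤ 1 / c ^ 2 * |lam t| := by positivity
  nlinarith

/-- The operator `Δ_{π+iη} + μ ε` is injective for large `η`. -/
lemma exists_injective_pencil (γ : BoundaryCondition) (hL : 0 < L) (ε : Permittivity L) (μ : ℂ) :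
    ∃ ξ, ∀ u, pencil γ hL ε ξ μ u = 0 → u = 0 := by
  set M := ‖μ‖ * ‖ε.mulL‖ with hM
  have hM0 : 0 ≤ M := by positivity
  have hp := Real.pi_pos
  -- At ξ = π + iη the imaginary part of the symbol has modulus 2πη|2l₁ + 1|. The real part π makes
  -- the integer odd, hence nonzero, and this η makes the modulus at least M + 1, more than the
  -- bound M for multiplication by με.
  let η : ℝ := (M + 1) / (2 * Real.pi)
  have hη : 0 < η := by positivity
  have hη' : 2 * Real.pi * η = M + 1 := by simp only [η]; field_simp
  let ξ : ℂ := Real.pi + η * Complex.I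
  refine ⟨ξ, fun u hu => ?_⟩
  have h1 : ‖H2.incl γ L u‖ ≤ (1 / (M + 1)) * ‖deltaXi γ hL ξ u‖ := by
    refine hasSymbol_incl.norm_le hL (hasSymbol_deltaXi hL ξ) (by positivity) fun l _ => ?_
    rw [norm_one, div_mul_eq_mul_div, one_mul, le_div_iff₀ (by positivity), one_mul, norm_neg]
    refine le_trans ?_ (Complex.abs_im_le_norm _)
    have h2 : ((2 * Real.pi * l.1 + ξ) ^ 2 + (γ.kappa L l.2 : ℂ) ^ 2).im
        = 2 * Real.pi * η * (2 * l.1 + 1) := by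
      simp [ξ, pow_two]
      ring
    rw [h2, hη', abs_mul, abs_of_pos (by positivity)]
    refine le_mul_of_one_le_right (by positivity) ?_
    have h3 : (1 : ℤ) ≤ |2 * l.1 + 1| := Int.one_le_abs (by omega)
    exact_mod_cast h3
  have h2 : deltaXi γ hL ξ u = -(μ • ε.mulL (H2.incl γ L u)) := eq_neg_of_add_eq_zero_left hu
  have h3 : ‖deltaXi γ hL ξ u‖ ≤ M * ‖H2.incl γ L u‖ := by
    rw [h2, norm_neg, norm_smul, hM, mul_assoc]
    exact mul_le_mul_of_nonneg_left (ε.mulL.le_opNorm _) (norm_nonneg _)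
  rw [div_mul_eq_mul_div, one_mul, le_div_iff₀ (by positivity)] at h1
  have h4 : ‖H2.incl γ L u‖ ≤ 0 := by linarith
  exact incl_injective ((norm_le_zero_iff.1 h4).trans (map_zero _).symm)

/-- The multiplicities of the root functions of `Δ_ξ + μ ε` at a given point are bounded. -/
lemma exists_multiplicity_le (hL : 0 < L) (μ ξ₀ : ℂ) :
    ∃ n : ℕ, ∀ u, IsRootFunction (fun ξ => pencil γ hL ε ξ μ) ξ₀ u →
      OperatorFamily.multiplicity (fun ξ => pencil γ hL ε ξ μ) ξ₀ u ≤ n := by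
  classical
  obtain ⟨ξ₁, hξ₁⟩ := exists_injective_pencil γ hL ε μ
  obtain ⟨s, hs⟩ := exists_norm_pencilRemainder_lt (γ := γ) ε hL (max ‖ξ₀‖ ‖ξ₁‖) μ
  obtain ⟨n, hn⟩ := exists_analyticOrderAt_le (U := Metric.closedBall 0 (max ‖ξ₀‖ ‖ξ₁‖))
    (convex_closedBall _ _).isPreconnected
    (fun ξ _ => analyticAt_pencilRemainder ε hL μ ξ)
    (fun ξ hξ => hs ξ (by simpa using hξ))
    ⟨ξ₁, by simp, fun f hf => by
      have h1 := pencil_apply ε hL ξ₁ μ ((weightEquiv γ hL).symm f)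
      rw [LinearIsometryEquiv.apply_symm_apply, hf, neg_zero] at h1
      simpa using hξ₁ _ h1⟩ (ξ₀ := ξ₀) (by simp)
  -- Up to sign the pencil is (1 - K)Q with Q independent of ξ, so u and Qu give zeros of the same
  -- order.
  refine ⟨n, fun u hu => ?_⟩
  have h1 := hn (fun ξ => weightEquiv γ hL (u ξ))
    (((weightEquiv γ hL).toContinuousLinearEquiv.analyticAt _).comp hu.1)
    (fun h => hu.2.1 ((weightEquiv γ hL).injective (h.trans (map_zero _).symm)))
  have h2 : (fun ξ => pencil γ hL ε ξ μ (u ξ)) = -fun ξ => weightEquiv γ hL (u ξ)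
      - pencilRemainder γ hL ε ξ μ (weightEquiv γ hL (u ξ)) := by
    funext ξ
    exact pencil_apply ε hL ξ μ (u ξ)
  rw [OperatorFamily.multiplicity, h2, analyticOrderAt_neg]
  exact h1

end Waveguide

/-! ### Infinitely many eigenvalues and the existence of an arrangement -/

namespace Waveguide

open BoundaryCondition OperatorFamily
open scoped ComplexConjugate InnerProductSpace

variable {γ : BoundaryCondition} {L : ℝ} (ε : Permittivity L)

/-- Truncation to finitely many Fourier modes approximates the operator in norm by operators of
finite rank. -/
lemma isCompactOperator_incl_symm (γ : BoundaryCondition) (hL : 0 < L) :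
    IsCompactOperator (H2.incl γ L ∘L
      ((weightEquiv γ hL).symm.toContinuousLinearEquiv : L2 L →L[ℂ] H2 γ L)) := by
  set R := H2.incl γ L ∘L ((weightEquiv γ hL).symm.toContinuousLinearEquiv : L2 L →L[ℂ] H2 γ L)
    with hR
  have h1 : R ∈ closure {T : L2 L →L[ℂ] L2 L | IsCompactOperator T} := by
    refine Metric.mem_closure_iff.2 fun δ hδ => ?_
    obtain ⟨s, hs⟩ := exists_truncation γ hL (half_pos hδ)
    refine ⟨R * truncation γ L s, ?_, ?_⟩
    · have h2 : R * truncation γ L s ∈ compactOperator (RingHom.id ℂ) (L2 L) (L2 L) := by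
        have h3 : R * truncation γ L s
            = ∑ l : s, (innerSL ℂ (phi γ L l)).smulRight (R (phi γ L l)) := by
          ext1 f
          rw [mul_apply_eq_comp, truncation, finiteRank_apply, map_sum]
          simp
        rw [h3]
        refine Submodule.sum_mem _ fun l _ => ?_
        have h4 : IsCompactOperator (ContinuousLinearMap.toSpanSingleton ℂ (R (phi γ L l))) :=
          isCompactOperator_of_locallyCompactSpace_rng _
        exact h4.comp_clm (innerSL ℂ (phi γ L (l : Index γ)))
      exact h2
    · rw [dist_eq_norm]
      refine (ContinuousLinearMap.opNorm_le_bound _ (half_pos hδ).le fun f => ?_).trans_lt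
        (half_lt_self hδ)
      have h2 := (hs f).1
      rw [sub_apply, mul_apply_eq_comp, ← map_sub]
      exact h2
  rwa [isClosed_setOfPred_isCompactOperator.closure_eq] at h1

lemma infinite_index (γ : BoundaryCondition) : Infinite (Index γ) := by
  have h : Nonempty γ.index := by
    cases γ <;> exact ⟨⟨1, by simp [index]⟩⟩
  exact Prod.infinite_of_left

/-- The operator `A_0` has infinitely many eigenvalues. -/
lemma infinite_eigenvalues (γ : BoundaryCondition) (hL : 0 < L) (ε : Permittivity L) :
    {μ : ℝ | bandMult γ hL ε 0 μ ≠ 0}.Infinite := by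
  have := completeSpace_H2 γ hL
  have hP := isSymmetricPencil γ hL ε
  set A : ℂ → H2 γ L →L[ℂ] L2 L := fun ξ => -deltaXi γ hL ξ with hA
  set S := epsOp γ ε.sqrt with hS
  -- The spectral parameter -1 is not an eigenvalue because A_0 is nonnegative and C positive.
  have hinj : Function.Injective (A (0 : ℝ) - ((-1 : ℝ) : ℂ) • epsOp γ ε) := by
    refine (injective_iff_map_eq_zero _).2 fun u hu => ?_
    have h1 : (⟪H2.incl γ L u, A (0 : ℝ) u⟫_ℂ).re + ‖S u‖ ^ 2 = 0 := by
      have h2 := congrArg (fun f => (⟪H2.incl γ L u, f⟫_ℂ).re) hu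
      simp only [sub_apply, smul_apply, inner_sub_right, inner_smul_right, hP.form',
        inner_self_eq_norm_sq_to_K, inner_zero_right, Complex.zero_re] at h2
      convert! h2 using 1
      have h3 : (((‖S u‖ : ℝ) : ℂ) ^ 2).re = ‖S u‖ ^ 2 := by norm_cast
      rw [Complex.sub_re, Complex.re_ofReal_mul]
      change _ = _ - -1 * (((‖S u‖ : ℝ) : ℂ) ^ 2).re
      rw [h3]
      ring
    have h2 : 0 ≤ (⟪H2.incl γ L u, A (0 : ℝ) u⟫_ℂ).re := by
      refine HasSymbol.re_inner_nonneg hL ((hasSymbol_deltaXi_real hL 0).neg.congr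
        (n := fun l => (((2 * Real.pi * l.1 + 0) ^ 2 + γ.kappa L l.2 ^ 2 : ℝ) : ℂ)) fun l => ?_)
        (fun l => by positivity) u
      push_cast; ring
    have h3 : ‖S u‖ ^ 2 = 0 := by nlinarith [sq_nonneg ‖S u‖]
    exact hP.injective ((norm_eq_zero.1 (pow_eq_zero_iff two_ne_zero |>.1 h3)).trans
      (map_zero _).symm)
  obtain ⟨Ψ, hΨ⟩ := (hP.fredholm 0 (-1)).exists_equiv hinj
  have hΨsymm : ∀ u v, ⟪Ψ u, H2.incl γ L v⟫_ℂ = ⟪H2.incl γ L u, Ψ v⟫_ℂ := fun u v => by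
    rw [hΨ, hΨ]; exact hP.symm_sub 0 (-1) u v
  -- The resolvent at -1, symmetrized by √ε, is compact and self-adjoint, so its eigenspaces span a
  -- dense subspace. They are images of eigenspaces of the pencil; with finitely many eigenvalues
  -- this span would be finite-dimensional and L² too.
  let T : L2 L →L[ℂ] L2 L := S ∘L (Ψ.symm : L2 L →L[ℂ] H2 γ L) ∘L ε.sqrt.mulL
  have hT : ∀ f, T f = S (Ψ.symm (ε.sqrt.mulL f)) := fun _ => rfl
  have hTsymm : T.IsSymmetric := by
    intro f g
    change ⟪T f, g⟫_ℂ = ⟪f, T g⟫_ℂ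
    have h1 := hΨsymm (Ψ.symm (ε.sqrt.mulL f)) (Ψ.symm (ε.sqrt.mulL g))
    rw [Ψ.apply_symm_apply, Ψ.apply_symm_apply] at h1
    rw [hT, hT]
    change ⟪ε.sqrt.mulL _, g⟫_ℂ = ⟪f, ε.sqrt.mulL _⟫_ℂ
    rw [ε.sqrt.inner_mulL, ← ε.sqrt.inner_mulL f]
    exact h1.symm
  have hTcomp : IsCompactOperator T := by
    have h1 := ((isCompactOperator_incl_symm γ hL).comp_clm
      (((weightEquiv γ hL).toContinuousLinearEquiv : H2 γ L →L[ℂ] L2 L) ∘L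
        (Ψ.symm : L2 L →L[ℂ] H2 γ L) ∘L ε.sqrt.mulL)).clm_comp ε.sqrt.mulL
    convert! h1 using 1
    funext f
    simp [T, hS, epsOp]
  intro hfin
  have hspec := ContinuousLinearMap.orthogonalComplement_iSup_eigenspaces_eq_bot hTcomp hTsymm
  let F := {μ : ℝ | bandMult γ hL ε 0 μ ≠ 0}
  have : Finite F := hfin
  let V : Submodule ℂ (L2 L) := ⨆ μ : F, (bandEigenspace γ hL ε 0 μ).map (S : H2 γ L →ₗ[ℂ] L2 L)
  have hV : FiniteDimensional ℂ V := Submodule.finiteDimensional_iSup _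
  have hle : (⨆ μ, Module.End.eigenspace (T : Module.End ℂ (L2 L)) μ) ≤ V := by
    refine iSup_le fun τ f hf => ?_
    by_cases hf0 : f = 0
    · rw [hf0]; exact V.zero_mem
    have hfT : T f = τ • f := Module.End.mem_eigenspace_iff.1 hf
    have hτ : (conj τ) = τ := hTsymm.conj_eigenvalue_eq_self
      (Module.End.hasEigenvalue_of_hasEigenvector ⟨hf, hf0⟩)
    set u := Ψ.symm (ε.sqrt.mulL f) with hu
    have hSu : S u = τ • f := by rw [← hfT, hT]
    have hu0 : u ≠ 0 := by
      intro h0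
      have h1 : ε.sqrt.mulL f = 0 := by
        rw [← Ψ.apply_symm_apply (ε.sqrt.mulL f), ← hu, h0, map_zero]
      exact hf0 (ε.sqrt.mulL_injective (h1.trans (map_zero _).symm))
    have hτ0 : τ ≠ 0 := by
      rintro rfl
      rw [zero_smul] at hSu
      exact hu0 (hP.injective (hSu.trans (map_zero _).symm))
    obtain ⟨r, rfl⟩ := Complex.conj_eq_iff_real.1 hτ
    have hf1 : f = ((r : ℂ)⁻¹) • S u := by rw [hSu, inv_smul_smul₀ hτ0]
    -- From Su = r f and Ψu = √ε f follows (A_0 + C)u = r⁻¹ C u; the shift by C accounts for the -1.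
    have hmem : u ∈ bandEigenspace γ hL ε 0 (r⁻¹ - 1) := by
      rw [← eigenspace_eq, IsSymmetricPencil.mem_eigenspace]
      have h1 : Ψ u = ε.sqrt.mulL f := Ψ.apply_symm_apply _
      have h2 : ε.sqrt.mulL (S u) = epsOp γ ε u := ε.mulL_sqrt_sqrt _
      rw [hf1, map_smul, h2, hΨ] at h1
      simp only [sub_apply, smul_apply] at h1
      rw [sub_eq_iff_eq_add] at h1
      change A (0 : ℝ) u = _
      rw [h1]
      push_cast
      module
    have hmult : bandMult γ hL ε 0 (r⁻¹ - 1) ≠ 0 := by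
      have h1 : Nontrivial (bandEigenspace γ hL ε 0 (r⁻¹ - 1)) :=
        ⟨⟨u, hmem⟩, 0, fun h => hu0 (congrArg Subtype.val h)⟩
      exact (Module.finrank_pos (R := ℂ) (M := bandEigenspace γ hL ε 0 (r⁻¹ - 1))).ne'
    have h3 : S u ∈ V := by
      refine Submodule.mem_iSup_of_mem (⟨r⁻¹ - 1, hmult⟩ : F) ?_
      exact Submodule.mem_map_of_mem hmem
    rw [hf1]
    exact V.smul_mem _ h3
  have hVbot : Vᗮ = ⊥ := by
    rw [eq_bot_iff, ← hspec]
    exact Submodule.orthogonal_le hle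
  have hVtop : V = ⊤ := Submodule.orthogonal_eq_bot_iff.1 hVbot
  rw [hVtop] at hV
  have hfd : FiniteDimensional ℂ (L2 L) := Module.Finite.equiv (Submodule.topEquiv (R := ℂ))
  have h1 := LinearIndependent.finite (orthonormal_phi γ hL).linearIndependent
  exact (infinite_index γ).not_finite h1

lemma finrank_eigenspace (hL : 0 < L) (t μ : ℝ) :
    Module.finrank ℂ (IsSymmetricPencil.eigenspace (fun ξ => -deltaXi γ hL ξ) (epsOp γ ε) t μ)
      = bandMult γ hL ε t μ := by
  rw [eigenspace_eq, bandMult]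

open Filter Topology in
/-- The eigenvalues of `A_t` lie on analytic branches. -/
lemma hasAnalyticBranches (γ : BoundaryCondition) (hL : 0 < L) (ε : Permittivity L) :
    HasAnalyticBranches (bandMult γ hL ε) := by
  have := completeSpace_H2 γ hL
  have hP := isSymmetricPencil γ hL ε
  constructor
  · intro t₀ μ₀
    obtain ⟨κ, _, lam, w, h1, h2, -, -, -, -, h3⟩ := hP.exists_local_eigenbasis t₀ μ₀
    exact ⟨κ, inferInstance, lam, h1, h2, h3.mono fun p hp => (finrank_eigenspace ε hL _ _).symm.trans hp⟩
  · obtain ⟨K, hK, hbound⟩ := norm_deriv_le (γ := γ) ε hL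
    refine ⟨K, hK, fun t f hf hm => ?_⟩
    obtain ⟨κ, _, lam, w, h1, h2, h3, h4, h5, h6, h7⟩ := hP.exists_local_eigenbasis t (f t)
    obtain ⟨i, hi⟩ := HasAnalyticBranches.exists_eventuallyEq (mult := bandMult γ hL ε) h1 hf
      (h7.mono fun p hp => (finrank_eigenspace ε hL _ _).symm.trans hp)
      (hm.filter_mono nhdsWithin_le_nhds).frequently
    have h8 := hbound t (lam i) (w i) (h1 i).differentiableAt (h3 i) (h4.ne_zero i)
      (h6.mono fun s hs => hs i)
    rwa [hi.deriv_eq, hi.eq_of_nhds] at h8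

/-- An analytic arrangement of the eigenvalues exists. -/
theorem exists_isAnalyticArrangement (γ : BoundaryCondition) (hL : 0 < L) (ε : Permittivity L) :
    ∃ lam : ℕ → ℝ → ℝ, IsAnalyticArrangement γ hL ε lam := by
  obtain ⟨lam, h1, h2⟩ :=
    (hasAnalyticBranches γ hL ε).exists_enumeration (infinite_eigenvalues γ hL ε)
  refine ⟨lam, fun m => (h1 m).mono (subset_univ _), fun α _ μ => ?_⟩
  obtain ⟨e⟩ := h2 α μ
  rw [Cardinal.mk_congr e, Cardinal.mk_fin, bandMult, Module.finrank_eq_rank]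

end Waveguide

/-! ### Root functions, canonical systems, and germs of an enumeration -/

namespace OperatorFamily

open Filter Topology

section Roots

variable {E F : Type*} [NormedAddCommGroup E] [NormedSpace ℂ E]
  [NormedAddCommGroup F] [NormedSpace ℂ F] {B : ℂ → E →L[ℂ] F} {ξ₀ : ℂ}

lemma hasDerivAt_root (hB : AnalyticAt ℂ B ξ₀) {u : ℂ → E} (hu : AnalyticAt ℂ u ξ₀) :
    HasDerivAt (fun ξ => B ξ (u ξ)) (B ξ₀ (deriv u ξ₀) + deriv B ξ₀ (u ξ₀)) ξ₀ := by
  rw [add_comm]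
  exact hB.differentiableAt.hasDerivAt.clm_apply hu.differentiableAt.hasDerivAt

/-- There is a root function of multiplicity at least `2` with a given value at `ξ₀` if and only
if there is a generalized eigenvector. -/
lemma exists_two_le_multiplicity_iff [CompleteSpace F] (hB : AnalyticAt ℂ B ξ₀) (u₀ : E) :
    (∃ u, IsRootFunction B ξ₀ u ∧ u ξ₀ = u₀ ∧ 2 ≤ multiplicity B ξ₀ u) ↔
      u₀ ≠ 0 ∧ B ξ₀ u₀ = 0 ∧ ∃ u₁, B ξ₀ u₁ + deriv B ξ₀ u₀ = 0 := by
  have key : ∀ u : ℂ → E, AnalyticAt ℂ u ξ₀ → (2 ≤ multiplicity B ξ₀ u ↔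
      B ξ₀ (u ξ₀) = 0 ∧ B ξ₀ (deriv u ξ₀) + deriv B ξ₀ (u ξ₀) = 0) := by
    intro u hu
    have h1 := natCast_le_analyticOrderAt_iff_iteratedDeriv_eq_zero (n := 2)
      (analyticAt_apply hB hu)
    rw [multiplicity]
    refine h1.trans ⟨fun h => ⟨by simpa using h 0 (by norm_num), ?_⟩, fun h i hi => ?_⟩
    · have h2 := h 1 (by norm_num)
      rwa [iteratedDeriv_one, (hasDerivAt_root hB hu).deriv] at h2
    · interval_cases i
      · simpa using h.1
      · rw [iteratedDeriv_one, (hasDerivAt_root hB hu).deriv]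
        exact h.2
  constructor
  · rintro ⟨u, hu, rfl, h⟩
    obtain ⟨h1, h2⟩ := (key u hu.1).1 h
    exact ⟨hu.2.1, h1, _, h2⟩
  · rintro ⟨h0, h1, u₁, h2⟩
    -- An affine root function suffices, since order at least 2 depends only on the value and the
    -- first derivative of u.
    have hd : HasDerivAt (fun ξ : ℂ => u₀ + (ξ - ξ₀) • u₁) u₁ ξ₀ := by
      simpa using (((hasDerivAt_id ξ₀).sub_const ξ₀).smul_const u₁).const_add u₀
    have ha : AnalyticAt ℂ (fun ξ : ℂ => u₀ + (ξ - ξ₀) • u₁) ξ₀ :=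
      analyticAt_const.add ((analyticAt_id.sub analyticAt_const).smul analyticAt_const)
    refine ⟨fun ξ => u₀ + (ξ - ξ₀) • u₁, ⟨ha, by simpa using h0, by simpa using h1⟩, by simp, ?_⟩
    rw [key _ ha, hd.deriv]
    simpa using ⟨h1, h2⟩

lemma isEigenvector_iff {w : E} : IsEigenvector B ξ₀ w ↔ w ≠ 0 ∧ B ξ₀ w = 0 := by
  constructor
  · rintro ⟨u, hu, rfl⟩
    exact hu.2
  · intro h
    exact ⟨fun _ => w, ⟨analyticAt_const, h⟩, rfl⟩

lemma rank_le {n : ℕ∞} (hn : ∀ u, IsRootFunction B ξ₀ u → multiplicity B ξ₀ u ≤ n) (w : E) :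
    rank B ξ₀ w ≤ n :=
  sSup_le fun _ ⟨u, hu, _, hr⟩ => hr ▸ hn u hu

lemma one_lt_rank_iff [CompleteSpace F] (hB : AnalyticAt ℂ B ξ₀) (w : E) :
    1 < rank B ξ₀ w ↔ w ≠ 0 ∧ B ξ₀ w = 0 ∧ ∃ u₁, B ξ₀ u₁ + deriv B ξ₀ w = 0 := by
  rw [← exists_two_le_multiplicity_iff hB, rank, lt_sSup_iff]
  have h1 : ∀ a : ℕ∞, 1 < a ↔ 2 ≤ a := fun a => by
    rw [← ENat.add_one_le_iff ENat.one_ne_top, one_add_one_eq_two]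
  constructor
  · rintro ⟨_, ⟨u, hu, hw, rfl⟩, h⟩
    exact ⟨u, hu, hw, (h1 _).1 h⟩
  · rintro ⟨u, hu, hw, h⟩
    exact ⟨_, ⟨u, hu, hw, rfl⟩, (h1 _).2 h⟩

/-- Among the nonzero elements of a nonzero subspace there is one of maximal rank, if the ranks
are bounded. -/
lemma exists_max_rank {n : ℕ} (hn : ∀ u, IsRootFunction B ξ₀ u → multiplicity B ξ₀ u ≤ n)
    {C : Submodule ℂ E} (hC : C ≤ LinearMap.ker (B ξ₀ : E →ₗ[ℂ] F)) (hC0 : C ≠ ⊥) :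
    ∃ w ∈ C, w ≠ 0 ∧ IsGreatest {r | ∃ w ∈ C, IsEigenvector B ξ₀ w ∧ rank B ξ₀ w = r}
      (rank B ξ₀ w) := by
  let s : Set ℕ∞ := {r | ∃ w ∈ C, IsEigenvector B ξ₀ w ∧ rank B ξ₀ w = r}
  have hs : s ⊆ (fun k : ℕ => (k : ℕ∞)) '' Iic n := by
    rintro _ ⟨w, -, -, rfl⟩
    have h1 := rank_le hn w
    obtain ⟨k, hk⟩ := ENat.ne_top_iff_exists.1 (ne_top_of_le_ne_top (ENat.natCast_ne_top n) h1)
    rw [← hk] at h1 ⊢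
    exact ⟨k, by exact_mod_cast h1, rfl⟩
  have hfin : s.Finite := ((finite_Iic n).image _).subset hs
  obtain ⟨w, hw, hw0⟩ := (Submodule.ne_bot_iff C).1 hC0
  have hne : s.Nonempty := ⟨_, w, hw, isEigenvector_iff.2 ⟨hw0, hC hw⟩, rfl⟩
  have hmax := hne.csSup_mem hfin
  have hg : IsGreatest s (sSup s) := ⟨hmax, fun r hr => le_sSup hr⟩
  obtain ⟨w', hw', he, hr⟩ := hmax
  exact ⟨w', hw', (isEigenvector_iff.1 he).1, hr ▸ hg⟩

/-- The greedy construction of a canonical system of eigenvectors. -/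
lemma exists_isCanonicalSystem_aux {n : ℕ}
    (hn : ∀ u, IsRootFunction B ξ₀ u → multiplicity B ξ₀ u ≤ n)
    (k : ℕ)
    (hk : k ≤ Module.finrank ℂ (LinearMap.ker (B ξ₀ : E →ₗ[ℂ] F))) :
    ∃ v : Fin k → E, LinearIndependent ℂ v ∧
      Submodule.span ℂ (range v) ≤ LinearMap.ker (B ξ₀ : E →ₗ[ℂ] F) ∧
      ∀ j : Fin k, ∃ C : Submodule ℂ E, Disjoint (Submodule.span ℂ (v '' Iio j)) C ∧
        Submodule.span ℂ (v '' Iio j) ⊔ C = LinearMap.ker (B ξ₀ : E →ₗ[ℂ] F) ∧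
        IsGreatest {r | ∃ w ∈ C, IsEigenvector B ξ₀ w ∧ rank B ξ₀ w = r} (rank B ξ₀ (v j)) := by
  induction k with
  | zero =>
    exact ⟨Fin.elim0, linearIndependent_empty_type, by simp, fun j => j.elim0⟩
  | succ k ih =>
    obtain ⟨v, hv, hle, hC⟩ := ih (by omega)
    set K := LinearMap.ker (B ξ₀ : E →ₗ[ℂ] F) with hK
    set W := Submodule.span ℂ (range v) with hW
    obtain ⟨C', hC'⟩ := exists_isCompl W
    have hdis : Disjoint W (C' ⊓ K) := hC'.disjoint.mono_right inf_le_left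
    -- By the modular law the trace on the kernel of a complement of W in E is a complement of W in
    -- the kernel.
    have hsup : W ⊔ C' ⊓ K = K := by
      rw [← sup_inf_assoc_of_le C' hle, hC'.sup_eq_top, top_inf_eq]
    have hne : C' ⊓ K ≠ ⊥ := by
      intro h0
      rw [h0, sup_bot_eq] at hsup
      have h1 := finrank_span_eq_card hv
      rw [Fintype.card_fin, ← hW, hsup] at h1
      omega
    obtain ⟨w, hwC, hw0, hmax⟩ := exists_max_rank hn inf_le_right hne
    have himage : ∀ j : Fin k, (Fin.snoc v w : Fin (k + 1) → E) '' Iio j.castSucc = v '' Iio j := by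
      intro j
      ext x
      constructor
      · rintro ⟨i, hi, rfl⟩
        have hi' : i < j.castSucc := hi
        obtain ⟨i, rfl⟩ := Fin.exists_castSucc_eq.2 (ne_of_lt (hi'.trans (Fin.castSucc_lt_last j)))
        exact ⟨i, hi', by rw [Fin.snoc_castSucc]⟩
      · rintro ⟨i, hi, rfl⟩
        have hi' : i < j := hi
        exact ⟨i.castSucc, Fin.castSucc_lt_castSucc_iff.2 hi', by rw [Fin.snoc_castSucc]⟩
    have hlast : (Fin.snoc v w : Fin (k + 1) → E) '' Iio (Fin.last k) = range v := by
      ext x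
      constructor
      · rintro ⟨i, hi, rfl⟩
        have hi' : i < Fin.last k := hi
        obtain ⟨i, rfl⟩ := Fin.exists_castSucc_eq.2 hi'.ne
        exact ⟨i, by rw [Fin.snoc_castSucc]⟩
      · rintro ⟨i, rfl⟩
        exact ⟨i.castSucc, Fin.castSucc_lt_last i, by rw [Fin.snoc_castSucc]⟩
    refine ⟨Fin.snoc v w, ?_, ?_, fun j => ?_⟩
    · exact linearIndependent_finSnoc.2 ⟨hv, fun h => hw0 ((Submodule.disjoint_def.1 hdis) w h hwC)⟩
    · rw [Submodule.span_le]
      rintro _ ⟨i, rfl⟩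
      induction i using Fin.lastCases with
      | last => rw [Fin.snoc_last]; exact hwC.2
      | cast i => rw [Fin.snoc_castSucc]; exact hle (Submodule.subset_span ⟨i, rfl⟩)
    · induction j using Fin.lastCases with
      | last => exact ⟨C' ⊓ K, by rwa [hlast], by rwa [hlast], by rwa [Fin.snoc_last]⟩
      | cast j =>
        rw [himage, Fin.snoc_castSucc]
        exact hC j

lemma exists_isCanonicalSystem {n : ℕ}
    (hn : ∀ u, IsRootFunction B ξ₀ u → multiplicity B ξ₀ u ≤ n)
    (hfin : FiniteDimensional ℂ (LinearMap.ker (B ξ₀ : E →ₗ[ℂ] F))) :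
    ∃ v : Fin (Module.finrank ℂ (LinearMap.ker (B ξ₀ : E →ₗ[ℂ] F))) → E,
      IsCanonicalSystem B ξ₀ v := by
  obtain ⟨v, hv, hle, hC⟩ := exists_isCanonicalSystem_aux hn _ le_rfl
  refine ⟨v, hv, Submodule.eq_of_le_of_finrank_eq hle ?_, hC⟩
  rw [finrank_span_eq_card hv, Fintype.card_fin]

/-- A characteristic value has a partial null multiplicity greater than `1` if and only if there is
a generalized eigenvector. -/
theorem exists_one_lt_isPartialNullMultiplicity_iff [CompleteSpace F] (hB : AnalyticAt ℂ B ξ₀)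
    (hn : ∃ n : ℕ, ∀ u, IsRootFunction B ξ₀ u → multiplicity B ξ₀ u ≤ n)
    (hfin : FiniteDimensional ℂ (LinearMap.ker (B ξ₀ : E →ₗ[ℂ] F))) :
    (IsCharacteristicValue B ξ₀ ∧ ∃ r : ℕ, 1 < r ∧ IsPartialNullMultiplicity B ξ₀ r) ↔
      ∃ u₀ u₁ : E, u₀ ≠ 0 ∧ B ξ₀ u₀ = 0 ∧ B ξ₀ u₁ + deriv B ξ₀ u₀ = 0 := by
  constructor
  · rintro ⟨-, r, hr, α, v, -, j, hj⟩
    have h1 : 1 < rank B ξ₀ (v j) := by rw [hj]; exact_mod_cast hr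
    obtain ⟨h2, h3, u₁, h4⟩ := (one_lt_rank_iff hB _).1 h1
    exact ⟨_, u₁, h2, h3, h4⟩
  · rintro ⟨u₀, u₁, h0, h1, h2⟩
    obtain ⟨n, hn⟩ := hn
    refine ⟨⟨fun _ => u₀, analyticAt_const, h0, h1⟩, ?_⟩
    obtain ⟨v, hv⟩ := exists_isCanonicalSystem hn hfin
    have hmem : u₀ ∈ LinearMap.ker (B ξ₀ : E →ₗ[ℂ] F) := h1
    have hpos : 0 < Module.finrank ℂ (LinearMap.ker (B ξ₀ : E →ₗ[ℂ] F)) := by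
      have : Nontrivial (LinearMap.ker (B ξ₀ : E →ₗ[ℂ] F)) :=
        ⟨⟨u₀, hmem⟩, 0, fun h => h0 (congrArg Subtype.val h)⟩
      exact Module.finrank_pos
    -- Nothing precedes the first vector, so its complement is the whole kernel and its rank
    -- dominates that of u₀.
    obtain ⟨C, -, hC, hmax⟩ := hv.2.2 ⟨0, hpos⟩
    have hempty : v '' Iio ⟨0, hpos⟩ = ∅ := by
      rw [image_eq_empty]
      ext i
      simp [Fin.lt_def]
    rw [hempty, Submodule.span_empty, bot_sup_eq] at hC
    have hle : rank B ξ₀ u₀ ≤ rank B ξ₀ (v ⟨0, hpos⟩) :=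
      hmax.2 ⟨u₀, hC ▸ hmem, isEigenvector_iff.2 ⟨h0, h1⟩, rfl⟩
    have h3 : 1 < rank B ξ₀ (v ⟨0, hpos⟩) :=
      ((one_lt_rank_iff hB u₀).2 ⟨h0, h1, u₁, h2⟩).trans_le hle
    obtain ⟨r, hr⟩ := ENat.ne_top_iff_exists.1
      (ne_top_of_le_ne_top (ENat.natCast_ne_top n) (rank_le hn (v ⟨0, hpos⟩)))
    rw [← hr] at h3
    exact ⟨r, by exact_mod_cast h3, _, v, hv, _, hr.symm⟩

end Roots

section Branches

lemma eventually_imp_eventuallyEq {f g : ℝ → ℝ} {s : ℝ} (hf : AnalyticAt ℝ f s)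
    (hg : AnalyticAt ℝ g s) : ∀ᶠ t in 𝓝[≠] s, f t = g t → f =ᶠ[𝓝 s] g := by
  by_cases h : f =ᶠ[𝓝 s] g
  · exact Eventually.of_forall fun _ _ => h
  · have h1 : ¬ ∃ᶠ t in 𝓝[≠] s, f t = g t := fun h2 =>
      h ((hf.frequently_eq_iff_eventually_eq hg).1 h2)
    rw [not_frequently] at h1
    exact h1.mono fun t ht hc => (ht hc).elim

/-- An enumeration of the analytic branches to the right of `s` has the same germs at `s` as
the local branches. -/
lemma exists_deriv_eq_zero_iff_of_enumeration {mult : ℝ → ℝ → ℕ} {s μ₀ : ℝ} {κ : Type}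
    [Fintype κ] {f : κ → ℝ → ℝ} (hf : ∀ i, AnalyticAt ℝ (f i) s) (hf0 : ∀ i, f i s = μ₀)
    (hcount : ∀ᶠ p : ℝ × ℝ in 𝓝 (s, μ₀), mult p.1 p.2 = Nat.card {i // f i p.1 = p.2})
    {lam : ℕ → ℝ → ℝ} (hlam : ∀ m, AnalyticAt ℝ (lam m) s)
    (henum : ∀ᶠ t in 𝓝[≥] s, ∀ μ, Nonempty ({m // lam m t = μ} ≃ Fin (mult t μ))) :
    (∃ m, lam m s = μ₀ ∧ deriv (lam m) s = 0) ↔ ∃ i, deriv (f i) s = 0 := by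
  classical
  have hgt : ∀ᶠ t in 𝓝[>] s, ∀ μ, Nonempty ({m // lam m t = μ} ≃ Fin (mult t μ)) :=
    henum.filter_mono (nhdsWithin_mono _ Ioi_subset_Ici_self)
  have hne : 𝓝[>] s ≤ 𝓝[≠] s := nhdsWithin_mono _ fun t ht => (ne_of_gt ht)
  have hgerm : ∀ m, lam m s = μ₀ → ∃ i, f i =ᶠ[𝓝 s] lam m := by
    intro m hm
    refine HasAnalyticBranches.exists_eventuallyEq (mult := mult) hf (hlam m) (by rwa [hm]) ?_
    refine Frequently.filter_mono ?_ hne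
    refine (hgt.mono fun t ht => ?_).frequently
    obtain ⟨e⟩ := ht (lam m t)
    intro h0
    rw [h0] at e
    exact (e ⟨m, rfl⟩).elim0
  constructor
  · rintro ⟨m, hm, hd⟩
    obtain ⟨i, hi⟩ := hgerm m hm
    exact ⟨i, by rw [hi.deriv_eq, hd]⟩
  · rintro ⟨i₀, hd⟩
    obtain ⟨e⟩ := henum.self_of_nhdsWithin self_mem_Ici μ₀
    -- Only the finitely many members through (s, μ₀) are followed, as many as there are local
    -- branches. The remaining members cannot be controlled uniformly and enter only through the
    -- multiplicity.
    let M := {m // lam m s = μ₀}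
    have : Fintype M := Fintype.ofEquiv _ e.symm
    have hcard : Fintype.card M = Fintype.card κ := by
      rw [Fintype.card_congr e, Fintype.card_fin, hcount.self_of_nhds]
      simp only [hf0]
      simp
    have h1 : ∀ᶠ t in 𝓝[>] s, ∀ m : M, lam m t = f i₀ t → lam m =ᶠ[𝓝 s] f i₀ :=
      (eventually_all.2 fun m : M =>
        eventually_imp_eventuallyEq (hlam m) (hf i₀)).filter_mono hne
    have h2 : ∀ᶠ t in 𝓝[>] s, ∀ m : M, ∃ i, f i t = lam m t := by
      refine eventually_all.2 fun m => ?_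
      obtain ⟨i, hi⟩ := hgerm m m.2
      exact (hi.filter_mono nhdsWithin_le_nhds).mono fun t ht => ⟨i, ht⟩
    have h3 : ∀ᶠ t in 𝓝[>] s, ∀ i, mult t (f i t) = Nat.card {j // f j t = f i t} := by
      refine eventually_all.2 fun i => Eventually.filter_mono nhdsWithin_le_nhds ?_
      have h4 : Tendsto (fun t => (t, f i t)) (𝓝 s) (𝓝 (s, μ₀)) := by
        have := (continuousAt_id (x := s)).prodMk (hf i).continuousAt
        rwa [ContinuousAt, hf0 i] at this
      exact h4.eventually hcount
    obtain ⟨t, h1, h2, h3, h4⟩ := (h1.and (h2.and (h3.and hgt))).exists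
    suffices h5 : ∃ m : M, lam m t = f i₀ t by
      obtain ⟨m, hm⟩ := h5
      exact ⟨m, m.2, by rw [(h1 m hm).deriv_eq, hd]⟩
    by_contra! hcon
    -- Double count at t: over each value the members in M are at most as many as the local
    -- branches, and over f i₀ t there would be none. This contradicts the equality of the totals.
    let V : Finset ℝ := Finset.univ.image fun i => f i t
    have h5 : Fintype.card M = ∑ μ ∈ V, (Finset.univ.filter fun m : M => lam m t = μ).card :=
      Finset.card_eq_sum_card_fiberwise fun m _ => by
        obtain ⟨i, hi⟩ := h2 m
        exact Finset.mem_coe.2 (Finset.mem_image.2 ⟨i, Finset.mem_univ _, hi⟩)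
    have h6 : Fintype.card κ = ∑ μ ∈ V, (Finset.univ.filter fun i => f i t = μ).card :=
      Finset.card_eq_sum_card_fiberwise fun i _ =>
        Finset.mem_coe.2 (Finset.mem_image.2 ⟨i, Finset.mem_univ _, rfl⟩)
    have h7 : ∀ μ ∈ V, (Finset.univ.filter fun m : M => lam m t = μ).card
        ≤ (Finset.univ.filter fun i => f i t = μ).card := by
      intro μ hμ
      obtain ⟨i, -, rfl⟩ := Finset.mem_image.1 hμ
      obtain ⟨e'⟩ := h4 (f i t)
      rw [h3 i, Nat.card_eq_fintype_card, Fintype.card_subtype] at e'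
      rw [← Fintype.card_subtype (fun m : M => lam m t = f i t)]
      have h8 := Fintype.card_le_of_injective
        (fun m : {m : M // lam m t = f i t} => e' ⟨m.1, m.2⟩) fun a b hab => by
          have := congrArg Subtype.val (e'.injective hab)
          exact Subtype.ext (Subtype.ext this)
      rwa [Fintype.card_fin] at h8
    have h8 : ∑ μ ∈ V, (Finset.univ.filter fun m : M => lam m t = μ).card
        < ∑ μ ∈ V, (Finset.univ.filter fun i => f i t = μ).card := by
      refine Finset.sum_lt_sum h7 ⟨f i₀ t, Finset.mem_image.2 ⟨i₀, Finset.mem_univ _, rfl⟩, ?_⟩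
      rw [Finset.filter_eq_empty_iff.2 fun m _ => hcon m, Finset.card_empty]
      exact Finset.card_pos.2 ⟨i₀, by simp⟩
    omega

end Branches

end OperatorFamily

/-! ### Band functions and generalized eigenvectors of B -/

namespace Waveguide

open OperatorFamily Filter Topology

variable {γ : BoundaryCondition} {L : ℝ} {ε : Permittivity L}

lemma deriv_pencil (hL : 0 < L) (μ ξ : ℂ) :
    deriv (fun ξ => pencil γ hL ε ξ μ) ξ = -deriv (fun ξ => -deltaXi γ hL ξ) ξ := by
  have h := (analyticAt_deltaXi (γ := γ) hL ξ).differentiableAt.hasDerivAt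
  rw [h.fun_neg.deriv, neg_neg]
  exact (h.add_const _).deriv

/-- The neighborhood is one-sided because an arrangement says nothing to the left of -π; right
neighborhoods are available at every point of the half-open interval. -/
lemma IsAnalyticArrangement.eventually_equiv {hL : 0 < L} {lam : ℕ → ℝ → ℝ}
    (h : IsAnalyticArrangement γ hL ε lam) {ξ : ℝ} (hξ : ξ ∈ Ico (-Real.pi) Real.pi) :
    ∀ᶠ t in 𝓝[≥] ξ, ∀ μ, Nonempty ({m // lam m t = μ} ≃ Fin (bandMult γ hL ε t μ)) := by
  filter_upwards [Ico_mem_nhdsGE hξ.2] with t ht μ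
  have h1 := h.2 t ⟨hξ.1.trans ht.1, ht.2⟩ μ
  rw [← Module.finrank_eq_rank, ← bandMult, ← Cardinal.mk_fin] at h1
  exact Cardinal.eq.1 h1

/-- Critical points of the band functions at the level `ω²` correspond to generalized eigenvectors
of `B`. -/
lemma exists_deriv_eq_zero_iff_generalized {hL : 0 < L} {lam : ℕ → ℝ → ℝ}
    (h : IsAnalyticArrangement γ hL ε lam) (ω : ℝ) {ξ : ℝ} (hξ : ξ ∈ Ico (-Real.pi) Real.pi) :
    (∃ m, lam m ξ = ω ^ 2 ∧ deriv (lam m) ξ = 0) ↔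
      ∃ u₀ u₁ : H2 γ L, u₀ ≠ 0 ∧ B γ hL ε ω ξ u₀ = 0 ∧
        B γ hL ε ω ξ u₁ + deriv (B γ hL ε ω) ξ u₀ = 0 := by
  have := completeSpace_H2 γ hL
  have hP := isSymmetricPencil γ hL ε
  obtain ⟨κ, _, f, w, h1, h2, h3, h4, h5, h6, h7⟩ := hP.exists_local_eigenbasis ξ (ω ^ 2)
  rw [exists_deriv_eq_zero_iff_of_enumeration (mult := bandMult γ hL ε) h1 h2
    (h7.mono fun p hp => (finrank_eigenspace ε hL _ _).symm.trans hp)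
    (fun m => h.1 m ξ hξ) (h.eventually_equiv hξ),
    hP.exists_deriv_eq_zero_iff (fun i => (h1 i).differentiableAt) h2 h3 h4 h5 h6]
  have hB : B γ hL ε ω = fun ξ => pencil γ hL ε ξ ((ω : ℂ) ^ 2) := rfl
  have hAB : ∀ u : H2 γ L, -deltaXi γ hL ξ u - ((ω ^ 2 : ℝ) : ℂ) • epsOp γ ε u
      = -B γ hL ε ω ξ u := fun u => by
    have := congrArg (fun T : H2 γ L →L[ℂ] L2 L => T u)
      (neg_deltaXi_sub (γ := γ) ε hL ξ ((ω : ℂ) ^ 2))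
    rw [Complex.ofReal_pow]
    exact this
  refine exists_congr fun u₀ => exists_congr fun u₁ => and_congr_right fun _ => and_congr ?_ ?_
  · rw [← sub_eq_zero]
    change -deltaXi γ hL ξ u₀ - _ = 0 ↔ _
    rw [hAB, neg_eq_zero]
  · change -deltaXi γ hL ξ u₁ - _ + _ = 0 ↔ _
    rw [hAB, ← neg_eq_zero, hB, deriv_pencil, neg_apply]
    simp [add_comm]

end Waveguide

end

theorem mainTheorem9 (γ : Waveguide.BoundaryCondition) (L : ℝ) (hL : 0 < L)
    (ε : Waveguide.Permittivity L) (ω : ℝ) :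
    (∃ lam : ℕ → ℝ → ℝ, Waveguide.IsAnalyticArrangement γ hL ε lam) ∧
    ∀ lam : ℕ → ℝ → ℝ, Waveguide.IsAnalyticArrangement γ hL ε lam →
      ∀ ξ : ℝ, ξ ∈ Set.Ico (-Real.pi) Real.pi →
        ((OperatorFamily.IsCharacteristicValue (Waveguide.B γ hL ε ω) (ξ : ℂ) ∧
            ∃ r : ℕ, 1 < r ∧
              OperatorFamily.IsPartialNullMultiplicity (Waveguide.B γ hL ε ω) (ξ : ℂ) r) ↔
          ∃ m : ℕ, lam m ξ = ω ^ 2 ∧ deriv (lam m) ξ = 0) := by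
  refine ⟨Waveguide.exists_isAnalyticArrangement γ hL ε, fun lam hlam ξ hξ => ?_⟩
  rw [Waveguide.exists_deriv_eq_zero_iff_generalized hlam ω hξ]
  exact OperatorFamily.exists_one_lt_isPartialNullMultiplicity_iff
    ((Waveguide.analyticAt_deltaXi hL ξ).add analyticAt_const)
    (Waveguide.exists_multiplicity_le ε hL ((ω : ℂ) ^ 2) ξ)
    (Waveguide.isFinitePerturbation_pencil ε hL ξ ((ω : ℂ) ^ 2)).finiteDimensional_ker
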